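/- Let $K$ be a field and let $H$ be a Hopf algebra over $K$ with comultiplication $\Delta$, counit $\varepsilon$ and antipode $S$; write $\otimes=\otimes_K$, $\Delta(h)=h_{(1)}\otimes h_{(2)}$, and let $H^+=\ker\varepsilon$. Conventions. The category ${}^H\mathfrak M^H$ of $H$-bicomodules is monoidal for $\otimes$ with codiagonal coactions on both sides, and $H$ is an algebra in it with both coactions equal to $\Delta$. For a functor $G:\mathcal B\to\mathcal A$, let $\mathcal E_G$ be the class of morphisms $f$ of $\mathcal B$ such that $G(f)$ has a section in $\mathcal A$; an object $P$ of $\mathcal B$ is $\mathcal E_G$-projective if $\mathrm{Hom}_{\mathcal B}(P,f)$ is surjective for every $f\in\mathcal E_G$. An algebra $A$ in ${}^H\mathfrak M^H$ is formally smooth if $\Omega^1A=\ker(A\otimes A\to A)$, regarded as an $A$-bimodule in ${}^H\mathfrak M^H$, is $\mathcal E_U$-projective, where $U$ is the forgetful functor from $A$-bimodules in ${}^H\mathfrak M^H$ to ${}^H\mathfrak M^H$. A left-left Yetter–Drinfeld module over $H$ is a left $H$-module and left $H$-comodule $V$, with coaction $v\mapsto v_{\langle -1\rangle}\otimes v_{\langle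 0\rangle}$, such that $(hv)_{\langle -1\rangle}\otimes (hv)_{\langle 0\rangle}=h_{(1)}v_{\langle -1\rangle}S(h_{(3)})\otimes h_{(2)}v_{\langle 0\rangle}$ for all $h\in H$, $v\in V$; morphisms are the $H$-linear and $H$-colinear maps; the category is denoted ${}^H_H\mathcal{YD}$. The space $H^+$ is an object of it via $h\cdot x=hx$ and $x\mapsto x_{(1)}S(x_{(3)})\otimes x_{(2)}$. Let $G:{}^H_H\mathcal{YD}\to{}^H\mathfrak M$ be the functor to left $H$-comodules that forgets the action. A complete fs-section is a $K$-linear map $\tau:H^+\to H\otimes H^+$ such that for all $h\in H$, $x\in H^+$, writing $\tau(x)=\sum_i a_i\otimes b_i$: (i) $\tau(hx)=\sum_i ha_i\otimes b_i$; (ii) $\sum_i a_ib_i=x$; (iii) $\sum_i a_{i(1)}b_{i(1)}S(a_{i(3)}b_{i(3)})\otimes a_{i(2)}\otimes b_{i(2)}=x_{(1)}S(x_{(3)})\otimes\tau(x_{(2)})$. Proposition. The following assertions are equivalent: (a) $H$ is formally smooth as an algebra in ${}^H\mathfrak M^H$; (b) $H^+$ is $\mathcal E_G$-projective in ${}^H_H\mathcal{YD}$;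 (c) there exists a complete fs-section $\tau:H^+\to H\otimes H^+$. If moreover $H$ is finite dimensional over $K$, then (a), (b), (c) are also equivalent to: (d) there is a $K$-linear section $\tau:H^+\to H^+\otimes H^+$ of the multiplication $H^+\otimes H^+\to H^+$ which is left $H$-linear, where $H$ acts on $H^+\otimes H^+$ by left multiplication on the left factor, and which satisfies (iii) for all $x\in H^+$, where $\tau(x)=\sum_i a_i\otimes b_i$. -/

import Mathlib

open CategoryTheory
open scoped TensorProduct

universe w v u

set_option linter.unusedSimpArgs false

noncomputable section

namespace HopfSmooth

/-! ## Relative projectivity -/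

/-- The object `P` is `E_G`-projective, where `E_G` is the class of all morphisms `f` such that
`G(f)` splits, i.e. `G(f)` has a section. -/
def RelProjective {B : Type*} [Category* B] {A : Type*} [Category* A] (G : B ⥤ A) (P : B) : Prop :=
  ∀ ⦃X Y : B⦄ (f : X ⟶ Y), IsSplitEpi (G.map f) → ∀ g : P ⟶ Y, ∃ l : P ⟶ X, l ≫ f = g

/-! ## Coactions -/

section Coactions

variable {K : Type u} [Field K] {C : Type v} [AddCommGroup C] [Module K C] [Coalgebra K C]

variable (K C) in
/-- A left `C`-comodule structure on the vector space `M`. -/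
@[ext] structure LeftCoaction (M : Type*) [AddCommGroup M] [Module K M] where
  toLin : M →ₗ[K] C ⊗[K] M
  coassoc : (TensorProduct.assoc K C C M).toLinearMap ∘ₗ
    (Coalgebra.comul (R := K) (A := C)).rTensor M ∘ₗ toLin = toLin.lTensor C ∘ₗ toLin
  counit : (Coalgebra.counit (R := K) (A := C)).rTensor M ∘ₗ toLin = TensorProduct.mk K K M 1

variable (K C) in
/-- A right `C`-comodule structure on the vector space `M`. -/
@[ext] structure RightCoaction (M : Type*) [AddCommGroup M] [Module K M] where
  toLin : M →ₗ[K] M ⊗[K] C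
  coassoc : (TensorProduct.assoc K M C C).toLinearMap ∘ₗ toLin.rTensor C ∘ₗ toLin =
    (Coalgebra.comul (R := K) (A := C)).lTensor M ∘ₗ toLin
  counit : (Coalgebra.counit (R := K) (A := C)).lTensor M ∘ₗ toLin =
    (TensorProduct.mk K M K).flip 1

variable {M N : Type*} [AddCommGroup M] [Module K M] [AddCommGroup N] [Module K N]

/-- `f` is a morphism of left comodules. -/
def IsLeftColinear (ρ : LeftCoaction K C M) (σ : LeftCoaction K C N) (f : M →ₗ[K] N) : Prop :=
  σ.toLin ∘ₗ f = f.lTensor C ∘ₗ ρ.toLin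

/-- `f` is a morphism of right comodules. -/
def IsRightColinear (ρ : RightCoaction K C M) (σ : RightCoaction K C N) (f : M →ₗ[K] N) : Prop :=
  σ.toLin ∘ₗ f = f.rTensor C ∘ₗ ρ.toLin

/-- The left and the right coaction commute, so that `M` is a `C`-bicomodule. -/
def CoactionsCommute (ρ : LeftCoaction K C M) (σ : RightCoaction K C M) : Prop :=
  (TensorProduct.assoc K C M C).toLinearMap ∘ₗ ρ.toLin.rTensor C ∘ₗ σ.toLin =
    σ.toLin.lTensor C ∘ₗ ρ.toLin

/-- A left comodule structure restricts to a subspace `N` along which the coaction restricts. -/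
def LeftCoaction.restrict (ρ : LeftCoaction K C M) (i : N →ₗ[K] M) (p : M →ₗ[K] N)
    (hp : p ∘ₗ i = LinearMap.id) (r : N →ₗ[K] C ⊗[K] N)
    (hr : i.lTensor C ∘ₗ r = ρ.toLin ∘ₗ i) : LeftCoaction K C N where
  toLin := r
  coassoc := by
    have hinj : Function.Injective ((i.lTensor C).lTensor C) := by
      apply Function.LeftInverse.injective (g := (p.lTensor C).lTensor C)
      intro x
      rw [← LinearMap.comp_apply, ← LinearMap.lTensor_comp, ← LinearMap.lTensor_comp, hp]
      simp
    have h1 := fun x => LinearMap.congr_fun hr x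
    ext x
    apply hinj
    have h2 := LinearMap.congr_fun ρ.coassoc (i x)
    simp only [LinearMap.comp_apply, LinearEquiv.coe_coe] at h1 h2 ⊢
    have e1 : ∀ t : C ⊗[K] N, (i.lTensor C).lTensor C ((TensorProduct.assoc K C C N)
        ((Coalgebra.comul (R := K) (A := C)).rTensor N t)) = (TensorProduct.assoc K C C M)
        ((Coalgebra.comul (R := K) (A := C)).rTensor M (i.lTensor C t)) := by
      intro t
      induction t using TensorProduct.induction_on with
      | zero => simp
      | add a b ha hb => simp only [map_add, ha, hb]
      | tmul c n =>
        simp only [LinearMap.rTensor_tmul, LinearMap.lTensor_tmul]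
        generalize (Coalgebra.comul (R := K) c) = s
        induction s using TensorProduct.induction_on with
        | zero => simp
        | add a b ha hb => simp only [map_add, ha, hb, TensorProduct.add_tmul]
        | tmul c n => simp
    rw [e1, h1, h2, ← h1, ← LinearMap.lTensor_comp_apply, ← LinearMap.lTensor_comp_apply, hr]
  counit := by
    have hinj : Function.Injective (i.lTensor K) := by
      apply Function.LeftInverse.injective (g := p.lTensor K)
      intro x
      rw [← LinearMap.comp_apply, ← LinearMap.lTensor_comp, hp]
      simp
    ext x
    apply hinj
    have h2 := LinearMap.congr_fun ρ.counit (i x)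
    have h1 := LinearMap.congr_fun hr x
    simp only [LinearMap.comp_apply] at h1 h2 ⊢
    rw [← h1] at h2
    rw [← LinearMap.comp_apply, LinearMap.lTensor_comp_rTensor, ← LinearMap.rTensor_comp_lTensor,
      LinearMap.comp_apply, h2]
    simp

/-- A right comodule structure restricts to a subspace `N` along which the coaction restricts. -/
def RightCoaction.restrict (ρ : RightCoaction K C M) (i : N →ₗ[K] M) (p : M →ₗ[K] N)
    (hp : p ∘ₗ i = LinearMap.id) (r : N →ₗ[K] N ⊗[K] C)
    (hr : i.rTensor C ∘ₗ r = ρ.toLin ∘ₗ i) : RightCoaction K C N where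
  toLin := r
  coassoc := by
    have hinj : Function.Injective (i.rTensor (C ⊗[K] C)) := by
      apply Function.LeftInverse.injective (g := p.rTensor (C ⊗[K] C))
      intro x
      rw [← LinearMap.comp_apply, ← LinearMap.rTensor_comp, hp]
      simp
    have h1 := fun x => LinearMap.congr_fun hr x
    ext x
    apply hinj
    have h2 := LinearMap.congr_fun ρ.coassoc (i x)
    simp only [LinearMap.comp_apply, LinearEquiv.coe_coe] at h1 h2 ⊢
    have e1 : ∀ t : (N ⊗[K] C) ⊗[K] C, i.rTensor (C ⊗[K] C) ((TensorProduct.assoc K N C C) t) =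
        (TensorProduct.assoc K M C C) ((i.rTensor C).rTensor C t) := by
      intro t
      rw [← LinearEquiv.coe_coe, ← LinearEquiv.coe_coe, ← LinearMap.comp_apply,
        ← LinearMap.comp_apply]
      congr 1
      ext; simp
    rw [e1]
    have e2 : (i.rTensor C).rTensor C (r.rTensor C (r x)) =
        ρ.toLin.rTensor C (ρ.toLin (i x)) := by
      rw [← h1, ← LinearMap.rTensor_comp_apply, ← LinearMap.rTensor_comp_apply, hr]
    rw [e2, h2, ← h1, ← LinearMap.comp_apply, LinearMap.lTensor_comp_rTensor,
      ← LinearMap.rTensor_comp_lTensor, LinearMap.comp_apply]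
  counit := by
    have hinj : Function.Injective (i.rTensor K) := by
      apply Function.LeftInverse.injective (g := p.rTensor K)
      intro x
      rw [← LinearMap.comp_apply, ← LinearMap.rTensor_comp, hp]
      simp
    ext x
    apply hinj
    have h2 := LinearMap.congr_fun ρ.counit (i x)
    have h1 := LinearMap.congr_fun hr x
    simp only [LinearMap.comp_apply] at h1 h2 ⊢
    rw [← h1] at h2
    rw [← LinearMap.comp_apply, LinearMap.rTensor_comp_lTensor, ← LinearMap.lTensor_comp_rTensor,
      LinearMap.comp_apply, h2]
    simp

end Coactions

/-! ## Codiagonal coactions on tensor products -/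

section Codiagonal

variable {K : Type u} [Field K] {H : Type v} [Ring H] [Bialgebra K H]
variable {M N : Type*} [AddCommGroup M] [Module K M] [AddCommGroup N] [Module K N]
variable {P Q : Type*} [AddCommGroup P] [Module K P] [AddCommGroup Q] [Module K Q]

variable (K H M N) in
/-- `(g ⊗ m) ⊗ (h ⊗ n) ↦ g h ⊗ (m ⊗ n)`. -/
def leftMulMid : (H ⊗[K] M) ⊗[K] (H ⊗[K] N) →ₗ[K] H ⊗[K] (M ⊗[K] N) :=
  (LinearMap.mul' K H).rTensor (M ⊗[K] N) ∘ₗ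
    (TensorProduct.tensorTensorTensorComm K H M H N).toLinearMap

@[simp] lemma leftMulMid_tmul (g h : H) (m : M) (n : N) :
    leftMulMid K H M N ((g ⊗ₜ m) ⊗ₜ (h ⊗ₜ n)) = (g * h) ⊗ₜ (m ⊗ₜ n) := by
  simp [leftMulMid]

variable (K H M N) in
/-- `(m ⊗ g) ⊗ (n ⊗ h) ↦ (m ⊗ n) ⊗ g h`. -/
def rightMulMid : (M ⊗[K] H) ⊗[K] (N ⊗[K] H) →ₗ[K] (M ⊗[K] N) ⊗[K] H :=
  (LinearMap.mul' K H).lTensor (M ⊗[K] N) ∘ₗ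
    (TensorProduct.tensorTensorTensorComm K M H N H).toLinearMap

@[simp] lemma rightMulMid_tmul (g h : H) (m : M) (n : N) :
    rightMulMid K H M N ((m ⊗ₜ g) ⊗ₜ (n ⊗ₜ h)) = (m ⊗ₜ n) ⊗ₜ (g * h) := by
  simp [rightMulMid]

lemma leftMulMid_map (f : M →ₗ[K] P) (g : N →ₗ[K] Q) (s : H ⊗[K] M) (t : H ⊗[K] N) :
    leftMulMid K H P Q (f.lTensor H s ⊗ₜ g.lTensor H t) =
      (TensorProduct.map f g).lTensor H (leftMulMid K H M N (s ⊗ₜ t)) := by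
  induction s using TensorProduct.induction_on with
  | zero => simp
  | add a b ha hb => simp only [map_add, TensorProduct.add_tmul, ha, hb]
  | tmul x m =>
    induction t using TensorProduct.induction_on with
    | zero => simp
    | add a b ha hb => simp only [map_add, TensorProduct.tmul_add, ha, hb]
    | tmul y n => simp

lemma rightMulMid_map (f : M →ₗ[K] P) (g : N →ₗ[K] Q) (s : M ⊗[K] H) (t : N ⊗[K] H) :
    rightMulMid K H P Q (f.rTensor H s ⊗ₜ g.rTensor H t) =
      (TensorProduct.map f g).rTensor H (rightMulMid K H M N (s ⊗ₜ t)) := by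
  induction s using TensorProduct.induction_on with
  | zero => simp
  | add a b ha hb => simp only [map_add, TensorProduct.add_tmul, ha, hb]
  | tmul x m =>
    induction t using TensorProduct.induction_on with
    | zero => simp
    | add a b ha hb => simp only [map_add, TensorProduct.tmul_add, ha, hb]
    | tmul y n => simp

/-- The codiagonal left coaction `m ⊗ n ↦ m₍₋₁₎ n₍₋₁₎ ⊗ (m₍₀₎ ⊗ n₍₀₎)`. -/
def LeftCoaction.tensor (ρ : LeftCoaction K H M) (σ : LeftCoaction K H N) :
    LeftCoaction K H (M ⊗[K] N) where
  toLin := leftMulMid K H M N ∘ₗ TensorProduct.map ρ.toLin σ.toLin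
  coassoc := by
    ext m n
    have h1 := LinearMap.congr_fun ρ.coassoc m
    have h2 := LinearMap.congr_fun σ.coassoc n
    simp only [LinearMap.comp_apply, LinearEquiv.coe_coe, TensorProduct.AlgebraTensorModule.curry_apply,
      LinearMap.restrictScalars_self, TensorProduct.curry_apply, TensorProduct.map_tmul] at h1 h2 ⊢
    have eL : ∀ (s : H ⊗[K] M) (t : H ⊗[K] N),
        (TensorProduct.assoc K H H (M ⊗[K] N))
          ((Coalgebra.comul (R := K) (A := H)).rTensor (M ⊗[K] N) (leftMulMid K H M N (s ⊗ₜ t))) =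
        (leftMulMid K H M N).lTensor H (leftMulMid K H (H ⊗[K] M) (H ⊗[K] N)
          ((TensorProduct.assoc K H H M ((Coalgebra.comul (R := K) (A := H)).rTensor M s)) ⊗ₜ
           (TensorProduct.assoc K H H N ((Coalgebra.comul (R := K) (A := H)).rTensor N t)))) := by
      intro s t
      induction s using TensorProduct.induction_on with
      | zero => simp
      | add a b ha hb => simp only [map_add, TensorProduct.add_tmul, ha, hb]
      | tmul x m =>
        induction t using TensorProduct.induction_on with
        | zero => simp
        | add a b ha hb => simp only [map_add, TensorProduct.tmul_add, ha, hb]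
        | tmul y n =>
          simp only [leftMulMid_tmul, LinearMap.rTensor_tmul, Bialgebra.comul_mul]
          generalize (Coalgebra.comul (R := K) x) = X
          generalize (Coalgebra.comul (R := K) y) = Y
          induction X using TensorProduct.induction_on with
          | zero => simp
          | add a b ha hb => simp only [map_add, add_mul, TensorProduct.add_tmul, ha, hb]
          | tmul x1 x2 =>
            induction Y using TensorProduct.induction_on with
            | zero => simp
            | add a b ha hb => simp only [map_add, mul_add, TensorProduct.tmul_add,
                TensorProduct.add_tmul, ha, hb]
            | tmul y1 y2 => simp
    rw [eL, h1, h2, leftMulMid_map, ← LinearMap.comp_apply, ← LinearMap.lTensor_comp]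
  counit := by
    ext m n
    have h1 := LinearMap.congr_fun ρ.counit m
    have h2 := LinearMap.congr_fun σ.counit n
    simp only [LinearMap.comp_apply, TensorProduct.AlgebraTensorModule.curry_apply,
      LinearMap.restrictScalars_self, TensorProduct.curry_apply, TensorProduct.map_tmul] at h1 h2 ⊢
    have eL : ∀ (s : H ⊗[K] M) (t : H ⊗[K] N),
        (Coalgebra.counit (R := K) (A := H)).rTensor (M ⊗[K] N) (leftMulMid K H M N (s ⊗ₜ t)) =
        leftMulMid K K M N ((Coalgebra.counit (R := K) (A := H)).rTensor M s ⊗ₜ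
          (Coalgebra.counit (R := K) (A := H)).rTensor N t) := by
      intro s t
      induction s using TensorProduct.induction_on with
      | zero => simp
      | add a b ha hb => simp only [map_add, TensorProduct.add_tmul, ha, hb]
      | tmul x m =>
        induction t using TensorProduct.induction_on with
        | zero => simp
        | add a b ha hb => simp only [map_add, TensorProduct.tmul_add, ha, hb]
        | tmul y n => simp
    rw [eL, h1, h2]
    simp

/-- The codiagonal right coaction `m ⊗ n ↦ (m₍₀₎ ⊗ n₍₀₎) ⊗ m₍₁₎ n₍₁₎`. -/
def RightCoaction.tensor (ρ : RightCoaction K H M) (σ : RightCoaction K H N) :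
    RightCoaction K H (M ⊗[K] N) where
  toLin := rightMulMid K H M N ∘ₗ TensorProduct.map ρ.toLin σ.toLin
  coassoc := by
    ext m n
    have h1 := LinearMap.congr_fun ρ.coassoc m
    have h2 := LinearMap.congr_fun σ.coassoc n
    simp only [LinearMap.comp_apply, LinearEquiv.coe_coe, TensorProduct.AlgebraTensorModule.curry_apply,
      LinearMap.restrictScalars_self, TensorProduct.curry_apply, TensorProduct.map_tmul] at h1 h2 ⊢
    have eR : ∀ (s : M ⊗[K] H) (t : N ⊗[K] H),
        (Coalgebra.comul (R := K) (A := H)).lTensor (M ⊗[K] N) (rightMulMid K H M N (s ⊗ₜ t)) =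
        rightMulMid K (H ⊗[K] H) M N
          ((Coalgebra.comul (R := K) (A := H)).lTensor M s ⊗ₜ
           (Coalgebra.comul (R := K) (A := H)).lTensor N t) := by
      intro s t
      induction s using TensorProduct.induction_on with
      | zero => simp
      | add a b ha hb => simp only [map_add, TensorProduct.add_tmul, ha, hb]
      | tmul x m =>
        induction t using TensorProduct.induction_on with
        | zero => simp
        | add a b ha hb => simp only [map_add, TensorProduct.tmul_add, ha, hb]
        | tmul y n => simp
    have eA : ∀ (s : (M ⊗[K] H) ⊗[K] H) (t : (N ⊗[K] H) ⊗[K] H),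
        rightMulMid K (H ⊗[K] H) M N
          (TensorProduct.assoc K M H H s ⊗ₜ TensorProduct.assoc K N H H t) =
        TensorProduct.assoc K (M ⊗[K] N) H H ((rightMulMid K H M N).rTensor H
          (rightMulMid K H (M ⊗[K] H) (N ⊗[K] H) (s ⊗ₜ t))) := by
      intro s t
      induction s using TensorProduct.induction_on with
      | zero => simp
      | add a b ha hb => simp only [map_add, TensorProduct.add_tmul, ha, hb]
      | tmul x h =>
        induction t using TensorProduct.induction_on with
        | zero => simp
        | add a b ha hb => simp only [map_add, TensorProduct.tmul_add, ha, hb]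
        | tmul y g =>
          induction x using TensorProduct.induction_on with
          | zero => simp
          | add a b ha hb => simp only [map_add, TensorProduct.add_tmul, ha, hb]
          | tmul x1 x2 =>
            induction y using TensorProduct.induction_on with
            | zero => simp
            | add a b ha hb => simp only [map_add, TensorProduct.tmul_add, TensorProduct.add_tmul,
                ha, hb]
            | tmul y1 y2 => simp
    rw [eR, ← h1, ← h2, eA, rightMulMid_map, LinearMap.rTensor_comp, LinearMap.comp_apply]
  counit := by
    ext m n
    have h1 := LinearMap.congr_fun ρ.counit m
    have h2 := LinearMap.congr_fun σ.counit n
    simp only [LinearMap.comp_apply, TensorProduct.AlgebraTensorModule.curry_apply,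
      LinearMap.restrictScalars_self, TensorProduct.curry_apply, TensorProduct.map_tmul] at h1 h2 ⊢
    have eL : ∀ (s : M ⊗[K] H) (t : N ⊗[K] H),
        (Coalgebra.counit (R := K) (A := H)).lTensor (M ⊗[K] N) (rightMulMid K H M N (s ⊗ₜ t)) =
        rightMulMid K K M N ((Coalgebra.counit (R := K) (A := H)).lTensor M s ⊗ₜ
          (Coalgebra.counit (R := K) (A := H)).lTensor N t) := by
      intro s t
      induction s using TensorProduct.induction_on with
      | zero => simp
      | add a b ha hb => simp only [map_add, TensorProduct.add_tmul, ha, hb]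
      | tmul x m =>
        induction t using TensorProduct.induction_on with
        | zero => simp
        | add a b ha hb => simp only [map_add, TensorProduct.tmul_add, ha, hb]
        | tmul y n => simp
    rw [eL, h1, h2]
    simp

lemma LeftCoaction.tensor_tmul (ρ : LeftCoaction K H M) (σ : LeftCoaction K H N) (m : M) (n : N) :
    (ρ.tensor σ).toLin (m ⊗ₜ n) = leftMulMid K H M N (ρ.toLin m ⊗ₜ σ.toLin n) := rfl

lemma RightCoaction.tensor_tmul (ρ : RightCoaction K H M) (σ : RightCoaction K H N)
    (m : M) (n : N) :
    (ρ.tensor σ).toLin (m ⊗ₜ n) = rightMulMid K H M N (ρ.toLin m ⊗ₜ σ.toLin n) := rfl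

lemma CoactionsCommute.tensor {ρ : LeftCoaction K H M} {ρ' : RightCoaction K H M}
    {σ : LeftCoaction K H N} {σ' : RightCoaction K H N}
    (h : CoactionsCommute ρ ρ') (h' : CoactionsCommute σ σ') :
    CoactionsCommute (ρ.tensor σ) (ρ'.tensor σ') := by
  unfold CoactionsCommute at *
  ext m n
  have h1 := LinearMap.congr_fun h m
  have h2 := LinearMap.congr_fun h' n
  simp only [LinearMap.comp_apply, LinearEquiv.coe_coe, TensorProduct.AlgebraTensorModule.curry_apply,
    LinearMap.restrictScalars_self, TensorProduct.curry_apply, LeftCoaction.tensor_tmul,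
    RightCoaction.tensor_tmul] at h1 h2 ⊢
  have e1 : ∀ (s : M ⊗[K] H) (t : N ⊗[K] H),
      (ρ.tensor σ).toLin.rTensor H (rightMulMid K H M N (s ⊗ₜ t)) =
      (leftMulMid K H M N).rTensor H (rightMulMid K H _ _
        (ρ.toLin.rTensor H s ⊗ₜ σ.toLin.rTensor H t)) := by
    intro s t
    rw [rightMulMid_map, ← LinearMap.rTensor_comp_apply]
    rfl
  have e2 : ∀ (s : H ⊗[K] M) (t : H ⊗[K] N),
      (ρ'.tensor σ').toLin.lTensor H (leftMulMid K H M N (s ⊗ₜ t)) =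
      (rightMulMid K H M N).lTensor H (leftMulMid K H _ _
        (ρ'.toLin.lTensor H s ⊗ₜ σ'.toLin.lTensor H t)) := by
    intro s t
    rw [leftMulMid_map, ← LinearMap.lTensor_comp_apply]
    rfl
  rw [e1, e2, ← h1, ← h2]
  generalize ρ.toLin.rTensor H (ρ'.toLin m) = s
  generalize σ.toLin.rTensor H (σ'.toLin n) = t
  induction s using TensorProduct.induction_on with
  | zero => simp
  | add a b ha hb => simp only [map_add, TensorProduct.add_tmul, ha, hb]
  | tmul x h =>
    induction t using TensorProduct.induction_on with
    | zero => simp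
    | add a b ha hb => simp only [map_add, TensorProduct.tmul_add, ha, hb]
    | tmul y g =>
      induction x using TensorProduct.induction_on with
      | zero => simp
      | add a b ha hb => simp only [map_add, TensorProduct.add_tmul, ha, hb]
      | tmul x1 x2 =>
        induction y using TensorProduct.induction_on with
        | zero => simp
        | add a b ha hb => simp only [map_add, TensorProduct.tmul_add, TensorProduct.add_tmul,
            ha, hb]
        | tmul y1 y2 => simp

end Codiagonal


/-! ## Comodules and bicomodules -/

section Comodules

variable (K : Type u) [Field K] (C : Type v) [AddCommGroup C] [Module K C] [Coalgebra K C]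

/-- The objects of the category of left `C`-comodules. -/
structure LeftComod where
  carrier : Type w
  [addCommGroup : AddCommGroup carrier]
  [module : Module K carrier]
  coact : LeftCoaction K C carrier

/-- The objects of the category of `C`-bicomodules. -/
structure Bicomod where
  carrier : Type w
  [addCommGroup : AddCommGroup carrier]
  [module : Module K carrier]
  left : LeftCoaction K C carrier
  right : RightCoaction K C carrier
  comm : CoactionsCommute left right

attribute [instance] LeftComod.addCommGroup LeftComod.module Bicomod.addCommGroup Bicomod.module

variable {K C}

/-- Morphisms of left comodules: colinear maps. -/
@[ext] structure LeftComod.Hom (M N : LeftComod.{w} K C) where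
  toLin : M.carrier →ₗ[K] N.carrier
  colinear : IsLeftColinear M.coact N.coact toLin

/-- Morphisms of bicomodules: maps that are colinear on both sides. -/
@[ext] structure Bicomod.Hom (M N : Bicomod.{w} K C) where
  toLin : M.carrier →ₗ[K] N.carrier
  left : IsLeftColinear M.left N.left toLin
  right : IsRightColinear M.right N.right toLin

section

variable {M N P : Type*} [AddCommGroup M] [Module K M] [AddCommGroup N] [Module K N]
  [AddCommGroup P] [Module K P]

lemma IsLeftColinear.id (ρ : LeftCoaction K C M) : IsLeftColinear ρ ρ LinearMap.id := by
  simp [IsLeftColinear]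

lemma IsRightColinear.id (ρ : RightCoaction K C M) : IsRightColinear ρ ρ LinearMap.id := by
  simp [IsRightColinear]

lemma IsLeftColinear.comp {ρ : LeftCoaction K C M} {σ : LeftCoaction K C N}
    {τ : LeftCoaction K C P} {f : M →ₗ[K] N} {g : N →ₗ[K] P} (hg : IsLeftColinear σ τ g)
    (hf : IsLeftColinear ρ σ f) : IsLeftColinear ρ τ (g ∘ₗ f) := by
  unfold IsLeftColinear at *
  rw [← LinearMap.comp_assoc, hg, LinearMap.comp_assoc, hf, ← LinearMap.comp_assoc,
    LinearMap.lTensor_comp]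

lemma IsRightColinear.comp {ρ : RightCoaction K C M} {σ : RightCoaction K C N}
    {τ : RightCoaction K C P} {f : M →ₗ[K] N} {g : N →ₗ[K] P} (hg : IsRightColinear σ τ g)
    (hf : IsRightColinear ρ σ f) : IsRightColinear ρ τ (g ∘ₗ f) := by
  unfold IsRightColinear at *
  rw [← LinearMap.comp_assoc, hg, LinearMap.comp_assoc, hf, ← LinearMap.comp_assoc,
    LinearMap.rTensor_comp]

end

instance : Category (LeftComod.{w} K C) where
  Hom := LeftComod.Hom
  id M := ⟨LinearMap.id, .id _⟩
  comp f g := ⟨g.toLin ∘ₗ f.toLin, g.colinear.comp f.colinear⟩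

instance : Category (Bicomod.{w} K C) where
  Hom := Bicomod.Hom
  id M := ⟨LinearMap.id, .id _, .id _⟩
  comp f g := ⟨g.toLin ∘ₗ f.toLin, g.left.comp f.left, g.right.comp f.right⟩

end Comodules

section

variable {K : Type u} [Field K] {C : Type v} [AddCommGroup C] [Module K C] [Coalgebra K C]
variable {M N P : Type*} [AddCommGroup M] [Module K M] [AddCommGroup N] [Module K N]
  [AddCommGroup P] [Module K P]

lemma IsLeftColinear.of_comp {ρ : LeftCoaction K C M} {σ : LeftCoaction K C N}
    {τ : LeftCoaction K C P} {f : M →ₗ[K] N} {i : N →ₗ[K] P} (hi : Function.Injective i)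
    (h : IsLeftColinear σ τ i) (hf : IsLeftColinear ρ τ (i ∘ₗ f)) : IsLeftColinear ρ σ f := by
  unfold IsLeftColinear at *
  refine (LinearMap.cancel_left (Module.Flat.lTensor_preserves_injective_linearMap i hi)).1 ?_
  rw [← LinearMap.comp_assoc, ← h, LinearMap.comp_assoc, hf, LinearMap.lTensor_comp,
    LinearMap.comp_assoc]

lemma IsRightColinear.of_comp {ρ : RightCoaction K C M} {σ : RightCoaction K C N}
    {τ : RightCoaction K C P} {f : M →ₗ[K] N} {i : N →ₗ[K] P} (hi : Function.Injective i)
    (h : IsRightColinear σ τ i) (hf : IsRightColinear ρ τ (i ∘ₗ f)) : IsRightColinear ρ σ f := by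
  unfold IsRightColinear at *
  refine (LinearMap.cancel_left (Module.Flat.rTensor_preserves_injective_linearMap i hi)).1 ?_
  rw [← LinearMap.comp_assoc, ← h, LinearMap.comp_assoc, hf, LinearMap.rTensor_comp,
    LinearMap.comp_assoc]

lemma CoactionsCommute.of_comp {ρ : LeftCoaction K C N} {ρ' : RightCoaction K C N}
    {σ : LeftCoaction K C M} {σ' : RightCoaction K C M} (i : N →ₗ[K] M)
    (hi : Function.Injective i) (hl : IsLeftColinear ρ σ i) (hr : IsRightColinear ρ' σ' i)
    (h : CoactionsCommute σ σ') : CoactionsCommute ρ ρ' := by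
  unfold IsLeftColinear at hl
  unfold IsRightColinear at hr
  unfold CoactionsCommute at *
  refine (LinearMap.cancel_left (Module.Flat.lTensor_preserves_injective_linearMap (M := C) _
    (Module.Flat.rTensor_preserves_injective_linearMap (M := C) i hi))).1 ?_
  have e : (i.rTensor C).lTensor C ∘ₗ (TensorProduct.assoc K C N C).toLinearMap =
      (TensorProduct.assoc K C M C).toLinearMap ∘ₗ (i.lTensor C).rTensor C := by
    ext; simp
  calc _ = (TensorProduct.assoc K C M C).toLinearMap ∘ₗ
        ((i.lTensor C ∘ₗ ρ.toLin).rTensor C) ∘ₗ ρ'.toLin := by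
        rw [← LinearMap.comp_assoc, e, LinearMap.rTensor_comp]
        simp only [LinearMap.comp_assoc]
    _ = ((TensorProduct.assoc K C M C).toLinearMap ∘ₗ σ.toLin.rTensor C ∘ₗ σ'.toLin) ∘ₗ i := by
        rw [← hl, LinearMap.rTensor_comp]
        simp only [LinearMap.comp_assoc]
        rw [hr]
    _ = (σ'.toLin ∘ₗ i).lTensor C ∘ₗ ρ.toLin := by
        rw [h, LinearMap.comp_assoc, hl, LinearMap.lTensor_comp]
        simp only [LinearMap.comp_assoc]
    _ = _ := by
        rw [hr, LinearMap.lTensor_comp]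
        simp only [LinearMap.comp_assoc]

end

section

variable {K : Type u} [Field K] {H : Type v} [Ring H] [Bialgebra K H]
variable {M N P Q : Type*} [AddCommGroup M] [Module K M] [AddCommGroup N] [Module K N]
  [AddCommGroup P] [Module K P] [AddCommGroup Q] [Module K Q]

lemma IsLeftColinear.tensorMap {ρ : LeftCoaction K H M} {σ : LeftCoaction K H N}
    {ρ' : LeftCoaction K H P} {σ' : LeftCoaction K H Q} {f : M →ₗ[K] P} {g : N →ₗ[K] Q}
    (hf : IsLeftColinear ρ ρ' f) (hg : IsLeftColinear σ σ' g) :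
    IsLeftColinear (ρ.tensor σ) (ρ'.tensor σ') (TensorProduct.map f g) := by
  unfold IsLeftColinear at *
  ext m n
  have h1 := LinearMap.congr_fun hf m
  have h2 := LinearMap.congr_fun hg n
  simp only [LinearMap.comp_apply, TensorProduct.AlgebraTensorModule.curry_apply,
    LinearMap.restrictScalars_self, TensorProduct.curry_apply, TensorProduct.map_tmul,
    LeftCoaction.tensor_tmul] at h1 h2 ⊢
  rw [h1, h2, leftMulMid_map]

lemma IsRightColinear.tensorMap {ρ : RightCoaction K H M} {σ : RightCoaction K H N}
    {ρ' : RightCoaction K H P} {σ' : RightCoaction K H Q} {f : M →ₗ[K] P} {g : N →ₗ[K] Q}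
    (hf : IsRightColinear ρ ρ' f) (hg : IsRightColinear σ σ' g) :
    IsRightColinear (ρ.tensor σ) (ρ'.tensor σ') (TensorProduct.map f g) := by
  unfold IsRightColinear at *
  ext m n
  have h1 := LinearMap.congr_fun hf m
  have h2 := LinearMap.congr_fun hg n
  simp only [LinearMap.comp_apply, TensorProduct.AlgebraTensorModule.curry_apply,
    LinearMap.restrictScalars_self, TensorProduct.curry_apply, TensorProduct.map_tmul,
    RightCoaction.tensor_tmul] at h1 h2 ⊢
  rw [h1, h2, rightMulMid_map]

end

/-! ## Algebras in the monoidal category of bicomodules, and their bimodules -/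

section Bimodules

variable (K : Type u) [Field K] (H : Type v) [Ring H] [Bialgebra K H]

/-- An algebra in the monoidal category of `H`-bicomodules (with the codiagonal coactions on tensor
products over `K`): an algebra with a bicomodule structure such that the unit `K → A` and the
multiplication `A ⊗ A → A` are morphisms of bicomodules. -/
structure BicomodAlgebra where
  carrier : Type w
  [ring : Ring carrier]
  [algebra : Algebra K carrier]
  left : LeftCoaction K H carrier
  right : RightCoaction K H carrier
  comm : CoactionsCommute left right
  left_one : left.toLin 1 = 1 ⊗ₜ[K] 1
  right_one : right.toLin 1 = 1 ⊗ₜ[K] 1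
  left_mul : IsLeftColinear (left.tensor left) left (LinearMap.mul' K carrier)
  right_mul : IsRightColinear (right.tensor right) right (LinearMap.mul' K carrier)

attribute [instance] BicomodAlgebra.ring BicomodAlgebra.algebra

/-- The bialgebra `H` as an algebra in the category of `H`-bicomodules, both coactions being the
comultiplication. -/
def BicomodAlgebra.regular : BicomodAlgebra.{v} K H where
  carrier := H
  left := ⟨Coalgebra.comul, Coalgebra.coassoc, Coalgebra.rTensor_counit_comp_comul⟩
  right := ⟨Coalgebra.comul, Coalgebra.coassoc, Coalgebra.lTensor_counit_comp_comul⟩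
  comm := Coalgebra.coassoc
  left_one := Bialgebra.comul_one
  right_one := Bialgebra.comul_one
  left_mul := by
    unfold IsLeftColinear
    ext x y
    simp only [TensorProduct.AlgebraTensorModule.curry_apply, LinearMap.restrictScalars_self,
      TensorProduct.curry_apply, LinearMap.comp_apply, LinearMap.mul'_apply, Bialgebra.comul_mul,
      LeftCoaction.tensor_tmul]
    generalize (Coalgebra.comul (R := K) x) = s
    generalize (Coalgebra.comul (R := K) y) = t
    induction s using TensorProduct.induction_on with
    | zero => simp
    | add a b ha hb => simp only [map_add, add_mul, TensorProduct.add_tmul, ha, hb]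
    | tmul a b =>
      induction t using TensorProduct.induction_on with
      | zero => simp
      | add a b ha hb => simp only [map_add, mul_add, TensorProduct.tmul_add, ha, hb]
      | tmul c d => simp
  right_mul := by
    unfold IsRightColinear
    ext x y
    simp only [TensorProduct.AlgebraTensorModule.curry_apply, LinearMap.restrictScalars_self,
      TensorProduct.curry_apply, LinearMap.comp_apply, LinearMap.mul'_apply, Bialgebra.comul_mul,
      RightCoaction.tensor_tmul]
    generalize (Coalgebra.comul (R := K) x) = s
    generalize (Coalgebra.comul (R := K) y) = t
    induction s using TensorProduct.induction_on with
    | zero => simp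
    | add a b ha hb => simp only [map_add, add_mul, TensorProduct.add_tmul, ha, hb]
    | tmul a b =>
      induction t using TensorProduct.induction_on with
      | zero => simp
      | add a b ha hb => simp only [map_add, mul_add, TensorProduct.tmul_add, ha, hb]
      | tmul c d => simp

section ActionMaps

variable {K} {A M : Type*} [Ring A] [Algebra K A] [AddCommGroup M] [Module K M]

/-- The map `A ⊗ M → M` of a left module structure on `M`. -/
def leftActMap (l : A →ₐ[K] Module.End K M) : A ⊗[K] M →ₗ[K] M :=
  TensorProduct.lift l.toLinearMap

/-- The map `M ⊗ A → M` of a right module structure on `M`. -/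
def rightActMap (r : Aᵐᵒᵖ →ₐ[K] Module.End K M) : M ⊗[K] A →ₗ[K] M :=
  TensorProduct.lift (r.toLinearMap ∘ₗ (MulOpposite.opLinearEquiv K).toLinearMap).flip

@[simp] lemma leftActMap_tmul (l : A →ₐ[K] Module.End K M) (a : A) (m : M) :
    leftActMap l (a ⊗ₜ m) = l a m := rfl

@[simp] lemma rightActMap_tmul (r : Aᵐᵒᵖ →ₐ[K] Module.End K M) (a : A) (m : M) :
    rightActMap r (m ⊗ₜ a) = r (.op a) m := rfl

/-- A module structure restricts to a stable subspace. -/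
def restrictAct (l : A →ₐ[K] Module.End K M) (N : Submodule K M)
    (h : ∀ a, ∀ x ∈ N, l a x ∈ N) : A →ₐ[K] Module.End K N where
  toFun a := (l a).restrict (h a)
  map_one' := by ext; simp
  map_mul' a b := by ext; simp
  map_zero' := by ext; simp
  map_add' a b := by ext; simp
  commutes' c := by ext; simp [Module.algebraMap_end_apply]

@[simp] lemma restrictAct_coe (l : A →ₐ[K] Module.End K M) (N : Submodule K M)
    (h : ∀ a, ∀ x ∈ N, l a x ∈ N) (a : A) (x : N) : (restrictAct l N h a x : M) = l a x := rfl

end ActionMaps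

variable {K H}

/-- An `A`-bimodule in the monoidal category of `H`-bicomodules: an `A`-bimodule and an
`H`-bicomodule such that both actions `A ⊗ M → M` and `M ⊗ A → M` are morphisms of bicomodules. -/
structure BicomodBimod (A : BicomodAlgebra.{w} K H) extends Bicomod.{w} K H where
  leftAct : A.carrier →ₐ[K] Module.End K carrier
  rightAct : A.carrierᵐᵒᵖ →ₐ[K] Module.End K carrier
  act_comm : ∀ a b, Commute (leftAct a) (rightAct b)
  leftAct_left : IsLeftColinear (A.left.tensor left) left (leftActMap leftAct)
  leftAct_right : IsRightColinear (A.right.tensor right) right (leftActMap leftAct)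
  rightAct_left : IsLeftColinear (left.tensor A.left) left (rightActMap rightAct)
  rightAct_right : IsRightColinear (right.tensor A.right) right (rightActMap rightAct)

/-- Morphisms of `A`-bimodules in `H`-bicomodules: bilinear and bicolinear maps. -/
@[ext] structure BicomodBimod.Hom {A : BicomodAlgebra.{w} K H} (M N : BicomodBimod A)
    extends Bicomod.Hom M.toBicomod N.toBicomod where
  map_leftAct : ∀ a m, toLin (M.leftAct a m) = N.leftAct a (toLin m)
  map_rightAct : ∀ a m, toLin (M.rightAct a m) = N.rightAct a (toLin m)

instance (A : BicomodAlgebra.{w} K H) : Category (BicomodBimod A) where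
  Hom := BicomodBimod.Hom
  id M := { toHom := ⟨LinearMap.id, .id _, .id _⟩
            map_leftAct := fun _ _ => rfl, map_rightAct := fun _ _ => rfl }
  comp f g :=
    { toHom := ⟨g.toLin ∘ₗ f.toLin, g.left.comp f.left, g.right.comp f.right⟩
      map_leftAct := fun a m => by
        rw [LinearMap.comp_apply, LinearMap.comp_apply, f.map_leftAct, g.map_leftAct]
      map_rightAct := fun a m => by
        rw [LinearMap.comp_apply, LinearMap.comp_apply, f.map_rightAct, g.map_rightAct] }

/-- The functor that forgets the `A`-bimodule structure. -/
def BicomodBimod.forget (A : BicomodAlgebra.{w} K H) : BicomodBimod A ⥤ Bicomod.{w} K H where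
  obj M := M.toBicomod
  map f := BicomodBimod.Hom.toHom f

/-! ### The bimodule of noncommutative differential one-forms -/

namespace BicomodAlgebra

variable (A : BicomodAlgebra.{w} K H)

lemma left_mul_apply (x y : A.carrier) : A.left.toLin (x * y) =
    (LinearMap.mul' K A.carrier).lTensor H
      (leftMulMid K H _ _ (A.left.toLin x ⊗ₜ A.left.toLin y)) :=
  LinearMap.congr_fun A.left_mul (x ⊗ₜ y)

lemma right_mul_apply (x y : A.carrier) : A.right.toLin (x * y) =
    (LinearMap.mul' K A.carrier).rTensor H
      (rightMulMid K H _ _ (A.right.toLin x ⊗ₜ A.right.toLin y)) :=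
  LinearMap.congr_fun A.right_mul (x ⊗ₜ y)

/-- `a (x ⊗ y) = a x ⊗ y`. -/
def outerLeft : A.carrier →ₐ[K] Module.End K (A.carrier ⊗[K] A.carrier) :=
  (Module.End.rTensorAlgHom K A.carrier A.carrier).comp (Algebra.lmul K A.carrier)

/-- `(x ⊗ y) b = x ⊗ y b`. -/
def outerRight : A.carrierᵐᵒᵖ →ₐ[K] Module.End K (A.carrier ⊗[K] A.carrier) :=
  (Module.End.lTensorAlgHom K A.carrier A.carrier).comp (Algebra.lsmul K K A.carrier)

@[simp] lemma outerLeft_tmul (a x y : A.carrier) :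
    A.outerLeft a (x ⊗ₜ y) = (a * x) ⊗ₜ y := rfl

@[simp] lemma outerRight_tmul (b : A.carrierᵐᵒᵖ) (x y : A.carrier) :
    A.outerRight b (x ⊗ₜ y) = x ⊗ₜ (y * b.unop) := rfl

/-- `A ⊗ A` with the codiagonal coactions and the outer actions `a (x ⊗ y) b = a x ⊗ y b`. -/
def free : BicomodBimod A where
  carrier := A.carrier ⊗[K] A.carrier
  left := A.left.tensor A.left
  right := A.right.tensor A.right
  comm := A.comm.tensor A.comm
  leftAct := A.outerLeft
  rightAct := A.outerRight
  act_comm a b := by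
    unfold Commute SemiconjBy
    ext x y
    simp
  leftAct_left := by
    unfold IsLeftColinear
    ext a x y
    simp only [TensorProduct.AlgebraTensorModule.curry_apply, LinearMap.restrictScalars_self,
      TensorProduct.curry_apply, LinearMap.comp_apply, leftActMap_tmul, LeftCoaction.tensor_tmul,
      outerLeft_tmul, A.left_mul_apply a x]
    generalize A.left.toLin a = r
    generalize A.left.toLin x = s
    generalize A.left.toLin y = t
    induction r using TensorProduct.induction_on with
    | zero => simp
    | add _ _ ha hb => simp only [map_add, TensorProduct.tmul_add, TensorProduct.add_tmul, ha, hb]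
    | tmul a b =>
      induction s using TensorProduct.induction_on with
      | zero => simp
      | add _ _ ha hb => simp only [map_add, TensorProduct.tmul_add, TensorProduct.add_tmul, ha, hb]
      | tmul c d =>
        induction t using TensorProduct.induction_on with
        | zero => simp
        | add _ _ ha hb =>
          simp only [map_add, TensorProduct.tmul_add, TensorProduct.add_tmul, ha, hb]
        | tmul e f => simp [mul_assoc]
  leftAct_right := by
    unfold IsRightColinear
    ext a x y
    simp only [TensorProduct.AlgebraTensorModule.curry_apply, LinearMap.restrictScalars_self,
      TensorProduct.curry_apply, LinearMap.comp_apply, leftActMap_tmul, RightCoaction.tensor_tmul,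
      outerLeft_tmul, A.right_mul_apply a x]
    generalize A.right.toLin a = r
    generalize A.right.toLin x = s
    generalize A.right.toLin y = t
    induction r using TensorProduct.induction_on with
    | zero => simp
    | add _ _ ha hb => simp only [map_add, TensorProduct.tmul_add, TensorProduct.add_tmul, ha, hb]
    | tmul a b =>
      induction s using TensorProduct.induction_on with
      | zero => simp
      | add _ _ ha hb => simp only [map_add, TensorProduct.tmul_add, TensorProduct.add_tmul, ha, hb]
      | tmul c d =>
        induction t using TensorProduct.induction_on with
        | zero => simp
        | add _ _ ha hb =>
          simp only [map_add, TensorProduct.tmul_add, TensorProduct.add_tmul, ha, hb]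
        | tmul e f => simp [mul_assoc]
  rightAct_left := by
    unfold IsLeftColinear
    ext x y a
    simp only [TensorProduct.AlgebraTensorModule.curry_apply, LinearMap.restrictScalars_self,
      TensorProduct.curry_apply, LinearMap.comp_apply, rightActMap_tmul, LeftCoaction.tensor_tmul,
      outerRight_tmul, MulOpposite.unop_op, A.left_mul_apply y a]
    generalize A.left.toLin x = r
    generalize A.left.toLin y = s
    generalize A.left.toLin a = t
    induction r using TensorProduct.induction_on with
    | zero => simp
    | add _ _ ha hb => simp only [map_add, TensorProduct.tmul_add, TensorProduct.add_tmul, ha, hb]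
    | tmul a b =>
      induction s using TensorProduct.induction_on with
      | zero => simp
      | add _ _ ha hb => simp only [map_add, TensorProduct.tmul_add, TensorProduct.add_tmul, ha, hb]
      | tmul c d =>
        induction t using TensorProduct.induction_on with
        | zero => simp
        | add _ _ ha hb =>
          simp only [map_add, TensorProduct.tmul_add, TensorProduct.add_tmul, ha, hb]
        | tmul e f => simp [mul_assoc]
  rightAct_right := by
    unfold IsRightColinear
    ext x y a
    simp only [TensorProduct.AlgebraTensorModule.curry_apply, LinearMap.restrictScalars_self,
      TensorProduct.curry_apply, LinearMap.comp_apply, rightActMap_tmul, RightCoaction.tensor_tmul,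
      outerRight_tmul, MulOpposite.unop_op, A.right_mul_apply y a]
    generalize A.right.toLin x = r
    generalize A.right.toLin y = s
    generalize A.right.toLin a = t
    induction r using TensorProduct.induction_on with
    | zero => simp
    | add _ _ ha hb => simp only [map_add, TensorProduct.tmul_add, TensorProduct.add_tmul, ha, hb]
    | tmul a b =>
      induction s using TensorProduct.induction_on with
      | zero => simp
      | add _ _ ha hb => simp only [map_add, TensorProduct.tmul_add, TensorProduct.add_tmul, ha, hb]
      | tmul c d =>
        induction t using TensorProduct.induction_on with
        | zero => simp
        | add _ _ ha hb =>
          simp only [map_add, TensorProduct.tmul_add, TensorProduct.add_tmul, ha, hb]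
        | tmul e f => simp [mul_assoc]

/-- `Ω¹A`, the kernel of the multiplication `A ⊗ A → A`. -/
def kerMul : Submodule K (A.carrier ⊗[K] A.carrier) := LinearMap.ker (LinearMap.mul' K A.carrier)

/-- The projection `∑ a ⊗ b ↦ ∑ (a ⊗ b - a b ⊗ 1)` of `A ⊗ A` onto `Ω¹A`. -/
def kerMulProj : A.carrier ⊗[K] A.carrier →ₗ[K] A.kerMul :=
  (LinearMap.id - (TensorProduct.mk K A.carrier A.carrier).flip 1 ∘ₗ
    LinearMap.mul' K A.carrier).codRestrict A.kerMul (fun z => by simp [kerMul])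

lemma subtype_comp_kerMulProj : A.kerMul.subtype ∘ₗ A.kerMulProj =
    LinearMap.id - (TensorProduct.mk K A.carrier A.carrier).flip 1 ∘ₗ LinearMap.mul' K A.carrier :=
  rfl

lemma mul_comp_subtype : LinearMap.mul' K A.carrier ∘ₗ A.kerMul.subtype = 0 := by
  ext z
  exact z.2

lemma kerMulProj_comp_subtype : A.kerMulProj ∘ₗ A.kerMul.subtype = LinearMap.id := by
  refine LinearMap.cancel_left A.kerMul.injective_subtype |>.1 ?_
  rw [← LinearMap.comp_assoc, subtype_comp_kerMulProj, LinearMap.sub_comp, LinearMap.comp_assoc,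
    mul_comp_subtype]
  simp

lemma kerMul_left_aux : A.kerMul.subtype.lTensor H ∘ₗ
    (A.kerMulProj.lTensor H ∘ₗ (A.left.tensor A.left).toLin ∘ₗ A.kerMul.subtype) =
      (A.left.tensor A.left).toLin ∘ₗ A.kerMul.subtype := by
  rw [← LinearMap.comp_assoc, ← LinearMap.lTensor_comp, subtype_comp_kerMulProj,
    LinearMap.lTensor_sub, LinearMap.lTensor_comp, LinearMap.sub_comp, LinearMap.comp_assoc,
    ← LinearMap.comp_assoc _ _ ((LinearMap.mul' K A.carrier).lTensor H), ← A.left_mul,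
    LinearMap.comp_assoc, mul_comp_subtype, LinearMap.lTensor_id, LinearMap.id_comp,
    LinearMap.comp_zero, LinearMap.comp_zero]
  exact sub_zero ((A.left.tensor A.left).toLin ∘ₗ A.kerMul.subtype)

/-- The left coaction of `Ω¹A`, the restriction of the one of `A ⊗ A`. -/
def kerMulLeft : LeftCoaction K H A.kerMul :=
  (A.left.tensor A.left).restrict A.kerMul.subtype A.kerMulProj A.kerMulProj_comp_subtype
    (A.kerMulProj.lTensor H ∘ₗ (A.left.tensor A.left).toLin ∘ₗ A.kerMul.subtype)
    A.kerMul_left_aux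

lemma kerMul_left_colinear :
    IsLeftColinear A.kerMulLeft (A.left.tensor A.left) A.kerMul.subtype :=
  A.kerMul_left_aux.symm

lemma kerMul_right_aux : A.kerMul.subtype.rTensor H ∘ₗ
    (A.kerMulProj.rTensor H ∘ₗ (A.right.tensor A.right).toLin ∘ₗ A.kerMul.subtype) =
      (A.right.tensor A.right).toLin ∘ₗ A.kerMul.subtype := by
  rw [← LinearMap.comp_assoc, ← LinearMap.rTensor_comp, subtype_comp_kerMulProj,
    LinearMap.rTensor_sub, LinearMap.rTensor_comp, LinearMap.sub_comp, LinearMap.comp_assoc,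
    ← LinearMap.comp_assoc _ _ ((LinearMap.mul' K A.carrier).rTensor H), ← A.right_mul,
    LinearMap.comp_assoc, mul_comp_subtype, LinearMap.rTensor_id, LinearMap.id_comp,
    LinearMap.comp_zero, LinearMap.comp_zero]
  exact sub_zero ((A.right.tensor A.right).toLin ∘ₗ A.kerMul.subtype)

/-- The right coaction of `Ω¹A`, the restriction of the one of `A ⊗ A`. -/
def kerMulRight : RightCoaction K H A.kerMul :=
  (A.right.tensor A.right).restrict A.kerMul.subtype A.kerMulProj A.kerMulProj_comp_subtype
    (A.kerMulProj.rTensor H ∘ₗ (A.right.tensor A.right).toLin ∘ₗ A.kerMul.subtype)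
    A.kerMul_right_aux

lemma kerMul_right_colinear :
    IsRightColinear A.kerMulRight (A.right.tensor A.right) A.kerMul.subtype :=
  A.kerMul_right_aux.symm

lemma outerLeft_mem (a : A.carrier) (z) (hz : z ∈ A.kerMul) : A.outerLeft a z ∈ A.kerMul := by
  have h : LinearMap.mul' K A.carrier ∘ₗ A.outerLeft a =
      LinearMap.mulLeft K a ∘ₗ LinearMap.mul' K A.carrier := by
    ext x y
    simp [mul_assoc]
  have h' := LinearMap.congr_fun h z
  simp only [kerMul, LinearMap.mem_ker] at hz ⊢
  simpa [hz] using h'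

lemma outerRight_mem (a : A.carrierᵐᵒᵖ) (z) (hz : z ∈ A.kerMul) : A.outerRight a z ∈ A.kerMul := by
  have h : LinearMap.mul' K A.carrier ∘ₗ A.outerRight a =
      LinearMap.mulRight K a.unop ∘ₗ LinearMap.mul' K A.carrier := by
    ext x y
    simp [mul_assoc]
  have h' := LinearMap.congr_fun h z
  simp only [kerMul, LinearMap.mem_ker] at hz ⊢
  simpa [hz] using h'

lemma subtype_comp_leftAct :
    A.kerMul.subtype ∘ₗ leftActMap (restrictAct A.outerLeft A.kerMul A.outerLeft_mem) =
      leftActMap A.outerLeft ∘ₗ TensorProduct.map LinearMap.id A.kerMul.subtype :=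
  TensorProduct.ext' fun _ _ => rfl

lemma subtype_comp_rightAct :
    A.kerMul.subtype ∘ₗ rightActMap (restrictAct A.outerRight A.kerMul A.outerRight_mem) =
      rightActMap A.outerRight ∘ₗ TensorProduct.map A.kerMul.subtype LinearMap.id :=
  TensorProduct.ext' fun _ _ => rfl

/-- `Ω¹A` as an `A`-bimodule in `H`-bicomodules: the kernel of `A ⊗ A → A` with the restrictions
of the structure maps of `A ⊗ A`. -/
def omega : BicomodBimod A where
  carrier := A.kerMul
  left := A.kerMulLeft
  right := A.kerMulRight
  comm := .of_comp A.kerMul.subtype A.kerMul.injective_subtype A.kerMul_left_colinear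
    A.kerMul_right_colinear A.free.comm
  leftAct := restrictAct A.outerLeft A.kerMul A.outerLeft_mem
  rightAct := restrictAct A.outerRight A.kerMul A.outerRight_mem
  act_comm a b := by
    unfold Commute SemiconjBy
    ext x
    exact LinearMap.congr_fun (A.free.act_comm a b) (A.kerMul.subtype x)
  leftAct_left := by
    refine .of_comp A.kerMul.injective_subtype A.kerMul_left_colinear ?_
    rw [subtype_comp_leftAct]
    exact IsLeftColinear.comp A.free.leftAct_left
      ((IsLeftColinear.id A.left).tensorMap A.kerMul_left_colinear)
  leftAct_right := by
    refine .of_comp A.kerMul.injective_subtype A.kerMul_right_colinear ?_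
    rw [subtype_comp_leftAct]
    exact IsRightColinear.comp A.free.leftAct_right
      ((IsRightColinear.id A.right).tensorMap A.kerMul_right_colinear)
  rightAct_left := by
    refine .of_comp A.kerMul.injective_subtype A.kerMul_left_colinear ?_
    rw [subtype_comp_rightAct]
    exact IsLeftColinear.comp A.free.rightAct_left
      (A.kerMul_left_colinear.tensorMap (IsLeftColinear.id A.left))
  rightAct_right := by
    refine .of_comp A.kerMul.injective_subtype A.kerMul_right_colinear ?_
    rw [subtype_comp_rightAct]
    exact IsRightColinear.comp A.free.rightAct_right
      (A.kerMul_right_colinear.tensorMap (IsRightColinear.id A.right))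

/-- The algebra `A` in the monoidal category of `H`-bicomodules is formally smooth: `Ω¹A` is
projective relative to the morphisms of `A`-bimodules in `H`-bicomodules that split as morphisms
of `H`-bicomodules. -/
def FormallySmooth : Prop := RelProjective (BicomodBimod.forget A) A.omega

end BicomodAlgebra

end Bimodules

/-! ## Yetter-Drinfeld modules and the augmentation ideal -/

section Hopf

variable (K : Type u) [Field K] (H : Type v) [Ring H] [HopfAlgebra K H]

open HopfAlgebra

variable {K H} in
/-- `adCoact f c = f(c₍₁₎) S(f(c₍₃₎)) ⊗ c₍₂₎` for a linear map `f` from a coalgebra `C` to `H`. -/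
def adCoact {C : Type*} [AddCommMonoid C] [Module K C] [Coalgebra K C] (f : C →ₗ[K] H) :
    C →ₗ[K] H ⊗[K] C :=
  (LinearMap.mul' K H).rTensor C ∘ₗ (TensorProduct.assoc K H H C).symm.toLinearMap ∘ₗ
    TensorProduct.map f
      (TensorProduct.map (antipode K ∘ₗ f) LinearMap.id ∘ₗ (TensorProduct.comm K C C).toLinearMap) ∘ₗ
    (Coalgebra.comul (R := K) (A := C)).lTensor C ∘ₗ Coalgebra.comul

variable {K H} in
/-- `twist l (a ⊗ (b ⊗ c)) (g ⊗ m) = a g S(c) ⊗ b m` for a left `H`-module `M` with action `l`. -/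
def twist {M : Type*} [AddCommGroup M] [Module K M] (l : H →ₐ[K] Module.End K M) :
    H ⊗[K] (H ⊗[K] H) →ₗ[K] Module.End K (H ⊗[K] M) :=
  TensorProduct.lift ((LinearMap.mul K (Module.End K (H ⊗[K] M))).compl₁₂
    (LinearMap.rTensorHom M ∘ₗ LinearMap.mul K H)
    (TensorProduct.lift ((TensorProduct.mapBilinear (RingHom.id K) H M H M).flip.compl₁₂
      l.toLinearMap ((LinearMap.mul K H).flip ∘ₗ antipode K))))

variable {K H} in
@[simp] lemma twist_tmul {M : Type*} [AddCommGroup M] [Module K M] (l : H →ₐ[K] Module.End K M)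
    (a b c g : H) (m : M) :
    twist l (a ⊗ₜ (b ⊗ₜ c)) (g ⊗ₜ m) = (a * (g * antipode K c)) ⊗ₜ[K] l b m := by
  simp [twist]

/-- Left-left Yetter-Drinfeld modules: left modules and left comodules `V` over `H` such that
`(h v)₍₋₁₎ ⊗ (h v)₍₀₎ = h₍₁₎ v₍₋₁₎ S(h₍₃₎) ⊗ h₍₂₎ v₍₀₎`. -/
structure YetterDrinfeld extends LeftComod.{w} K H where
  act : H →ₐ[K] Module.End K carrier
  compat : ∀ h v, coact.toLin (act h v) =
    twist act ((Coalgebra.comul (R := K) (A := H)).lTensor H (Coalgebra.comul h)) (coact.toLin v)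

variable {K H} in
/-- Morphisms of Yetter-Drinfeld modules: linear and colinear maps. -/
@[ext] structure YetterDrinfeld.Hom (V W : YetterDrinfeld.{w} K H)
    extends LeftComod.Hom V.toLeftComod W.toLeftComod where
  map_act : ∀ h v, toLin (V.act h v) = W.act h (toLin v)

instance : Category (YetterDrinfeld.{w} K H) where
  Hom := YetterDrinfeld.Hom
  id M := { toHom := ⟨LinearMap.id, .id _⟩, map_act := fun _ _ => rfl }
  comp f g :=
    { toHom := ⟨g.toLin ∘ₗ f.toLin, g.colinear.comp f.colinear⟩
      map_act := fun a m => by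
        rw [LinearMap.comp_apply, LinearMap.comp_apply, f.map_act, g.map_act] }

/-- The functor from Yetter-Drinfeld modules to left comodules that forgets the action. -/
def YetterDrinfeld.forget : YetterDrinfeld.{w} K H ⥤ LeftComod.{w} K H where
  obj V := V.toLeftComod
  map f := YetterDrinfeld.Hom.toHom f


/-! ### The adjoint coaction -/

variable {K H}

lemma comul_comul (x : H) :
    TensorProduct.map (Coalgebra.comul (R := K) (A := H)) (Coalgebra.comul (R := K) (A := H))
      (Coalgebra.comul x) =
    (TensorProduct.assoc K H H (H ⊗[K] H)).symm
      ((TensorProduct.assoc K H H H).toLinearMap.lTensor H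
        (((Coalgebra.comul (R := K) (A := H)).rTensor H).lTensor H
          ((Coalgebra.comul (R := K) (A := H)).lTensor H (Coalgebra.comul x)))) := by
  rw [← LinearMap.lTensor_comp_apply, ← LinearMap.lTensor_comp_apply, LinearMap.comp_assoc,
    Coalgebra.coassoc, LinearMap.lTensor_comp_apply, ← Coalgebra.coassoc_apply]
  generalize (Coalgebra.comul (R := K) x) = t
  induction t using TensorProduct.induction_on with
  | zero => simp
  | add a b ha hb => simp only [map_add, ha, hb]
  | tmul a b =>
    simp only [TensorProduct.map_tmul, LinearMap.rTensor_tmul]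
    generalize (Coalgebra.comul (R := K) a) = s
    induction s using TensorProduct.induction_on with
    | zero => simp
    | add a b ha hb => simp only [map_add, TensorProduct.add_tmul, ha, hb]
    | tmul c d => simp

/-- The antipode is an anti-morphism of coalgebras. -/
lemma comul_antipode (x : H) : Coalgebra.comul (R := K) (antipode K x) =
    TensorProduct.map (antipode K) (antipode K) (TensorProduct.comm K H H (Coalgebra.comul x)) := by
  have h1 := LinearMap.comul_right_inv (R := K) (C := H)
  have h2 : WithConv.toConv (TensorProduct.map (antipode K) (antipode K) ∘ₗ
      (TensorProduct.comm K H H).toLinearMap ∘ₗ Coalgebra.comul (R := K) (A := H)) *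
      WithConv.toConv (Coalgebra.comul (R := K) (A := H)) = 1 := by
    apply WithConv.ext
    simp only [LinearMap.convMul_def, LinearMap.convOne_def, WithConv.ofConv_toConv]
    ext x
    have e1 : TensorProduct.map (TensorProduct.map (antipode K) (antipode K) ∘ₗ
        (TensorProduct.comm K H H).toLinearMap ∘ₗ Coalgebra.comul (R := K) (A := H))
        (Coalgebra.comul (R := K) (A := H)) (Coalgebra.comul x) =
        (TensorProduct.map (antipode K) (antipode K) ∘ₗ
        (TensorProduct.comm K H H).toLinearMap).rTensor (H ⊗[K] H)
        (TensorProduct.map (Coalgebra.comul (R := K) (A := H)) (Coalgebra.comul (R := K) (A := H))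
          (Coalgebra.comul x)) := by
      generalize (Coalgebra.comul (R := K) x) = t
      induction t using TensorProduct.induction_on with
      | zero => simp
      | add a b ha hb => simp only [map_add, ha, hb]
      | tmul a b => simp
    simp only [LinearMap.comp_apply]
    rw [e1, comul_comul]
    have e2 : ∀ t : H ⊗[K] (H ⊗[K] H), LinearMap.mul' K (H ⊗[K] H)
        ((TensorProduct.map (antipode K) (antipode K) ∘ₗ
        (TensorProduct.comm K H H).toLinearMap).rTensor (H ⊗[K] H)
          ((TensorProduct.assoc K H H (H ⊗[K] H)).symm
          ((TensorProduct.assoc K H H H).toLinearMap.lTensor H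
            (((Coalgebra.comul (R := K) (A := H)).rTensor H).lTensor H t)))) =
        TensorProduct.mk K H H 1 (LinearMap.mul' K H ((antipode K).rTensor H
          ((TensorProduct.lid K H).toLinearMap.lTensor H
          (((Coalgebra.counit (R := K) (A := H)).rTensor H).lTensor H t)))) := by
      intro t
      induction t using TensorProduct.induction_on with
      | zero => simp
      | add a b ha hb => simp only [map_add, ha, hb]
      | tmul a b =>
        induction b using TensorProduct.induction_on with
        | zero => simp
        | add b b' ha hb => simp only [map_add, TensorProduct.tmul_add, ha, hb]
        | tmul b c =>
          have e3 : ∀ s : H ⊗[K] H, LinearMap.mul' K (H ⊗[K] H)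
              ((TensorProduct.map (antipode K) (antipode K) ∘ₗ
              (TensorProduct.comm K H H).toLinearMap).rTensor (H ⊗[K] H)
                ((TensorProduct.assoc K H H (H ⊗[K] H)).symm
                  (a ⊗ₜ (TensorProduct.assoc K H H H) (s ⊗ₜ c)))) =
              (LinearMap.mul' K H ((antipode K).rTensor H s)) ⊗ₜ (antipode K a * c) := by
            intro s
            induction s using TensorProduct.induction_on with
            | zero => simp
            | add b b' ha hb => simp only [map_add, TensorProduct.add_tmul, TensorProduct.tmul_add,
                ha, hb]
            | tmul d e => simp
          have e4 := e3 (Coalgebra.comul b)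
          rw [mul_antipode_rTensor_comul_apply] at e4
          simp only [LinearMap.lTensor_tmul, LinearMap.rTensor_tmul, LinearEquiv.coe_coe] at e4 ⊢
          rw [e4]
          simp [Algebra.algebraMap_eq_smul_one, TensorProduct.smul_tmul]
    rw [e2, ← LinearMap.lTensor_comp_apply H
      ((Coalgebra.counit (R := K) (A := H)).rTensor H), Coalgebra.rTensor_counit_comp_comul,
      ← LinearMap.lTensor_comp_apply H (TensorProduct.lid K H).toLinearMap]
    have e' : (TensorProduct.lid K H).toLinearMap ∘ₗ TensorProduct.mk K K H 1 = LinearMap.id := by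
      ext; simp
    rw [e', LinearMap.lTensor_id, LinearMap.id_apply, mul_antipode_rTensor_comul_apply]
    simp [Algebra.algebraMap_eq_smul_one, Algebra.TensorProduct.one_def]
  have h3 := left_inv_eq_right_inv h2 h1
  exact (LinearMap.congr_fun (congrArg WithConv.ofConv h3) x).symm

lemma adCoact_apply {C : Type*} [AddCommMonoid C] [Module K C] [Coalgebra K C] (f : C →ₗ[K] H)
    (c : C) : adCoact f c = (LinearMap.mul' K H).rTensor C ((TensorProduct.assoc K H H C).symm
      (TensorProduct.map f (TensorProduct.map (antipode K ∘ₗ f) LinearMap.id ∘ₗ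
        (TensorProduct.comm K C C).toLinearMap)
        ((Coalgebra.comul (R := K) (A := C)).lTensor C (Coalgebra.comul c)))) := rfl

variable (K H) in
/-- `H` as a left comodule over itself via the comultiplication. -/
def comulCoaction : LeftCoaction K H H :=
  ⟨Coalgebra.comul, Coalgebra.coassoc, Coalgebra.rTensor_counit_comp_comul⟩

variable (K H) in
/-- The left adjoint coaction `h ↦ h₍₁₎ S(h₍₃₎) ⊗ h₍₂₎` of `H` on itself. -/
def adjointCoaction : LeftCoaction K H H :=
  ((comulCoaction K H).tensor (comulCoaction K H)).restrict
    ((antipode K (A := H)).lTensor H ∘ₗ Coalgebra.comul)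
    ((TensorProduct.rid K H).toLinearMap ∘ₗ (Coalgebra.counit (R := K) (A := H)).lTensor H)
    (by
      ext x
      simp only [LinearMap.comp_apply]
      rw [← LinearMap.lTensor_comp_apply, counit_comp_antipode]
      simp)
    (adCoact LinearMap.id) (by
      ext x
      have h : ((comulCoaction K H).tensor (comulCoaction K H)).toLin
          ((antipode K (A := H)).lTensor H (Coalgebra.comul x)) =
          leftMulMid K H H H (TensorProduct.map LinearMap.id
            (TensorProduct.map (antipode K) (antipode K) ∘ₗ (TensorProduct.comm K H H).toLinearMap)
            (TensorProduct.map Coalgebra.comul Coalgebra.comul (Coalgebra.comul x))) := by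
        generalize (Coalgebra.comul (R := K) x) = t
        induction t using TensorProduct.induction_on with
        | zero => simp
        | add a b ha hb => simp only [map_add, ha, hb]
        | tmul a b =>
          simp only [LinearMap.lTensor_tmul, LeftCoaction.tensor_tmul, comulCoaction,
            TensorProduct.map_tmul, comul_antipode, LinearMap.id_apply, LinearMap.comp_apply,
            LinearEquiv.coe_coe]
      simp only [LinearMap.comp_apply]
      rw [h, comul_comul, adCoact_apply]
      generalize (Coalgebra.comul (R := K) (A := H)).lTensor H (Coalgebra.comul x) = t
      induction t using TensorProduct.induction_on with
      | zero => simp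
      | add a b ha hb => simp only [map_add, ha, hb]
      | tmul a b =>
        induction b using TensorProduct.induction_on with
        | zero => simp
        | add a b ha hb => simp only [map_add, TensorProduct.tmul_add, ha, hb]
        | tmul b c =>
          simp only [TensorProduct.map_tmul, LinearMap.comp_apply, LinearMap.lTensor_tmul,
            LinearMap.rTensor_tmul, LinearEquiv.coe_coe, TensorProduct.comm_tmul,
            LinearMap.id_apply, TensorProduct.assoc_symm_tmul, LinearMap.mul'_apply]
          generalize (Coalgebra.comul (R := K) b) = s
          induction s using TensorProduct.induction_on with
          | zero => simp
          | add a b ha hb => simp only [map_add, TensorProduct.tmul_add, TensorProduct.add_tmul,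
              ha, hb]
          | tmul d e => simp)

lemma adjointCoaction_toLin : (adjointCoaction K H).toLin = adCoact LinearMap.id := rfl

lemma adCoact_mul (h x : H) : adCoact (K := K) LinearMap.id (h * x) =
    twist (Algebra.lmul K H) ((Coalgebra.comul (R := K) (A := H)).lTensor H (Coalgebra.comul h))
      (adCoact LinearMap.id x) := by
  have e : (Coalgebra.comul (R := K) (A := H)).lTensor H (Coalgebra.comul (h * x)) =
      (Coalgebra.comul (R := K) (A := H)).lTensor H (Coalgebra.comul h) *
      (Coalgebra.comul (R := K) (A := H)).lTensor H (Coalgebra.comul x) := by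
    rw [Bialgebra.comul_mul]
    exact map_mul (Algebra.TensorProduct.map (AlgHom.id K H) (Bialgebra.comulAlgHom K H)) _ _
  rw [adCoact_apply, adCoact_apply, e]
  generalize (Coalgebra.comul (R := K) (A := H)).lTensor H (Coalgebra.comul h) = s
  generalize (Coalgebra.comul (R := K) (A := H)).lTensor H (Coalgebra.comul x) = t
  induction s using TensorProduct.induction_on with
  | zero => simp
  | add a b ha hb => simp only [map_add, add_mul, LinearMap.add_apply, ha, hb]
  | tmul a b =>
    induction b using TensorProduct.induction_on with
    | zero => simp
    | add b b' ha hb => simp only [map_add, add_mul, TensorProduct.tmul_add, LinearMap.add_apply,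
        ha, hb]
    | tmul b c =>
      induction t using TensorProduct.induction_on with
      | zero => simp
      | add a b ha hb => simp only [map_add, mul_add, ha, hb]
      | tmul d g =>
        induction g using TensorProduct.induction_on with
        | zero => simp
        | add b b' ha hb => simp only [map_add, mul_add, TensorProduct.tmul_add, ha, hb]
        | tmul g k => simp [antipode_mul_antidistrib, mul_assoc]

variable (K H)

/-- The augmentation ideal `H⁺`, the kernel of the counit. -/
def augIdeal : Submodule K H := LinearMap.ker (Coalgebra.counit (R := K) (A := H))

/-- The projection `h ↦ h - ε(h) 1` of `H` onto `H⁺`. -/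
def augProj : H →ₗ[K] augIdeal K H :=
  (LinearMap.id - Algebra.linearMap K H ∘ₗ Coalgebra.counit).codRestrict (augIdeal K H)
    (fun z => by simp [augIdeal])

lemma augProj_comp_subtype : augProj K H ∘ₗ (augIdeal K H).subtype = LinearMap.id := by
  refine LinearMap.ext fun x => Subtype.ext ?_
  have hx : Coalgebra.counit (R := K) (x : H) = 0 := x.2
  change (x : H) - algebraMap K H (Coalgebra.counit (x : H)) = x
  rw [hx, map_zero, sub_zero]

lemma counit_adCoact (x : H) : (Coalgebra.counit (R := K) (A := H)).lTensor H
    (adCoact LinearMap.id x) = algebraMap K H (Coalgebra.counit x) ⊗ₜ 1 := by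
  have e : ∀ t : H ⊗[K] (H ⊗[K] H), (Coalgebra.counit (R := K) (A := H)).lTensor H
      ((LinearMap.mul' K H).rTensor H ((TensorProduct.assoc K H H H).symm
      (TensorProduct.map LinearMap.id (TensorProduct.map (antipode K ∘ₗ LinearMap.id)
        LinearMap.id ∘ₗ (TensorProduct.comm K H H).toLinearMap) t))) =
      (TensorProduct.mk K H K).flip 1 (LinearMap.mul' K H ((antipode K).lTensor H
        ((TensorProduct.lid K H).toLinearMap.lTensor H
          (((Coalgebra.counit (R := K) (A := H)).rTensor H).lTensor H t)))) := by
    intro t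
    induction t using TensorProduct.induction_on with
    | zero => simp
    | add a b ha hb => simp only [map_add, ha, hb]
    | tmul a b =>
      induction b using TensorProduct.induction_on with
      | zero => simp
      | add b b' ha hb => simp only [map_add, TensorProduct.tmul_add, ha, hb]
      | tmul b c => simp [← TensorProduct.tmul_smul]
  rw [adCoact_apply, e, ← LinearMap.lTensor_comp_apply H
    ((Coalgebra.counit (R := K) (A := H)).rTensor H), Coalgebra.rTensor_counit_comp_comul,
    ← LinearMap.lTensor_comp_apply H (TensorProduct.lid K H).toLinearMap]
  have e' : (TensorProduct.lid K H).toLinearMap ∘ₗ TensorProduct.mk K K H 1 = LinearMap.id := by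
    ext; simp
  rw [e', LinearMap.lTensor_id, LinearMap.id_apply, mul_antipode_lTensor_comul_apply]
  rfl

lemma aug_aux : (augIdeal K H).subtype.lTensor H ∘ₗ
    ((augProj K H).lTensor H ∘ₗ adCoact LinearMap.id ∘ₗ (augIdeal K H).subtype) =
      (adjointCoaction K H).toLin ∘ₗ (augIdeal K H).subtype := by
  have h : (augIdeal K H).subtype ∘ₗ augProj K H =
    LinearMap.id - Algebra.linearMap K H ∘ₗ Coalgebra.counit := rfl
  rw [← LinearMap.comp_assoc, ← LinearMap.lTensor_comp, h]
  ext x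
  have hx : Coalgebra.counit (R := K) (x : H) = 0 := x.2
  simp only [LinearMap.lTensor_sub, LinearMap.lTensor_comp, LinearMap.comp_apply,
    LinearMap.sub_apply, LinearMap.lTensor_id, LinearMap.id_apply, Submodule.subtype_apply,
    counit_adCoact, hx, map_zero, TensorProduct.zero_tmul, adjointCoaction_toLin]
  exact sub_zero _

/-- The left coaction `x ↦ x₍₁₎ S(x₍₃₎) ⊗ x₍₂₎` of `H` on `H⁺`. -/
def augCoaction : LeftCoaction K H (augIdeal K H) :=
  (adjointCoaction K H).restrict (augIdeal K H).subtype (augProj K H) (augProj_comp_subtype K H)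
    ((augProj K H).lTensor H ∘ₗ adCoact LinearMap.id ∘ₗ (augIdeal K H).subtype) (aug_aux K H)

/-- The defining property of the coaction of `H` on `H⁺`. -/
lemma augCoaction_coe (x : augIdeal K H) :
    (augIdeal K H).subtype.lTensor H ((augCoaction K H).toLin x) = adCoact LinearMap.id (x : H) :=
  LinearMap.congr_fun (aug_aux K H) x

/-- The action of `H` on `H⁺` by left multiplication. -/
def augAct : H →ₐ[K] Module.End K (augIdeal K H) :=
  restrictAct (Algebra.lmul K H) (augIdeal K H) (fun a x hx => by
    simp only [augIdeal, LinearMap.mem_ker] at hx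
    simp [augIdeal, hx])

/-- The Yetter-Drinfeld module `H⁺`. -/
def augYetterDrinfeld : YetterDrinfeld.{v} K H where
  carrier := augIdeal K H
  coact := augCoaction K H
  act := augAct K H
  compat h x := by
    apply Module.Flat.lTensor_preserves_injective_linearMap (M := H) (augIdeal K H).subtype
      (augIdeal K H).injective_subtype
    have e : ∀ (t : H ⊗[K] (H ⊗[K] H)) (z : H ⊗[K] augIdeal K H),
        (augIdeal K H).subtype.lTensor H (twist (augAct K H) t z) =
        twist (Algebra.lmul K H) t ((augIdeal K H).subtype.lTensor H z) := by
      intro t z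
      induction t using TensorProduct.induction_on with
      | zero => simp
      | add a b ha hb => simp only [map_add, LinearMap.add_apply, ha, hb]
      | tmul a b =>
        induction b using TensorProduct.induction_on with
        | zero => simp
        | add b b' ha hb => simp only [map_add, TensorProduct.tmul_add, LinearMap.add_apply, ha, hb]
        | tmul b c =>
          induction z using TensorProduct.induction_on with
          | zero => simp
          | add a b ha hb => simp only [map_add, ha, hb]
          | tmul g m =>
            simp only [twist_tmul, LinearMap.lTensor_tmul]
            rfl
    rw [e, augCoaction_coe, augCoaction_coe, ← adCoact_mul]
    rfl

/-! ### Complete fs-sections -/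

variable {K H}

/-- An fs-section: a linear map `τ : H⁺ → H ⊗ H⁺` such that, with `τ(x) = ∑ aᵢ ⊗ bᵢ`,
`τ(h x) = ∑ h aᵢ ⊗ bᵢ` and `∑ aᵢ bᵢ = x`. -/
structure IsFsSection (τ : augIdeal K H →ₗ[K] H ⊗[K] augIdeal K H) : Prop where
  map_act : ∀ h x, τ (augAct K H h x) = (LinearMap.mulLeft K h).rTensor (augIdeal K H) (τ x)
  mul_eq : ∀ x, leftActMap (augAct K H) (τ x) = x

/-- An fs-section `τ` is complete if, with `τ(x) = ∑ aᵢ ⊗ bᵢ`,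
`∑ aᵢ₍₁₎ bᵢ₍₁₎ S(aᵢ₍₃₎ bᵢ₍₃₎) ⊗ aᵢ₍₂₎ ⊗ bᵢ₍₂₎ = x₍₁₎ S(x₍₃₎) ⊗ τ(x₍₂₎)`. Both sides are compared in
`H ⊗ (H ⊗ H)`; on the left, `H ⊗ H` carries the tensor product coalgebra structure. -/
structure IsCompleteFsSection (τ : augIdeal K H →ₗ[K] H ⊗[K] augIdeal K H) : Prop
    extends IsFsSection τ where
  colinear : ∀ x, adCoact (LinearMap.mul' K H) ((augIdeal K H).subtype.lTensor H (τ x)) =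
    ((augIdeal K H).subtype.lTensor H ∘ₗ τ).lTensor H ((augCoaction K H).toLin x)

variable (K H) in
/-- The multiplication `H⁺ ⊗ H⁺ → H⁺`. -/
def augMul : augIdeal K H ⊗[K] augIdeal K H →ₗ[K] augIdeal K H :=
  leftActMap (augAct K H) ∘ₗ (augIdeal K H).subtype.rTensor (augIdeal K H)

/-- `τ` is a section of the multiplication `H⁺ ⊗ H⁺ → H⁺` that is left `H`-linear (for the action
on the left factor) and such that, with `τ(x) = ∑ aᵢ ⊗ bᵢ`,
`∑ aᵢ₍₁₎ bᵢ₍₁₎ S(aᵢ₍₃₎ bᵢ₍₃₎) ⊗ aᵢ₍₂₎ ⊗ bᵢ₍₂₎ = x₍₁₎ S(x₍₃₎) ⊗ τ(x₍₂₎)` in `H ⊗ (H ⊗ H)`. -/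
structure IsAugMulSection (τ : augIdeal K H →ₗ[K] augIdeal K H ⊗[K] augIdeal K H) : Prop where
  map_act : ∀ h x, τ (augAct K H h x) = (augAct K H h).rTensor (augIdeal K H) (τ x)
  section_eq : augMul K H ∘ₗ τ = LinearMap.id
  colinear : ∀ x, adCoact (LinearMap.mul' K H)
      (TensorProduct.map (augIdeal K H).subtype (augIdeal K H).subtype (τ x)) =
    (TensorProduct.map (augIdeal K H).subtype (augIdeal K H).subtype ∘ₗ τ).lTensor H
      ((augCoaction K H).toLin x)

end Hopf

end HopfSmooth

end

/-! The proof is the part of the correspondence between Hopf bimodules and Yetter–Drinfeld modules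
that is needed to match Ω¹H with H⁺. A Hopf bimodule X has the left adjoint action h ▹ m = h₁ m
S(h₂), which together with the left coaction makes all of X a Yetter–Drinfeld module and preserves
right coinvariants (`left_ad`, `IsCoinvariant.ad`). In the other direction a Yetter–Drinfeld module
V yields the Hopf bimodule V ⊗ H with diagonal left action, and V is recovered as its right
coinvariants V ⊗ 1.

Morphisms Ω¹H → X correspond to maps c : H⁺ → X that are left colinear, ▹-linear and have right
coinvariant values (`IsAdMap`). One restricts a morphism along x ↦ x₁ ⊗ S(x₂) = x ▹ (1 ⊗ 1).
Conversely d(p) = c(p₁ - ε(p₁)) p₂ is a derivation because (h₁ ▹ m) h₂ = h m, and ∑ p ⊗ q ↦ ∑ d(p) q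
is the morphism (`IsAdMap.lift`). The two constructions are inverse by `omega_hom_eq_lift` and
`IsAdMap.lift_augToOmega_apply`.

(a) ⇒ (b): tensor a lifting problem for H⁺ with H, solve it for Ω¹H, and restrict the solution to
H⁺; its values are coinvariant, so they come from the Yetter–Drinfeld module itself. (b) ⇒ (c): H ⊗
H⁺ carries the structure of the free Yetter–Drinfeld module on the comodule H⁺, multiplication onto
H⁺ is split colinearly by x ↦ 1 ⊗ x, and a Yetter–Drinfeld section of it is exactly a complete
fs-section. (c) ⇒ (a): a bicomodule section s turns g : Ω¹H → Y into a colinear map H⁺ → X, which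
freeness extends to H ⊗ H⁺ → X; precomposing with τ gives the map H⁺ → X to be lifted.

(c) ⇔ (d): for finite dimensional H every left linear map H⁺ → H has values in H⁺
(`counit_eq_zero_of_leftLinear`, by stabilization of the powers of H⁺), so an fs-section lands in H⁺
⊗ H⁺.

Sweedler computations are done with convolution products of families of operators indexed by H:
structure maps intertwine such families, and intertwining passes to convolution products, so the
identities reduce to associativity and cancellation of antipodes. -/

noncomputable section

namespace HopfSmooth

open HopfAlgebra

/-! ## Convolution products of operators -/

section Convolution

variable {K : Type u} [Field K] {H : Type v} [Ring H] [HopfAlgebra K H]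
variable {M N P : Type*} [AddCommGroup M] [Module K M] [AddCommGroup N] [Module K N]
  [AddCommGroup P] [Module K P]

/-- The convolution product `(f ⋆ g)(h) = f(h₍₁₎) g(h₍₂₎)` of families of operators. -/
def conv (f g : H →ₗ[K] Module.End K M) : H →ₗ[K] Module.End K M :=
  LinearMap.mul' K (Module.End K M) ∘ₗ TensorProduct.map f g ∘ₗ Coalgebra.comul

/-- The unit `h ↦ ε(h) id` of the convolution product. -/
def convUnit : H →ₗ[K] Module.End K M :=
  Algebra.linearMap K (Module.End K M) ∘ₗ Coalgebra.counit

infixr:70 " ⋆ " => conv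

lemma conv_apply (f g : H →ₗ[K] Module.End K M) (h : H) : (f ⋆ g) h =
    LinearMap.mul' K (Module.End K M) (TensorProduct.map f g (Coalgebra.comul h)) := rfl

lemma convUnit_apply (h : H) (m : M) :
    (convUnit : H →ₗ[K] Module.End K M) h m = Coalgebra.counit (R := K) h • m := rfl

lemma conv_assoc (f g k : H →ₗ[K] Module.End K M) : (f ⋆ g) ⋆ k = f ⋆ g ⋆ k :=
  congrArg WithConv.ofConv
    (mul_assoc (WithConv.toConv f) (WithConv.toConv g) (WithConv.toConv k))

lemma convUnit_conv (f : H →ₗ[K] Module.End K M) : convUnit ⋆ f = f :=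
  congrArg WithConv.ofConv (one_mul (WithConv.toConv f))

lemma conv_convUnit (f : H →ₗ[K] Module.End K M) : f ⋆ convUnit = f :=
  congrArg WithConv.ofConv (mul_one (WithConv.toConv f))

/-- The antipode reverses convolution products of elementwise commuting maps. -/
lemma conv_comp_antipode (f g : H →ₗ[K] Module.End K M) (hfg : ∀ a b, Commute (f a) (g b)) :
    (f ⋆ g) ∘ₗ antipode K = (g ∘ₗ antipode K) ⋆ (f ∘ₗ antipode K) := by
  refine LinearMap.ext fun h => ?_
  simp only [LinearMap.comp_apply, conv_apply, comul_antipode]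
  generalize (Coalgebra.comul (R := K) h) = t
  induction t using TensorProduct.induction_on with
  | zero => simp
  | add a b ha hb => simp only [map_add, ha, hb]
  | tmul a b => simp [(hfg _ _).eq]

/-- `e` transforms the family of operators `f` into the family of operators `g`. -/
def Intertwines (e : M →ₗ[K] N) (f : H →ₗ[K] Module.End K M) (g : H →ₗ[K] Module.End K N) : Prop :=
  ∀ h m, e (f h m) = g h (e m)

lemma Intertwines.comp {e : M →ₗ[K] N} {e' : N →ₗ[K] P} {f : H →ₗ[K] Module.End K M}
    {g : H →ₗ[K] Module.End K N} {k : H →ₗ[K] Module.End K P} (h' : Intertwines e' g k)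
    (h : Intertwines e f g) : Intertwines (e' ∘ₗ e) f k := fun x m => by
  rw [LinearMap.comp_apply, h, h', LinearMap.comp_apply]

lemma Intertwines.conv {e : M →ₗ[K] N} {f f' : H →ₗ[K] Module.End K M}
    {g g' : H →ₗ[K] Module.End K N} (h : Intertwines e f g) (h' : Intertwines e f' g') :
    Intertwines e (f ⋆ f') (g ⋆ g') := fun x m => by
  simp only [conv_apply]
  generalize (Coalgebra.comul (R := K) x) = t
  induction t using TensorProduct.induction_on with
  | zero => simp
  | add a b ha hb => simp only [map_add, LinearMap.add_apply, ha, hb]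
  | tmul a b => simp [h a, h' b]

lemma Intertwines.comp_antipode {e : M →ₗ[K] N} {f : H →ₗ[K] Module.End K M}
    {g : H →ₗ[K] Module.End K N} (h : Intertwines e f g) :
    Intertwines e (f ∘ₗ antipode K) (g ∘ₗ antipode K) := fun x => h (antipode K x)

/-- The operators `f(h) ⊗ id`. -/
def opL (N : Type*) [AddCommGroup N] [Module K N] (f : H →ₗ[K] Module.End K M) :
    H →ₗ[K] Module.End K (M ⊗[K] N) :=
  LinearMap.rTensorHom N ∘ₗ f

/-- The operators `id ⊗ f(h)`. -/
def opR (N : Type*) [AddCommGroup N] [Module K N] (f : H →ₗ[K] Module.End K M) :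
    H →ₗ[K] Module.End K (N ⊗[K] M) :=
  LinearMap.lTensorHom N ∘ₗ f

@[simp] lemma opL_tmul (f : H →ₗ[K] Module.End K M) (h : H) (m : M) (n : N) :
    opL N f h (m ⊗ₜ n) = f h m ⊗ₜ n := rfl

@[simp] lemma opR_tmul (f : H →ₗ[K] Module.End K M) (h : H) (m : M) (n : N) :
    opR N f h (n ⊗ₜ m) = n ⊗ₜ f h m := rfl

lemma opL_comp_antipode (f : H →ₗ[K] Module.End K M) :
    opL N (f ∘ₗ antipode K) = opL N f ∘ₗ antipode K := rfl

lemma opR_comp_antipode (f : H →ₗ[K] Module.End K M) :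
    opR N (f ∘ₗ antipode K) = opR N f ∘ₗ antipode K := rfl

lemma opL_conv (f g : H →ₗ[K] Module.End K M) : opL N (f ⋆ g) = opL N f ⋆ opL N g := by
  refine LinearMap.ext fun h => ?_
  change (Module.End.rTensorAlgHom K M N) ((f ⋆ g) h) = _
  simp only [conv_apply]
  generalize (Coalgebra.comul (R := K) h) = t
  induction t using TensorProduct.induction_on with
  | zero => simp
  | add a b ha hb => simp only [map_add, ha, hb]
  | tmul a b => simp [opL]; rfl

lemma opR_conv (f g : H →ₗ[K] Module.End K M) : opR N (f ⋆ g) = opR N f ⋆ opR N g := by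
  refine LinearMap.ext fun h => ?_
  change (Module.End.lTensorAlgHom K M N) ((f ⋆ g) h) = _
  simp only [conv_apply]
  generalize (Coalgebra.comul (R := K) h) = t
  induction t using TensorProduct.induction_on with
  | zero => simp
  | add a b ha hb => simp only [map_add, ha, hb]
  | tmul a b => simp [opR]; rfl

lemma Intertwines.lTensor {e : M →ₗ[K] N} {f : H →ₗ[K] Module.End K M}
    {g : H →ₗ[K] Module.End K N} (h : Intertwines e f g) :
    Intertwines (e.lTensor P) (opR P f) (opR P g) := fun x m => by
  induction m using TensorProduct.induction_on with
  | zero => simp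
  | add a b ha hb => simp only [map_add, ha, hb]
  | tmul a b => simp [h x]

lemma Intertwines.rTensor {e : M →ₗ[K] N} {f : H →ₗ[K] Module.End K M}
    {g : H →ₗ[K] Module.End K N} (h : Intertwines e f g) :
    Intertwines (e.rTensor P) (opL P f) (opL P g) := fun x m => by
  induction m using TensorProduct.induction_on with
  | zero => simp
  | add a b ha hb => simp only [map_add, ha, hb]
  | tmul a b => simp [h x]

lemma Intertwines.opL_lTensor (e : M →ₗ[K] N) (f : H →ₗ[K] Module.End K P) :
    Intertwines (e.lTensor P) (opL M f) (opL N f) := fun x m => by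
  induction m using TensorProduct.induction_on with
  | zero => simp
  | add a b ha hb => simp only [map_add, ha, hb]
  | tmul a b => simp

lemma Intertwines.opR_rTensor (e : M →ₗ[K] N) (f : H →ₗ[K] Module.End K P) :
    Intertwines (e.rTensor P) (opR M f) (opR N f) := fun x m => by
  induction m using TensorProduct.induction_on with
  | zero => simp
  | add a b ha hb => simp only [map_add, ha, hb]
  | tmul a b => simp

/-! ### Multiplication operators and the operators h₁ · S(h₃) ⊗ f(h₂). -/

variable (K H) in
/-- Left multiplications. -/
abbrev mulL : H →ₗ[K] Module.End K H := LinearMap.mul K H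

variable (K H) in
/-- Right multiplications. -/
abbrev mulR : H →ₗ[K] Module.End K H := (LinearMap.mul K H).flip

/-- The operator is k ↦ h₁ k S(h₂), and the antipode axiom collapses it only at k = 1. This is how
the H-factor of an element `m ⊗ 1` drops out of adjoint actions. -/
lemma mulL_conv_mulR_antipode (h : H) :
    (mulL K H ⋆ mulR K H ∘ₗ antipode K) h 1 = algebraMap K H (Coalgebra.counit h) := by
  rw [← mul_antipode_lTensor_comul_apply]
  simp only [conv_apply]
  generalize (Coalgebra.comul (R := K) h) = t
  induction t using TensorProduct.induction_on with
  | zero => simp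
  | add a b ha hb => simp only [map_add, LinearMap.add_apply, ha, hb]
  | tmul a b => simp

/-- The operators `h₍₁₎ · S(h₍₃₎) ⊗ f(h₍₂₎)` on `H ⊗ M`. -/
def adOp (f : H →ₗ[K] Module.End K M) : H →ₗ[K] Module.End K (H ⊗[K] M) :=
  opL M (mulL K H) ⋆ opR H f ⋆ opL M (mulR K H) ∘ₗ antipode K

/-- Bridge between the convolution form, whose factors can be regrouped with `conv_assoc`, and the
form in which the Yetter–Drinfeld condition is stated. -/
lemma adOp_eq_twist (l : H →ₐ[K] Module.End K M) (h : H) : adOp l.toLinearMap h =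
    twist l ((Coalgebra.comul (R := K) (A := H)).lTensor H (Coalgebra.comul h)) := by
  simp only [adOp, conv_apply]
  generalize (Coalgebra.comul (R := K) h) = t
  induction t using TensorProduct.induction_on with
  | zero => simp
  | add a b ha hb => simp only [map_add, ha, hb]
  | tmul a b =>
    simp only [TensorProduct.map_tmul, LinearMap.lTensor_tmul, LinearMap.mul'_apply, conv_apply]
    generalize (Coalgebra.comul (R := K) b) = t
    induction t using TensorProduct.induction_on with
    | zero => simp
    | add c d ha hb => simp only [map_add, mul_add, TensorProduct.tmul_add, ha, hb]
    | tmul c d => ext; simp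

lemma Intertwines.adOp {e : M →ₗ[K] N} {f : H →ₗ[K] Module.End K M}
    {g : H →ₗ[K] Module.End K N} (h : Intertwines e f g) :
    Intertwines (e.lTensor H) (adOp f) (adOp g) :=
  (Intertwines.opL_lTensor e _).conv
    (h.lTensor.conv (Intertwines.opL_lTensor e _).comp_antipode)

/-- The third leg acts by right multiplication after the antipode, and both reverse products, so the
reversals cancel. -/
lemma twist_mul (l : H →ₐ[K] Module.End K M) (s t : H ⊗[K] (H ⊗[K] H)) :
    twist l (s * t) = twist l s * twist l t := by
  induction s using TensorProduct.induction_on with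
  | zero => simp
  | add a b ha hb => simp only [map_add, add_mul, ha, hb]
  | tmul a b =>
    induction b using TensorProduct.induction_on with
    | zero => simp
    | add b b' ha hb => simp only [map_add, add_mul, TensorProduct.tmul_add, ha, hb]
    | tmul b c =>
      induction t using TensorProduct.induction_on with
      | zero => simp
      | add a b ha hb => simp only [map_add, mul_add, ha, hb]
      | tmul d g =>
        induction g using TensorProduct.induction_on with
        | zero => simp
        | add b b' ha hb => simp only [map_add, mul_add, TensorProduct.tmul_add, ha, hb]
        | tmul g k => ext; simp [antipode_mul_antidistrib, mul_assoc]

lemma adOp_mul (l : H →ₐ[K] Module.End K M) (a b : H) :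
    adOp l.toLinearMap (a * b) = adOp l.toLinearMap a * adOp l.toLinearMap b := by
  simp only [adOp_eq_twist]
  rw [← twist_mul]
  congr 1
  rw [Bialgebra.comul_mul]
  exact map_mul (Algebra.TensorProduct.map (AlgHom.id K H) (Bialgebra.comulAlgHom K H)) _ _

/-- The compatibility condition of a Yetter-Drinfeld module. -/
lemma YetterDrinfeld.intertwines (V : YetterDrinfeld.{w} K H) :
    Intertwines V.coact.toLin V.act.toLinearMap (adOp V.act.toLinearMap) := fun h v => by
  rw [adOp_eq_twist]
  exact V.compat h v

end Convolution

/-! ## Hopf bimodules and their adjoint action -/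

section HopfBimodules

variable {K : Type u} [Field K] {H : Type v} [Ring H] [HopfAlgebra K H]
variable {M : Type*} [AddCommGroup M] [Module K M]

variable (K H) in
/-- `H` as a right comodule over itself via the comultiplication. -/
def comulRightCoaction : RightCoaction K H H :=
  ⟨Coalgebra.comul, Coalgebra.coassoc, Coalgebra.lTensor_counit_comp_comul⟩

/-- The linear map underlying a right action. -/
def rightOp (r : Hᵐᵒᵖ →ₐ[K] Module.End K M) : H →ₗ[K] Module.End K M :=
  r.toLinearMap ∘ₗ (MulOpposite.opLinearEquiv K).toLinearMap

lemma rightOp_apply (r : Hᵐᵒᵖ →ₐ[K] Module.End K M) (h : H) : rightOp r h = r (.op h) := rfl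

/-- This and the next three lemmas express the colinearity of an action as an intertwining relation,
the form that `Intertwines.conv` can combine. -/
lemma leftActMap_leftColinear_iff (ρ : LeftCoaction K H M) (l : H →ₐ[K] Module.End K M) :
    IsLeftColinear ((comulCoaction K H).tensor ρ) ρ (leftActMap l) ↔
      Intertwines ρ.toLin l.toLinearMap (opL M (mulL K H) ⋆ opR H l.toLinearMap) := by
  have e : ∀ (h : H) (t : H ⊗[K] M),
      (leftActMap l).lTensor H (leftMulMid K H H M (Coalgebra.comul h ⊗ₜ t)) =
        (opL M (mulL K H) ⋆ opR H l.toLinearMap) h t := by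
    intro h t
    simp only [conv_apply]
    generalize (Coalgebra.comul (R := K) h) = s
    induction s using TensorProduct.induction_on with
    | zero => simp
    | add a b ha hb => simp only [map_add, TensorProduct.add_tmul, LinearMap.add_apply, ha, hb]
    | tmul a b =>
      induction t using TensorProduct.induction_on with
      | zero => simp
      | add a b ha hb => simp only [map_add, TensorProduct.tmul_add, ha, hb]
      | tmul c d => simp
  constructor
  · intro h x m
    rw [← e]
    exact LinearMap.congr_fun h (x ⊗ₜ m)
  · intro h
    refine TensorProduct.ext' fun x m => (h x m).trans ?_
    rw [← e]
    rfl

lemma leftActMap_rightColinear_iff (ρ : RightCoaction K H M) (l : H →ₐ[K] Module.End K M) :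
    IsRightColinear ((comulRightCoaction K H).tensor ρ) ρ (leftActMap l) ↔
      Intertwines ρ.toLin l.toLinearMap (opL H l.toLinearMap ⋆ opR M (mulL K H)) := by
  have e : ∀ (h : H) (t : M ⊗[K] H),
      (leftActMap l).rTensor H (rightMulMid K H H M (Coalgebra.comul h ⊗ₜ t)) =
        (opL H l.toLinearMap ⋆ opR M (mulL K H)) h t := by
    intro h t
    simp only [conv_apply]
    generalize (Coalgebra.comul (R := K) h) = s
    induction s using TensorProduct.induction_on with
    | zero => simp
    | add a b ha hb => simp only [map_add, TensorProduct.add_tmul, LinearMap.add_apply, ha, hb]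
    | tmul a b =>
      induction t using TensorProduct.induction_on with
      | zero => simp
      | add a b ha hb => simp only [map_add, TensorProduct.tmul_add, ha, hb]
      | tmul c d => simp
  constructor
  · intro h x m
    rw [← e]
    exact LinearMap.congr_fun h (x ⊗ₜ m)
  · intro h
    refine TensorProduct.ext' fun x m => (h x m).trans ?_
    rw [← e]
    rfl

lemma rightActMap_leftColinear_iff (ρ : LeftCoaction K H M) (r : Hᵐᵒᵖ →ₐ[K] Module.End K M) :
    IsLeftColinear (ρ.tensor (comulCoaction K H)) ρ (rightActMap r) ↔
      Intertwines ρ.toLin (rightOp r) (opL M (mulR K H) ⋆ opR H (rightOp r)) := by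
  have e : ∀ (h : H) (t : H ⊗[K] M),
      (rightActMap r).lTensor H (leftMulMid K H M H (t ⊗ₜ Coalgebra.comul h)) =
        (opL M (mulR K H) ⋆ opR H (rightOp r)) h t := by
    intro h t
    simp only [conv_apply]
    generalize (Coalgebra.comul (R := K) h) = s
    induction s using TensorProduct.induction_on with
    | zero => simp
    | add a b ha hb => simp only [map_add, TensorProduct.tmul_add, LinearMap.add_apply, ha, hb]
    | tmul a b =>
      induction t using TensorProduct.induction_on with
      | zero => simp
      | add a b ha hb => simp only [map_add, TensorProduct.add_tmul, ha, hb]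
      | tmul c d => simp [rightOp_apply]
  constructor
  · intro h x m
    rw [← e]
    exact LinearMap.congr_fun h (m ⊗ₜ x)
  · intro h
    refine TensorProduct.ext' fun m x => (h x m).trans ?_
    rw [← e]
    rfl

lemma rightActMap_rightColinear_iff (ρ : RightCoaction K H M) (r : Hᵐᵒᵖ →ₐ[K] Module.End K M) :
    IsRightColinear (ρ.tensor (comulRightCoaction K H)) ρ (rightActMap r) ↔
      Intertwines ρ.toLin (rightOp r) (opL H (rightOp r) ⋆ opR M (mulR K H)) := by
  have e : ∀ (h : H) (t : M ⊗[K] H),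
      (rightActMap r).rTensor H (rightMulMid K H M H (t ⊗ₜ Coalgebra.comul h)) =
        (opL H (rightOp r) ⋆ opR M (mulR K H)) h t := by
    intro h t
    simp only [conv_apply]
    generalize (Coalgebra.comul (R := K) h) = s
    induction s using TensorProduct.induction_on with
    | zero => simp
    | add a b ha hb => simp only [map_add, TensorProduct.tmul_add, LinearMap.add_apply, ha, hb]
    | tmul a b =>
      induction t using TensorProduct.induction_on with
      | zero => simp
      | add a b ha hb => simp only [map_add, TensorProduct.add_tmul, ha, hb]
      | tmul c d => simp [rightOp_apply]
  constructor
  · intro h x m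
    rw [← e]
    exact LinearMap.congr_fun h (m ⊗ₜ x)
  · intro h
    refine TensorProduct.ext' fun m x => (h x m).trans ?_
    rw [← e]
    rfl

/-! ### Hopf bimodules, the adjoint action and right coinvariants. -/

variable (K H) in
/-- Hopf bimodules: bimodules over `H` in the category of `H`-bicomodules. -/
abbrev HopfBimod := BicomodBimod (BicomodAlgebra.regular K H)

namespace HopfBimod

variable (X : HopfBimod K H)

/-- The left action of `H` on a Hopf bimodule. -/
def lact : H →ₐ[K] Module.End K X.carrier := X.leftAct

/-- The right action of `H` on a Hopf bimodule. -/
def ract : Hᵐᵒᵖ →ₐ[K] Module.End K X.carrier := X.rightAct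

lemma commute_lact_ract (a b : H) : Commute (X.lact a) (X.ract (.op b)) := X.act_comm a (.op b)

lemma left_lact : Intertwines X.left.toLin X.lact.toLinearMap
    (opL X.carrier (mulL K H) ⋆ opR H X.lact.toLinearMap) :=
  (leftActMap_leftColinear_iff _ _).1 X.leftAct_left

lemma right_lact : Intertwines X.right.toLin X.lact.toLinearMap
    (opL H X.lact.toLinearMap ⋆ opR X.carrier (mulL K H)) :=
  (leftActMap_rightColinear_iff _ _).1 X.leftAct_right

lemma left_ract : Intertwines X.left.toLin (rightOp X.ract)
    (opL X.carrier (mulR K H) ⋆ opR H (rightOp X.ract)) :=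
  (rightActMap_leftColinear_iff _ _).1 X.rightAct_left

lemma right_ract : Intertwines X.right.toLin (rightOp X.ract)
    (opL H (rightOp X.ract) ⋆ opR X.carrier (mulR K H)) :=
  (rightActMap_rightColinear_iff _ _).1 X.rightAct_right

/-- The left adjoint action `h ▹ m = h₍₁₎ m S(h₍₂₎)`. -/
def ad : H →ₐ[K] Module.End K X.carrier :=
  AlgHom.ofLinearMap (X.lact.toLinearMap ⋆ rightOp X.ract ∘ₗ antipode K)
    (by
      simp only [conv_apply, Bialgebra.comul_one, Algebra.TensorProduct.one_def,
        TensorProduct.map_tmul, LinearMap.comp_apply, antipode_one, rightOp_apply,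
        LinearMap.mul'_apply, AlgHom.toLinearMap_apply, map_one, MulOpposite.op_one, mul_one])
    (fun x y => by
      simp only [conv_apply, Bialgebra.comul_mul]
      generalize (Coalgebra.comul (R := K) x) = s
      generalize (Coalgebra.comul (R := K) y) = t
      induction s using TensorProduct.induction_on with
      | zero => simp
      | add a b ha hb => simp only [map_add, add_mul, ha, hb]
      | tmul a b =>
        induction t using TensorProduct.induction_on with
        | zero => simp
        | add a b ha hb => simp only [map_add, mul_add, ha, hb]
        | tmul c d =>
          simp only [Algebra.TensorProduct.tmul_mul_tmul, TensorProduct.map_tmul,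
            LinearMap.mul'_apply, LinearMap.comp_apply, rightOp_apply, AlgHom.toLinearMap_apply,
            antipode_mul_antidistrib, map_mul, MulOpposite.op_mul]
          have := (X.commute_lact_ract c (antipode K b)).eq
          simp only [mul_assoc]
          rw [← mul_assoc (X.lact c), this]
          simp only [mul_assoc])

lemma ad_toLinearMap : X.ad.toLinearMap = X.lact.toLinearMap ⋆ rightOp X.ract ∘ₗ antipode K := rfl

/-- The rule for the left action is convolved with the rule for the right action composed with S.
The antipode reverses the second one, so the two inner factors, acting on X, merge into the adjoint
action and the outer ones become h₁ · S(h₃). -/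
lemma left_ad : Intertwines X.left.toLin X.ad.toLinearMap (adOp X.ad.toLinearMap) := by
  have h := X.left_lact.conv X.left_ract.comp_antipode
  rw [conv_comp_antipode] at h
  · rw [ad_toLinearMap, adOp, opR_conv, opR_comp_antipode]
    simpa only [conv_assoc] using h
  · intro a b
    refine TensorProduct.ext' fun x m => ?_
    simp

/-- The left adjoint action makes a Hopf bimodule a Yetter-Drinfeld module. -/
def toYetterDrinfeld : YetterDrinfeld K H where
  carrier := X.carrier
  coact := X.left
  act := X.ad
  compat h v := by
    rw [← adOp_eq_twist]
    exact X.left_ad h v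

/-- The right coinvariants of a Hopf bimodule. -/
def IsCoinvariant (m : X.carrier) : Prop := X.right.toLin m = m ⊗ₜ 1

/-- The right coaction of h₁ m S(h₂) is h₁ m₀ S(h₄) ⊗ h₂ m₁ S(h₃). For m₁ = 1 the right-hand factor
contracts to a counit, which leaves (h ▹ m) ⊗ 1. -/
lemma IsCoinvariant.ad {m : X.carrier} (hm : X.IsCoinvariant m) (h : H) :
    X.IsCoinvariant (X.ad h m) := by
  have h1 := X.right_lact.conv X.right_ract.comp_antipode
  rw [conv_comp_antipode] at h1
  · let e : X.carrier →ₗ[K] X.carrier ⊗[K] H := (TensorProduct.mk K X.carrier H).flip 1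
    -- On the image of m ↦ m ⊗ 1 the middle factor acts through ε, so it corresponds to the
    -- convolution unit on X.
    have h2 : Intertwines e (X.lact.toLinearMap ⋆ convUnit ⋆ rightOp X.ract ∘ₗ antipode K)
        (opL H X.lact.toLinearMap ⋆ (opR X.carrier (mulL K H ⋆ mulR K H ∘ₗ antipode K)) ⋆
          (opL H (rightOp X.ract) ∘ₗ antipode K)) := by
      refine .conv (fun _ _ => rfl) (.conv (fun h m => ?_) fun _ _ => rfl)
      change _ = m ⊗ₜ[K] ((mulL K H ⋆ mulR K H ∘ₗ antipode K) h 1)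
      rw [mulL_conv_mulR_antipode, convUnit_apply]
      simp [e, Algebra.algebraMap_eq_smul_one, TensorProduct.smul_tmul]
    rw [convUnit_conv, opR_conv] at h2
    have h3 := h1 h m
    simp only [conv_assoc] at h2 h3
    have h4 := h2 h m
    rw [hm] at h3
    exact h3.trans h4.symm
  · intro a b
    refine TensorProduct.ext' fun x m => ?_
    simp

/-- `(h₍₁₎ ▹ m) h₍₂₎ = h m`. -/
lemma ad_ract (h : H) (m : X.carrier) : rightActMap X.ract
    ((X.ad.toLinearMap.flip m).rTensor H (Coalgebra.comul h)) = X.lact h m := by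
  -- In the opposite endomorphism algebra the product l * s * r applies l first and r last. There s
  -- * r is right multiplication by S(h₁) h₂ = ε(h), so h₁ m S(h₂) h₃ = h m becomes (l * s) * r = l.
  -- With the usual order of composition one would meet h₂ S(h₁), which need not collapse.
  let o : Module.End K X.carrier →ₗ[K] (Module.End K X.carrier)ᵐᵒᵖ :=
    (MulOpposite.opLinearEquiv K).toLinearMap
  let l := WithConv.toConv (o ∘ₗ X.lact.toLinearMap)
  let r := WithConv.toConv (o ∘ₗ rightOp X.ract)
  let s := WithConv.toConv (o ∘ₗ rightOp X.ract ∘ₗ antipode K)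
  have h1 : WithConv.toConv (o ∘ₗ X.ad.toLinearMap) = l * s := by
    refine WithConv.ext (LinearMap.ext fun x => ?_)
    simp only [LinearMap.convMul_def, ad_toLinearMap, LinearMap.comp_apply, conv_apply, l, s]
    generalize (Coalgebra.comul (R := K) x) = t
    induction t using TensorProduct.induction_on with
    | zero => simp
    | add a b ha hb => simp only [map_add, ha, hb]
    | tmul a b =>
      simp only [TensorProduct.map_tmul, LinearMap.mul'_apply, LinearMap.comp_apply, rightOp_apply,
        AlgHom.toLinearMap_apply, (X.commute_lact_ract a (antipode K b)).eq]
      rfl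
  have h2 : s * r = 1 := by
    refine WithConv.ext (LinearMap.ext fun x => ?_)
    have e : ∀ t : H ⊗[K] H, LinearMap.mul' K (Module.End K X.carrier)ᵐᵒᵖ
        (TensorProduct.map s.ofConv r.ofConv t) =
        o (rightOp X.ract (LinearMap.mul' K H ((antipode K).rTensor H t))) := by
      intro t
      induction t using TensorProduct.induction_on with
      | zero => simp
      | add a b ha hb => simp only [map_add, ha, hb]
      | tmul a b =>
        simp only [TensorProduct.map_tmul, LinearMap.mul'_apply, LinearMap.comp_apply,
          rightOp_apply, LinearMap.rTensor_tmul, MulOpposite.op_mul, map_mul, s, r]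
        rfl
    refine (e _).trans ?_
    rw [mul_antipode_rTensor_comul_apply, Algebra.algebraMap_eq_smul_one, map_smul, map_smul,
      rightOp_apply, MulOpposite.op_one, map_one]
    exact (Algebra.algebraMap_eq_smul_one _).symm
  have h3 : WithConv.toConv (o ∘ₗ X.ad.toLinearMap) * r = l := by
    rw [h1, mul_assoc, h2, mul_one]
  have h4 := congrArg MulOpposite.unop (LinearMap.congr_fun (congrArg WithConv.ofConv h3) h)
  refine Eq.trans ?_ (LinearMap.congr_fun h4 m)
  simp only [LinearMap.convMul_def, LinearMap.comp_apply]
  generalize (Coalgebra.comul (R := K) h) = t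
  induction t using TensorProduct.induction_on with
  | zero => simp
  | add a b ha hb => simp only [map_add, ha, hb, MulOpposite.unop_add, LinearMap.add_apply]
  | tmul a b => rfl

end HopfBimod

end HopfBimodules

/-! ## The Hopf bimodule `V ⊗ H` of a Yetter-Drinfeld module -/

section Induced

variable {K : Type u} [Field K] {H : Type v} [Ring H] [HopfAlgebra K H]

variable (K H) in
/-- The trivial right coaction `m ↦ m ⊗ 1`. -/
def trivialRightCoaction (M : Type*) [AddCommGroup M] [Module K M] : RightCoaction K H M where
  toLin := (TensorProduct.mk K M H).flip 1
  coassoc := by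
    ext; simp [Algebra.TensorProduct.one_def]
  counit := by
    ext; simp

lemma trivialRightCoaction_toLin {M : Type*} [AddCommGroup M] [Module K M] (m : M) :
    (trivialRightCoaction K H M).toLin m = m ⊗ₜ 1 := rfl

lemma coactionsCommute_trivial {M : Type*} [AddCommGroup M] [Module K M]
    (ρ : LeftCoaction K H M) : CoactionsCommute ρ (trivialRightCoaction K H M) := by
  refine LinearMap.ext fun m => ?_
  simp only [LinearMap.comp_apply, trivialRightCoaction_toLin, LinearMap.rTensor_tmul]
  generalize ρ.toLin m = t
  induction t using TensorProduct.induction_on with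
  | zero => simp
  | add a b ha hb => simp only [map_add, TensorProduct.add_tmul, ha, hb]
  | tmul a b => simp [trivialRightCoaction_toLin]

lemma coactionsCommute_comul : CoactionsCommute (comulCoaction K H) (comulRightCoaction K H) :=
  Coalgebra.coassoc

lemma trivial_tensor_tmul {M : Type*} [AddCommGroup M] [Module K M] (m : M) (h : H) :
    ((trivialRightCoaction K H M).tensor (comulRightCoaction K H)).toLin (m ⊗ₜ h) =
      (TensorProduct.assoc K M H H).symm (m ⊗ₜ Coalgebra.comul h) := by
  rw [RightCoaction.tensor_tmul, trivialRightCoaction_toLin]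
  change rightMulMid K H M H ((m ⊗ₜ 1) ⊗ₜ Coalgebra.comul h) = _
  generalize (Coalgebra.comul (R := K) h) = t
  induction t using TensorProduct.induction_on with
  | zero => simp
  | add a b ha hb => simp only [map_add, TensorProduct.tmul_add, ha, hb]
  | tmul a b => simp

/-- Once the two H-coordinates are multiplied, the operators contribute g S(h₁) h₂ k = ε(h) g k. -/
lemma leftMulMid_antipode_cancel {V N : Type*} [AddCommGroup V] [Module K V] [AddCommGroup N]
    [Module K N] :
    Intertwines (leftMulMid K H V N)
      ((opL (H ⊗[K] N) (opL V (mulR K H)) ∘ₗ antipode K) ⋆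
        opR (H ⊗[K] V) (opL N (mulL K H))) convUnit := by
  intro h z
  rw [convUnit_apply, conv_apply]
  have e : ∀ (s : H ⊗[K] H) (g : H) (v : V) (k : H) (n : N),
      leftMulMid K H V N (LinearMap.mul' K _ (TensorProduct.map
        (opL (H ⊗[K] N) (opL V (mulR K H)) ∘ₗ antipode K)
        (opR (H ⊗[K] V) (opL N (mulL K H))) s) ((g ⊗ₜ v) ⊗ₜ (k ⊗ₜ n))) =
      (g * LinearMap.mul' K H ((antipode K).rTensor H s) * k) ⊗ₜ (v ⊗ₜ n) := by
    intro s g v k n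
    induction s using TensorProduct.induction_on with
    | zero => simp
    | add a b ha hb => simp only [map_add, LinearMap.add_apply, ha, hb, mul_add, add_mul,
        TensorProduct.add_tmul]
    | tmul a b => simp [mul_assoc]
  induction z using TensorProduct.induction_on with
  | zero => simp
  | add a b ha hb => simp only [map_add, smul_add, ha, hb]
  | tmul a b =>
    induction a using TensorProduct.induction_on with
    | zero => simp
    | add a b ha hb => simp only [map_add, TensorProduct.add_tmul, smul_add, ha, hb]
    | tmul g v =>
      induction b using TensorProduct.induction_on with
      | zero => simp
      | add a b ha hb => simp only [map_add, TensorProduct.tmul_add, smul_add, ha, hb]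
      | tmul k n =>
        rw [e, mul_antipode_rTensor_comul_apply]
        simp [Algebra.algebraMap_eq_smul_one, TensorProduct.smul_tmul']

/-- The coaction of h₁v ⊗ h₂k is h₁ v₋₁ S(h₃) h₄ k₁ ⊗ (h₂ v₀ ⊗ h₅ k₂), and S(h₃) h₄ cancels. The
lemma serves both for the left action on V ⊗ H and, with V = H under left multiplication, for the
colinearity of Δ. -/
lemma intertwines_diagonal {V : Type*} [AddCommGroup V] [Module K V] (ρ : LeftCoaction K H V)
    (l : H →ₗ[K] Module.End K V) (hl : Intertwines ρ.toLin l (adOp l)) :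
    Intertwines (ρ.tensor (comulCoaction K H)).toLin (opL H l ⋆ opR V (mulL K H))
      (opL _ (mulL K H) ⋆ opR H (opL H l ⋆ opR V (mulL K H))) := by
  have h1 : Intertwines (TensorProduct.map ρ.toLin (comulCoaction K H).toLin)
      (opL H l) (opL (H ⊗[K] H) (adOp l)) := by
    intro h z
    induction z using TensorProduct.induction_on with
    | zero => simp
    | add a b ha hb => simp only [map_add, ha, hb]
    | tmul a b => simp only [opL_tmul, TensorProduct.map_tmul, hl h a]
  have h2 : Intertwines (TensorProduct.map ρ.toLin (comulCoaction K H).toLin)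
      (opR V (mulL K H))
      (opR (H ⊗[K] V) (opL H (mulL K H) ⋆ opR H (mulL K H))) := by
    intro h z
    induction z using TensorProduct.induction_on with
    | zero => simp
    | add a b ha hb => simp only [map_add, ha, hb]
    | tmul a b =>
      simp only [opR_tmul, TensorProduct.map_tmul]
      congr 1
      simp only [comulCoaction, LinearMap.mul_apply', Bialgebra.comul_mul, conv_apply]
      generalize (Coalgebra.comul (R := K) h) = t
      generalize (Coalgebra.comul (R := K) b) = s
      induction t using TensorProduct.induction_on with
      | zero => simp
      | add a b ha hb => simp only [map_add, add_mul, LinearMap.add_apply, ha, hb]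
      | tmul a b =>
        induction s using TensorProduct.induction_on with
        | zero => simp
        | add a b ha hb => simp only [map_add, mul_add, ha, hb]
        | tmul c d => simp
  have h3 := h1.conv h2
  simp only [adOp, opL_conv, opR_conv, conv_assoc, opL_comp_antipode] at h3
  -- The factors in `m1`, `m2` and `m3` pass through the multiplication of the two H-coordinates;
  -- the remaining adjacent pair is removed by `leftMulMid_antipode_cancel`.
  have m1 : Intertwines (leftMulMid K H V H)
      (opL (H ⊗[K] H) (opL V (mulL K H))) (opL _ (mulL K H)) := by
    intro h z
    have : leftMulMid K H V H ∘ₗ (opL (H ⊗[K] H) (opL V (mulL K H)) h) =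
      (opL _ (mulL K H) h) ∘ₗ leftMulMid K H V H := by
      ext; simp [mul_assoc]
    exact LinearMap.congr_fun this z
  have m2 : Intertwines (leftMulMid K H V H)
      (opL (H ⊗[K] H) (opR H l)) (opR H (opL H l)) := by
    intro h z
    have : leftMulMid K H V H ∘ₗ (opL (H ⊗[K] H) (opR H l) h) =
      (opR H (opL H l) h) ∘ₗ leftMulMid K H V H := by
      ext; simp
    exact LinearMap.congr_fun this z
  have m3 : Intertwines (leftMulMid K H V H)
      (opR (H ⊗[K] V) (opR H (mulL K H))) (opR H (opR V (mulL K H))) := by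
    intro h z
    have : leftMulMid K H V H ∘ₗ (opR (H ⊗[K] V) (opR H (mulL K H)) h) =
      (opR H (opR V (mulL K H)) h) ∘ₗ leftMulMid K H V H := by
      ext; simp
    exact LinearMap.congr_fun this z
  have h4 := m1.conv (m2.conv (leftMulMid_antipode_cancel.conv m3))
  simp only [convUnit_conv, conv_assoc] at h4
  rw [opR_conv]
  exact h4.comp h3

namespace YetterDrinfeld

variable (V : YetterDrinfeld.{w} K H)

/-- The diagonal action `h (v ⊗ k) = h₍₁₎ v ⊗ h₍₂₎ k` on `V ⊗ H`. -/
def diagAct : H →ₐ[K] Module.End K (V.carrier ⊗[K] H) :=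
  (Module.endTensorEndAlgHom (R := K) (A := K) (M := V.carrier) (N := H)).comp
    ((Algebra.TensorProduct.map V.act (Algebra.lmul K H)).comp (Bialgebra.comulAlgHom K H))

lemma diagAct_toLinearMap :
    V.diagAct.toLinearMap = opL H V.act.toLinearMap ⋆ opR V.carrier (mulL K H) := by
  refine LinearMap.ext fun h => ?_
  simp only [diagAct, AlgHom.toLinearMap_apply, AlgHom.comp_apply, conv_apply,
    Bialgebra.comulAlgHom_apply]
  generalize (Coalgebra.comul (R := K) h) = t
  induction t using TensorProduct.induction_on with
  | zero => simp
  | add a b ha hb => simp only [map_add, ha, hb]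
  | tmul a b =>
    refine TensorProduct.ext' fun x y => ?_
    simp
    rfl

lemma intertwines_diagAct_left :
    Intertwines (V.coact.tensor (comulCoaction K H)).toLin V.diagAct.toLinearMap
      (opL _ (mulL K H) ⋆ opR H V.diagAct.toLinearMap) := by
  rw [diagAct_toLinearMap]
  exact intertwines_diagonal V.coact V.act.toLinearMap V.intertwines

lemma intertwines_diagAct_right :
    Intertwines ((trivialRightCoaction K H V.carrier).tensor (comulRightCoaction K H)).toLin
      V.diagAct.toLinearMap (opL H V.diagAct.toLinearMap ⋆ opR _ (mulL K H)) := by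
  rw [diagAct_toLinearMap, opL_conv, conv_assoc]
  refine Intertwines.conv (fun h z => ?_) fun h z => ?_
  · induction z using TensorProduct.induction_on with
    | zero => simp
    | add a b ha hb => simp only [map_add, ha, hb]
    | tmul a b =>
      simp only [opL_tmul, trivial_tensor_tmul]
      generalize (Coalgebra.comul (R := K) b) = t
      induction t using TensorProduct.induction_on with
      | zero => simp
      | add a b ha hb => simp only [map_add, TensorProduct.tmul_add, ha, hb]
      | tmul c d => simp
  · induction z using TensorProduct.induction_on with
    | zero => simp
    | add a b ha hb => simp only [map_add, ha, hb]
    | tmul a b =>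
      simp only [opR_tmul, trivial_tensor_tmul, LinearMap.mul_apply', Bialgebra.comul_mul,
        conv_apply]
      generalize (Coalgebra.comul (R := K) b) = t
      generalize (Coalgebra.comul (R := K) h) = s
      induction s using TensorProduct.induction_on with
      | zero => simp
      | add a b ha hb => simp only [map_add, add_mul, TensorProduct.tmul_add,
          LinearMap.add_apply, ha, hb]
      | tmul x y =>
        induction t using TensorProduct.induction_on with
        | zero => simp
        | add a b ha hb => simp only [map_add, mul_add, TensorProduct.tmul_add, ha, hb]
        | tmul c d => simp

/-- The right action `(v ⊗ k) h = v ⊗ k h` on `V ⊗ H`. -/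
def factorRightAct : Hᵐᵒᵖ →ₐ[K] Module.End K (V.carrier ⊗[K] H) :=
  (Module.End.lTensorAlgHom K H V.carrier).comp (Algebra.lsmul K K H)

@[simp] lemma factorRightAct_tmul (a : Hᵐᵒᵖ) (x : V.carrier) (y : H) :
    V.factorRightAct a (x ⊗ₜ y) = x ⊗ₜ (y * a.unop) := rfl

lemma commute_diagAct_factorRightAct (a : H) (b : Hᵐᵒᵖ) :
    Commute (V.diagAct a) (V.factorRightAct b) := by
  change V.diagAct.toLinearMap a * _ = _ * V.diagAct.toLinearMap a
  rw [V.diagAct_toLinearMap, conv_apply]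
  generalize (Coalgebra.comul (R := K) (A := H) a) = t
  induction t using TensorProduct.induction_on with
  | zero => simp
  | add a b ha hb => simp only [map_add, add_mul, mul_add, ha, hb]
  | tmul c d =>
    refine TensorProduct.ext' fun x y => ?_
    simp [mul_assoc]

lemma rTensor_diagAct {V W : YetterDrinfeld.{w} K H} (f : V ⟶ W) (h : H)
    (m : V.carrier ⊗[K] H) :
    f.toLin.rTensor H (V.diagAct h m) = W.diagAct h (f.toLin.rTensor H m) := by
  change f.toLin.rTensor H (V.diagAct.toLinearMap h m) = W.diagAct.toLinearMap h _
  rw [diagAct_toLinearMap, diagAct_toLinearMap]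
  refine Intertwines.conv (Intertwines.rTensor fun h v => ?_) (Intertwines.opR_rTensor _ _) h m
  exact f.map_act h v

lemma rTensor_factorRightAct {V W : YetterDrinfeld.{w} K H} (f : V.carrier →ₗ[K] W.carrier)
    (h : Hᵐᵒᵖ) (m : V.carrier ⊗[K] H) :
    f.rTensor H (V.factorRightAct h m) = W.factorRightAct h (f.rTensor H m) := by
  induction m using TensorProduct.induction_on with
  | zero => simp
  | add a b ha hb => simp only [map_add, ha, hb]
  | tmul a b => simp

end YetterDrinfeld

/-- The Hopf bimodule `V ⊗ H` of a Yetter-Drinfeld module `V`. -/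
def YetterDrinfeld.induced (V : YetterDrinfeld.{v} K H) : HopfBimod K H where
  carrier := V.carrier ⊗[K] H
  left := V.coact.tensor (comulCoaction K H)
  right := (trivialRightCoaction K H V.carrier).tensor (comulRightCoaction K H)
  comm := (coactionsCommute_trivial _).tensor coactionsCommute_comul
  leftAct := V.diagAct
  rightAct := V.factorRightAct
  act_comm := V.commute_diagAct_factorRightAct
  leftAct_left := (leftActMap_leftColinear_iff _ _).2 V.intertwines_diagAct_left
  leftAct_right := (leftActMap_rightColinear_iff _ _).2 V.intertwines_diagAct_right
  rightAct_left := by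
    refine (rightActMap_leftColinear_iff _ _).2 fun h z => ?_
    induction z using TensorProduct.induction_on with
    | zero => simp
    | add a b ha hb => simp only [map_add, ha, hb]
    | tmul x y =>
      simp only [rightOp_apply, YetterDrinfeld.factorRightAct_tmul, LeftCoaction.tensor_tmul,
        MulOpposite.unop_op, comulCoaction, Bialgebra.comul_mul, conv_apply]
      generalize V.coact.toLin x = r
      generalize (Coalgebra.comul (R := K) y) = s
      generalize (Coalgebra.comul (R := K) h) = t
      induction r using TensorProduct.induction_on with
      | zero => simp
      | add _ _ ha hb => simp only [map_add, TensorProduct.add_tmul, ha, hb]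
      | tmul a b =>
        induction s using TensorProduct.induction_on with
        | zero => simp
        | add _ _ ha hb => simp only [map_add, add_mul, TensorProduct.tmul_add, ha, hb]
        | tmul c d =>
          induction t using TensorProduct.induction_on with
          | zero => simp
          | add _ _ ha hb => simp only [map_add, mul_add, TensorProduct.tmul_add,
              LinearMap.add_apply, ha, hb]
          | tmul e f => simp [mul_assoc, rightOp_apply]
  rightAct_right := by
    refine (rightActMap_rightColinear_iff _ _).2 fun h z => ?_
    induction z using TensorProduct.induction_on with
    | zero => simp
    | add a b ha hb => simp only [map_add, ha, hb]
    | tmul x y =>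
      simp only [rightOp_apply, YetterDrinfeld.factorRightAct_tmul, trivial_tensor_tmul,
        MulOpposite.unop_op, Bialgebra.comul_mul, conv_apply]
      generalize (Coalgebra.comul (R := K) y) = s
      generalize (Coalgebra.comul (R := K) h) = t
      induction s using TensorProduct.induction_on with
      | zero => simp
      | add _ _ ha hb => simp only [map_add, add_mul, TensorProduct.tmul_add, ha, hb]
      | tmul c d =>
        induction t using TensorProduct.induction_on with
        | zero => simp
        | add _ _ ha hb => simp only [map_add, mul_add, TensorProduct.tmul_add,
            LinearMap.add_apply, ha, hb]
        | tmul e f => simp [mul_assoc, rightOp_apply]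

/-! ### Functoriality of V ⊗ H, and V as its right coinvariants. -/

namespace YetterDrinfeld

/-- The functoriality of `V ↦ V ⊗ H` in colinear maps. -/
lemma induced_colinear {V W : YetterDrinfeld.{v} K H} (f : V.carrier →ₗ[K] W.carrier)
    (hf : IsLeftColinear V.coact W.coact f) :
    IsLeftColinear V.induced.left W.induced.left (f.rTensor H) ∧
      IsRightColinear V.induced.right W.induced.right (f.rTensor H) := by
  refine ⟨hf.tensorMap (IsLeftColinear.id _), IsRightColinear.tensorMap ?_ (IsRightColinear.id _)⟩
  refine LinearMap.ext fun x => ?_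
  simp [trivialRightCoaction_toLin]

/-- The functoriality of `V ↦ V ⊗ H`. -/
def inducedMap {V W : YetterDrinfeld.{v} K H} (f : V ⟶ W) : V.induced ⟶ W.induced where
  toLin := f.toLin.rTensor H
  left := (induced_colinear f.toLin f.colinear).1
  right := (induced_colinear f.toLin f.colinear).2
  map_leftAct := rTensor_diagAct f
  map_rightAct := rTensor_factorRightAct f.toLin

/-- The embedding `v ↦ v ⊗ 1` of `V` into `V ⊗ H`. -/
def toInduced (V : YetterDrinfeld.{v} K H) : V.carrier →ₗ[K] V.carrier ⊗[K] H :=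
  (TensorProduct.mk K V.carrier H).flip 1

variable (V : YetterDrinfeld.{v} K H)

lemma toInduced_apply (v : V.carrier) : V.toInduced v = v ⊗ₜ[K] (1 : H) := rfl

/-- The projection `v ⊗ h ↦ v ε(h)` of `V ⊗ H` onto `V`. -/
def ofInduced : V.carrier ⊗[K] H →ₗ[K] V.carrier :=
  (TensorProduct.rid K V.carrier).toLinearMap ∘ₗ
    (Coalgebra.counit (R := K) (A := H)).lTensor V.carrier

lemma ofInduced_toInduced (v : V.carrier) : V.ofInduced (V.toInduced v) = v := by
  simp [ofInduced, toInduced_apply]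

lemma toInduced_injective : Function.Injective V.toInduced :=
  Function.LeftInverse.injective V.ofInduced_toInduced

lemma toInduced_colinear : IsLeftColinear V.coact V.induced.left V.toInduced := by
  refine LinearMap.ext fun v => ?_
  change leftMulMid K H V.carrier H (V.coact.toLin v ⊗ₜ Coalgebra.comul 1) =
    ((TensorProduct.mk K V.carrier H).flip 1).lTensor H (V.coact.toLin v)
  rw [Bialgebra.comul_one, Algebra.TensorProduct.one_def]
  generalize V.coact.toLin v = t
  induction t using TensorProduct.induction_on with
  | zero => simp
  | add a b ha hb => simp only [map_add, TensorProduct.add_tmul, ha, hb]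
  | tmul a b => simp

lemma isCoinvariant_toInduced (v : V.carrier) : V.induced.IsCoinvariant (V.toInduced v) := by
  change ((trivialRightCoaction K H V.carrier).tensor (comulRightCoaction K H)).toLin (v ⊗ₜ 1) = _
  rw [trivial_tensor_tmul, Bialgebra.comul_one, Algebra.TensorProduct.one_def]
  rfl

/-- Applying v ⊗ h ↦ v ε(h) to the first factor of the right coaction gives the identity of V ⊗ H,
by the counit axiom. On a coinvariant m the same composite gives `V.ofInduced m ⊗ 1`. -/
lemma toInduced_ofInduced {m : V.carrier ⊗[K] H} (hm : V.induced.IsCoinvariant m) :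
    V.toInduced (V.ofInduced m) = m := by
  have e : ∀ z : V.carrier ⊗[K] H, (V.ofInduced.rTensor H)
      (((trivialRightCoaction K H V.carrier).tensor (comulRightCoaction K H)).toLin z) = z := by
    intro z
    induction z using TensorProduct.induction_on with
    | zero => simp
    | add a b ha hb => simp only [map_add, ha, hb]
    | tmul a b =>
      have e2 : ∀ t : H ⊗[K] H,
          (V.ofInduced.rTensor H) ((TensorProduct.assoc K V.carrier H H).symm (a ⊗ₜ t)) =
            a ⊗ₜ TensorProduct.lid K H ((Coalgebra.counit (R := K) (A := H)).rTensor H t) := by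
        intro t
        induction t using TensorProduct.induction_on with
        | zero => simp
        | add a b ha hb => simp only [map_add, TensorProduct.tmul_add, ha, hb]
        | tmul c d => simp [ofInduced, TensorProduct.smul_tmul]
      rw [trivial_tensor_tmul, e2, Coalgebra.rTensor_counit_comul]
      simp
  exact (congrArg (V.ofInduced.rTensor H) hm).symm.trans (e m)

lemma induced_ad_toLinearMap :
    (V.induced.ad.toLinearMap : H →ₗ[K] Module.End K (V.carrier ⊗[K] H)) =
      opL H V.act.toLinearMap ⋆ opR V.carrier (mulL K H ⋆ mulR K H ∘ₗ antipode K) := by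
  rw [opR_conv, ← conv_assoc, ← diagAct_toLinearMap]
  rfl

/-- The adjoint action on V ⊗ H is v ⊗ k ↦ h₁v ⊗ h₂ k S(h₃); for k = 1 the second factor collapses.
Hence passing to V ⊗ H and back to coinvariants returns the original action on V. -/
lemma toInduced_act (h : H) (v : V.carrier) :
    V.toInduced (V.act h v) = V.induced.ad h (V.toInduced v) := by
  refine Eq.trans ?_ (LinearMap.congr_fun (LinearMap.congr_fun V.induced_ad_toLinearMap h)
    (V.toInduced v)).symm
  have e : Intertwines V.toInduced (V.act.toLinearMap ⋆ convUnit)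
      (opL H V.act.toLinearMap ⋆ opR V.carrier (mulL K H ⋆ mulR K H ∘ₗ antipode K)) := by
    refine .conv (fun _ _ => rfl) fun h v => ?_
    change _ = v ⊗ₜ[K] ((mulL K H ⋆ mulR K H ∘ₗ antipode K) h 1)
    rw [mulL_conv_mulR_antipode, convUnit_apply]
    simp [toInduced_apply, Algebra.algebraMap_eq_smul_one, TensorProduct.smul_tmul]
  rw [conv_convUnit] at e
  exact e h v

end YetterDrinfeld

end Induced

/-! ## The universal property of `Ω¹H` -/

section Omega

variable {K : Type u} [Field K] {H : Type v} [Ring H] [HopfAlgebra K H]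

/-! ### The adjoint coaction and the colinearity of Δ. -/

lemma adCoact_eq_adOp (x : H) :
    adCoact (K := K) LinearMap.id x = adOp (mulL K H) x (1 ⊗ₜ 1) := by
  change _ = adOp (Algebra.lmul K H).toLinearMap x (1 ⊗ₜ 1)
  rw [adCoact_apply, adOp_eq_twist]
  generalize (Coalgebra.comul (R := K) (A := H)).lTensor H (Coalgebra.comul x) = t
  induction t using TensorProduct.induction_on with
  | zero => simp
  | add a b ha hb => simp only [map_add, LinearMap.add_apply, ha, hb]
  | tmul a b =>
    induction b using TensorProduct.induction_on with
    | zero => simp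
    | add b b' ha hb => simp only [map_add, TensorProduct.tmul_add, LinearMap.add_apply, ha, hb]
    | tmul b c => simp

lemma adCoact_one : adCoact (K := K) LinearMap.id (1 : H) = 1 ⊗ₜ 1 := by
  rw [adCoact_apply]
  simp [Algebra.TensorProduct.one_def]

/-- Δ(h) is the diagonal action of h on 1 ⊗ 1, and the coaction of 1 ⊗ 1 is 1 ⊗ (1 ⊗ 1). So the
claim is `intertwines_diagonal` for H with its adjoint coaction, evaluated at 1 ⊗ 1. -/
lemma comul_leftColinear : IsLeftColinear (comulCoaction K H)
    ((adjointCoaction K H).tensor (comulCoaction K H)) Coalgebra.comul := by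
  have e1 : ∀ x : H, (opL H (mulL K H) ⋆ opR H (mulL K H)) x (1 ⊗ₜ 1) = Coalgebra.comul x := by
    intro x
    rw [conv_apply]
    generalize (Coalgebra.comul (R := K) x) = t
    induction t using TensorProduct.induction_on with
    | zero => simp
    | add a b ha hb => simp only [map_add, LinearMap.add_apply, ha, hb]
    | tmul a b => simp
  have e2 : ((adjointCoaction K H).tensor (comulCoaction K H)).toLin (1 ⊗ₜ 1) =
      1 ⊗ₜ (1 ⊗ₜ 1) := by
    rw [LeftCoaction.tensor_tmul, adjointCoaction_toLin, adCoact_one]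
    change leftMulMid K H H H (_ ⊗ₜ Coalgebra.comul 1) = _
    simp [Algebra.TensorProduct.one_def]
  have e3 := intertwines_diagonal (adjointCoaction K H) (mulL K H) fun h x =>
    (adCoact_mul h x).trans (by rw [← adOp_eq_twist]; rfl)
  have e4 : ∀ h : H, (opL _ (mulL K H) ⋆ opR H (opL H (mulL K H) ⋆ opR H (mulL K H))) h
      (1 ⊗ₜ (1 ⊗ₜ 1)) = (Coalgebra.comul (R := K) (A := H)).lTensor H (Coalgebra.comul h) := by
    intro h
    rw [conv_apply]
    generalize (Coalgebra.comul (R := K) h) = t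
    induction t using TensorProduct.induction_on with
    | zero => simp
    | add a b ha hb => simp only [map_add, LinearMap.add_apply, ha, hb]
    | tmul a b => simp [e1]
  refine LinearMap.ext fun h => ?_
  change ((adjointCoaction K H).tensor (comulCoaction K H)).toLin (Coalgebra.comul h) =
    (Coalgebra.comul (R := K) (A := H)).lTensor H (Coalgebra.comul h)
  rw [← e4, ← e1, ← e2]
  exact e3 h (1 ⊗ₜ 1)

lemma comul_rightColinear : IsRightColinear (comulRightCoaction K H)
    ((trivialRightCoaction K H H).tensor (comulRightCoaction K H)) Coalgebra.comul := by
  refine LinearMap.ext fun h => ?_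
  change ((trivialRightCoaction K H H).tensor (comulRightCoaction K H)).toLin (Coalgebra.comul h) =
    (Coalgebra.comul (R := K) (A := H)).rTensor H (Coalgebra.comul h)
  rw [← Coalgebra.coassoc_symm_apply]
  generalize (Coalgebra.comul (R := K) h) = t
  induction t using TensorProduct.induction_on with
  | zero => simp
  | add a b ha hb => simp only [map_add, ha, hb]
  | tmul a b => simp [trivial_tensor_tmul]

/-- The element 1 is coinvariant for the adjoint coaction and is killed by the projection, so
subtracting ε(x) 1 changes nothing. -/
lemma augProj_colinear :
    IsLeftColinear (adjointCoaction K H) (augCoaction K H) (augProj K H) := by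
  refine LinearMap.ext fun x => ?_
  change (augProj K H).lTensor H (adCoact LinearMap.id
    (x - algebraMap K H (Coalgebra.counit x))) = (augProj K H).lTensor H (adCoact LinearMap.id x)
  have h : augProj K H 1 = 0 := by
    refine Subtype.ext ?_
    change (1 : H) - algebraMap K H (Coalgebra.counit 1) = 0
    simp
  rw [map_sub, map_sub, Algebra.algebraMap_eq_smul_one, map_smul, adCoact_one, map_smul,
    LinearMap.lTensor_tmul, h, TensorProduct.tmul_zero, smul_zero, sub_zero]

/-- The source of the Leibniz rule in `IsAdMap.derivation_mul`. -/
lemma augProj_mul (a b : H) : augProj K H (a * b) =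
    augAct K H a (augProj K H b) + Coalgebra.counit (R := K) b • augProj K H a := by
  refine Subtype.ext ?_
  change a * b - algebraMap K H (Coalgebra.counit (a * b)) =
    a * (b - algebraMap K H (Coalgebra.counit b)) +
      Coalgebra.counit (R := K) b • (a - algebraMap K H (Coalgebra.counit a))
  simp only [Bialgebra.counit_mul, Algebra.algebraMap_eq_smul_one, mul_sub, smul_sub,
    mul_smul_comm, mul_one, smul_smul, mul_comm (Coalgebra.counit (R := K) a)]
  abel

namespace HopfBimod

variable {X Y : HopfBimod K H}

lemma hom_lact (f : X ⟶ Y) (h : H) (m : X.carrier) : f.toLin (X.lact h m) = Y.lact h (f.toLin m) :=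
  f.map_leftAct h m

lemma hom_ract (f : X ⟶ Y) (h : Hᵐᵒᵖ) (m : X.carrier) :
    f.toLin (X.ract h m) = Y.ract h (f.toLin m) :=
  f.map_rightAct h m

lemma hom_ad (f : X ⟶ Y) (h : H) (m : X.carrier) : f.toLin (X.ad h m) = Y.ad h (f.toLin m) :=
  Intertwines.conv (f := X.lact.toLinearMap) (g := Y.lact.toLinearMap) (fun h m => hom_lact f h m)
    (Intertwines.comp_antipode fun h m => hom_ract f (.op h) m) h m

lemma rightColinear_isCoinvariant {f : X.carrier →ₗ[K] Y.carrier}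
    (hf : IsRightColinear X.right Y.right f) {m : X.carrier} (hm : X.IsCoinvariant m) :
    Y.IsCoinvariant (f m) := by
  refine (LinearMap.congr_fun hf m).trans ?_
  rw [LinearMap.comp_apply, hm]
  rfl

lemma isCoinvariant_of_injective {f : X.carrier →ₗ[K] Y.carrier}
    (hf : IsRightColinear X.right Y.right f) (hi : Function.Injective f) {m : X.carrier}
    (hm : Y.IsCoinvariant (f m)) : X.IsCoinvariant m :=
  Module.Flat.rTensor_preserves_injective_linearMap (M := H) f hi
    ((LinearMap.congr_fun hf m).symm.trans hm)

lemma IsCoinvariant.add {m m' : X.carrier} (h : X.IsCoinvariant m) (h' : X.IsCoinvariant m') :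
    X.IsCoinvariant (m + m') := by
  unfold IsCoinvariant at *
  rw [map_add, h, h', TensorProduct.add_tmul]

/-! ### Maps from H⁺ to a Hopf bimodule and their derivations. -/

variable (X) in
/-- The maps from `H⁺` to a Hopf bimodule `X` that are left colinear, have right coinvariant values
and are linear for the left adjoint action. -/
structure IsAdMap (c : augIdeal K H →ₗ[K] X.carrier) : Prop where
  colinear : IsLeftColinear (augCoaction K H) X.left c
  coinvariant : ∀ x, X.IsCoinvariant (c x)
  map_act : ∀ h x, c (augAct K H h x) = X.ad h (c x)

lemma IsAdMap.comp {c : augIdeal K H →ₗ[K] X.carrier} (hc : X.IsAdMap c) (f : X ⟶ Y) :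
    Y.IsAdMap (f.toLin ∘ₗ c) where
  colinear := f.left.comp hc.colinear
  coinvariant x := rightColinear_isCoinvariant f.right (hc.coinvariant x)
  map_act h x := by
    rw [LinearMap.comp_apply, hc.map_act, hom_ad, LinearMap.comp_apply]

/-- The derivation `p ↦ c(p₍₁₎ - ε(p₍₁₎)) p₍₂₎` given by `c : H⁺ → X`. -/
def derivation (c : augIdeal K H →ₗ[K] X.carrier) : H →ₗ[K] X.carrier :=
  rightActMap X.ract ∘ₗ (c ∘ₗ augProj K H).rTensor H ∘ₗ Coalgebra.comul

lemma rightActMap_rTensor_comp (f : X ⟶ Y) (c : H →ₗ[K] X.carrier) (t : H ⊗[K] H) :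
    rightActMap Y.ract ((f.toLin ∘ₗ c).rTensor H t) =
      f.toLin (rightActMap X.ract (c.rTensor H t)) := by
  induction t using TensorProduct.induction_on with
  | zero => simp
  | add a b ha hb => simp only [map_add, ha, hb]
  | tmul a b => simp [hom_ract]

lemma derivation_comp (f : X ⟶ Y) (c : augIdeal K H →ₗ[K] X.carrier) :
    derivation (f.toLin ∘ₗ c) = f.toLin ∘ₗ derivation c := by
  refine LinearMap.ext fun p => ?_
  rw [derivation, LinearMap.comp_assoc]
  exact rightActMap_rTensor_comp f (c ∘ₗ augProj K H) (Coalgebra.comul p)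

/-- By `augProj_mul` and ▹-linearity, with π = `augProj K H`, d(hp) is the sum of (h₁ ▹ c(π p₁)) h₂
p₂ and ε(p₁) c(π h₁) h₂ p₂. The first term is h d(p) by `ad_ract`, the second is d(h) p by the
counit axiom. -/
lemma IsAdMap.derivation_mul {c : augIdeal K H →ₗ[K] X.carrier} (hc : X.IsAdMap c) (h p : H) :
    derivation c (h * p) = X.lact h (derivation c p) + X.ract (.op p) (derivation c h) := by
  have e1 : ∀ (a b : H) (s : H ⊗[K] H),
      rightActMap X.ract ((c ∘ₗ augProj K H).rTensor H (s * (a ⊗ₜ b))) =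
        X.ract (.op b) (rightActMap X.ract
          ((X.ad.toLinearMap.flip (c (augProj K H a))).rTensor H s)) +
        Coalgebra.counit (R := K) a •
          X.ract (.op b) (rightActMap X.ract ((c ∘ₗ augProj K H).rTensor H s)) := by
    intro a b s
    induction s using TensorProduct.induction_on with
    | zero => simp
    | add s t hs ht =>
      simp only [map_add, add_mul, hs, ht, smul_add]
      abel
    | tmul x y =>
      simp only [Algebra.TensorProduct.tmul_mul_tmul, LinearMap.rTensor_tmul, LinearMap.comp_apply,
        augProj_mul, map_add, map_smul, hc.map_act, rightActMap_tmul, LinearMap.flip_apply,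
        AlgHom.toLinearMap_apply, MulOpposite.op_mul, map_mul, Module.End.mul_apply]
  have e2 : ∀ t : H ⊗[K] H,
      rightActMap X.ract ((c ∘ₗ augProj K H).rTensor H (Coalgebra.comul h * t)) =
        X.lact h (rightActMap X.ract ((c ∘ₗ augProj K H).rTensor H t)) +
        X.ract (.op (TensorProduct.lid K H ((Coalgebra.counit (R := K) (A := H)).rTensor H t)))
          (derivation c h) := by
    intro t
    induction t using TensorProduct.induction_on with
    | zero => simp
    | add s t hs ht =>
      simp only [map_add, mul_add, hs, ht, MulOpposite.op_add, LinearMap.add_apply]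
      abel
    | tmul a b =>
      rw [e1, ad_ract]
      have h1 := LinearMap.congr_fun (X.commute_lact_ract h b).eq (c (augProj K H a))
      simp only [Module.End.mul_apply] at h1
      simp [h1, derivation]
  change rightActMap X.ract ((c ∘ₗ augProj K H).rTensor H (Coalgebra.comul (h * p))) = _
  rw [Bialgebra.comul_mul, e2, Coalgebra.rTensor_counit_comul]
  simp [derivation]

/-- The derivation factors as Δ, followed by the map given by c on the first factor, followed by the
right action. Each is colinear when the first tensor factor H has its adjoint coaction. -/
lemma IsAdMap.derivation_left {c : augIdeal K H →ₗ[K] X.carrier} (hc : X.IsAdMap c) :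
    IsLeftColinear (comulCoaction K H) X.left (derivation c) :=
  IsLeftColinear.comp X.rightAct_left (IsLeftColinear.comp
    (IsLeftColinear.tensorMap (hc.colinear.comp augProj_colinear) (IsLeftColinear.id _))
    comul_leftColinear)

lemma IsAdMap.derivation_right {c : augIdeal K H →ₗ[K] X.carrier} (hc : X.IsAdMap c) :
    IsRightColinear (comulRightCoaction K H) X.right (derivation c) :=
  IsRightColinear.comp X.rightAct_right (IsRightColinear.comp
    -- On the right, coinvariant values mean that c is colinear for the trivial coaction on its
    -- source.
    (IsRightColinear.tensorMap (ρ := trivialRightCoaction K H H)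
      (LinearMap.ext fun x => hc.coinvariant (augProj K H x)) (IsRightColinear.id _))
    comul_rightColinear)

/-! ### Ω¹H inside H ⊗ H and the morphisms out of it. -/

variable (K H) in
/-- The Hopf bimodule `Ω¹H`. -/
abbrev omega : HopfBimod K H := (BicomodAlgebra.regular K H).omega

variable (K H) in
/-- The Hopf bimodule `H ⊗ H` with the outer actions and codiagonal coactions. -/
abbrev outer : HopfBimod K H := (BicomodAlgebra.regular K H).free

variable (K H) in
/-- The inclusion of `Ω¹H` into `H ⊗ H`. -/
def incl : (omega K H).carrier →ₗ[K] H ⊗[K] H := (BicomodAlgebra.regular K H).kerMul.subtype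

variable (K H) in
/-- The inclusion of `Ω¹H` into `H ⊗ H`, as a morphism of Hopf bimodules. -/
def omegaIncl : omega K H ⟶ outer K H where
  toLin := (BicomodAlgebra.regular K H).kerMul.subtype
  left := (BicomodAlgebra.regular K H).kerMul_left_colinear
  right := (BicomodAlgebra.regular K H).kerMul_right_colinear
  map_leftAct _ _ := rfl
  map_rightAct _ _ := rfl

lemma incl_injective : Function.Injective (incl K H) :=
  (BicomodAlgebra.regular K H).kerMul.injective_subtype

lemma mul_incl (z : (omega K H).carrier) : LinearMap.mul' K H (incl K H z) = 0 := z.2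

lemma incl_ract (h : H) (z : (omega K H).carrier) :
    incl K H ((omega K H).ract (.op h) z) = opR H (mulR K H) h (incl K H z) := rfl

/-- The adjoint action on `H ⊗ H`. -/
def outerAd : H →ₗ[K] Module.End K (H ⊗[K] H) :=
  opL H (mulL K H) ⋆ opR H (mulR K H) ∘ₗ antipode K

lemma outerAd_mul (a b : H) (z : H ⊗[K] H) :
    outerAd (K := K) (a * b) z = outerAd a (outerAd b z) :=
  LinearMap.congr_fun (map_mul (outer K H).ad a b) z

lemma outerAd_one (z : H ⊗[K] H) : outerAd (K := K) (1 : H) z = z :=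
  LinearMap.congr_fun (map_one (outer K H).ad) z

lemma outerAd_apply_one (x : H) : outerAd (K := K) x (1 ⊗ₜ[K] 1) =
    (antipode K (A := H)).lTensor H (Coalgebra.comul x) := by
  rw [outerAd, conv_apply]
  generalize (Coalgebra.comul (R := K) x) = t
  induction t using TensorProduct.induction_on with
  | zero => simp
  | add a b ha hb => simp only [map_add, LinearMap.add_apply, ha, hb]
  | tmul a b => simp

lemma incl_ad (h : H) (z : (omega K H).carrier) :
    incl K H ((omega K H).ad h z) = outerAd h (incl K H z) :=
  hom_ad (omegaIncl K H) h z

lemma outerAd_ract (h : H) (z : H ⊗[K] H) :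
    TensorProduct.lift (LinearMap.flip (opR H (mulR K H)))
      ((outerAd.flip z).rTensor H (Coalgebra.comul h)) = opL H (mulL K H) h z :=
  (outer K H).ad_ract h z

/-- The map `p ⊗ q ↦ d(p) q`, for the derivation `d` given by `c`. -/
def outerLift (c : augIdeal K H →ₗ[K] X.carrier) : H ⊗[K] H →ₗ[K] X.carrier :=
  rightActMap X.ract ∘ₗ (derivation c).rTensor H

lemma outerLift_tmul (c : augIdeal K H →ₗ[K] X.carrier) (p q : H) :
    outerLift c (p ⊗ₜ q) = X.ract (.op q) (derivation c p) := rfl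

lemma outerLift_ract (c : augIdeal K H →ₗ[K] X.carrier) (h : H) (z : H ⊗[K] H) :
    outerLift c (opR H (mulR K H) h z) = X.ract (.op h) (outerLift c z) := by
  induction z using TensorProduct.induction_on with
  | zero => simp
  | add a b ha hb => simp only [map_add, ha, hb]
  | tmul p q =>
    rw [opR_tmul, outerLift_tmul, outerLift_tmul, LinearMap.flip_apply, LinearMap.mul_apply',
      MulOpposite.op_mul, map_mul]
    rfl

/-- The Leibniz rule leaves an error term containing the product ∑ p q of z = ∑ p ⊗ q. It vanishes
on Ω¹H, so `outerLift c` becomes left linear exactly after restriction to the kernel of the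
multiplication, as used in `IsAdMap.lift`. -/
lemma IsAdMap.outerLift_lact {c : augIdeal K H →ₗ[K] X.carrier} (hc : X.IsAdMap c) (h : H)
    (z : H ⊗[K] H) : outerLift c (opL H (mulL K H) h z) =
      X.lact h (outerLift c z) + X.ract (.op (LinearMap.mul' K H z)) (derivation c h) := by
  induction z using TensorProduct.induction_on with
  | zero => simp
  | add a b ha hb =>
    simp only [map_add, ha, hb, MulOpposite.op_add, LinearMap.add_apply]
    abel
  | tmul p q =>
    rw [opL_tmul, outerLift_tmul, outerLift_tmul, LinearMap.mul_apply', hc.derivation_mul, map_add]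
    have h1 := LinearMap.congr_fun (X.commute_lact_ract h q).eq (derivation c p)
    simp only [Module.End.mul_apply] at h1
    rw [h1, LinearMap.mul'_apply, MulOpposite.op_mul, map_mul]
    rfl

/-- The morphism `Ω¹H ⟶ X` given by a suitable map `H⁺ → X`. -/
def IsAdMap.lift {c : augIdeal K H →ₗ[K] X.carrier} (hc : X.IsAdMap c) : omega K H ⟶ X where
  toLin := outerLift c ∘ₗ incl K H
  left := IsLeftColinear.comp (IsLeftColinear.comp X.rightAct_left
    (IsLeftColinear.tensorMap hc.derivation_left (IsLeftColinear.id _))) (omegaIncl K H).left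
  right := IsRightColinear.comp (IsRightColinear.comp X.rightAct_right
    (IsRightColinear.tensorMap hc.derivation_right (IsRightColinear.id _))) (omegaIncl K H).right
  map_leftAct h z := by
    have h1 := hc.outerLift_lact h (incl K H z)
    rw [mul_incl] at h1
    simp only [MulOpposite.op_zero, map_zero, LinearMap.zero_apply, add_zero] at h1
    exact h1
  map_rightAct h z := outerLift_ract c h.unop (incl K H z)

lemma IsAdMap.lift_toLin {c : augIdeal K H →ₗ[K] X.carrier} (hc : X.IsAdMap c) :
    hc.lift.toLin = outerLift c ∘ₗ incl K H := rfl

lemma outerLift_comp (c : augIdeal K H →ₗ[K] X.carrier) (f : X ⟶ Y) (z : H ⊗[K] H) :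
    f.toLin (outerLift c z) = outerLift (f.toLin ∘ₗ c) z := by
  have h : outerLift (f.toLin ∘ₗ c) = rightActMap Y.ract ∘ₗ (f.toLin ∘ₗ derivation c).rTensor H :=
    congrArg (fun d => rightActMap Y.ract ∘ₗ LinearMap.rTensor H d) (derivation_comp f c)
  rw [h]
  exact (rightActMap_rTensor_comp f (derivation c) z).symm

lemma IsAdMap.lift_comp {c : augIdeal K H →ₗ[K] X.carrier} (hc : X.IsAdMap c) (f : X ⟶ Y) :
    f.toLin ∘ₗ hc.lift.toLin = (hc.comp f).lift.toLin :=
  LinearMap.ext fun z => outerLift_comp c f (incl K H z)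

variable (K H) in
/-- The map `H⁺ → Ω¹H`, `x ↦ x₍₁₎ ⊗ S(x₍₂₎)`. -/
def augToOmega : augIdeal K H →ₗ[K] (omega K H).carrier :=
  LinearMap.codRestrict (BicomodAlgebra.regular K H).kerMul
    ((antipode K (A := H)).lTensor H ∘ₗ Coalgebra.comul ∘ₗ (augIdeal K H).subtype) (fun x => by
      have h : LinearMap.mul' K H ((antipode K (A := H)).lTensor H
          (Coalgebra.comul (x : H))) = 0 := by
        rw [mul_antipode_lTensor_comul_apply, show Coalgebra.counit (R := K) (x : H) = 0 from x.2,
          map_zero]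
      exact h)

lemma incl_augToOmega (x : augIdeal K H) :
    incl K H (augToOmega K H x) = outerAd (x : H) (1 ⊗ₜ[K] 1) :=
  (outerAd_apply_one _).symm

-- All three properties come from writing the map as x ↦ x ▹ (1 ⊗ 1) in H ⊗ H, where 1 ⊗ 1 is
-- coinvariant on both sides. They descend to Ω¹H because the inclusion is injective and bicolinear.
variable (K H) in
lemma isAdMap_augToOmega : (omega K H).IsAdMap (augToOmega K H) where
  colinear := by
    let j : H →ₗ[K] H ⊗[K] H := outerAd.flip (1 ⊗ₜ[K] 1)
    let ρ : LeftCoaction K H (H ⊗[K] H) := (comulCoaction K H).tensor (comulCoaction K H)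
    have h1 : Intertwines j (mulL K H) outerAd := fun a b => outerAd_mul a b _
    -- The adjoint coaction on H and the coaction on H ⊗ H are both computed as `adOp x` applied to
    -- the coaction of a generator, 1 and 1 ⊗ 1 respectively; these generators correspond under j.
    have h2 : ∀ x : H, j.lTensor H (adCoact LinearMap.id x) = adOp outerAd x (1 ⊗ₜ j 1) :=
      fun x => by rw [adCoact_eq_adOp]; exact h1.adOp x (1 ⊗ₜ 1)
    have h3 : ∀ x : H, ρ.toLin (outerAd x (1 ⊗ₜ[K] 1)) = adOp outerAd x (ρ.toLin (1 ⊗ₜ[K] 1)) :=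
      fun x => (outer K H).left_ad x (1 ⊗ₜ[K] 1 : H ⊗[K] H)
    have h4 : ρ.toLin (1 ⊗ₜ[K] 1) = 1 ⊗ₜ[K] j 1 := by
      change leftMulMid K H H H (Coalgebra.comul 1 ⊗ₜ Coalgebra.comul 1) =
        1 ⊗ₜ[K] (outerAd (K := K) (1 : H) (1 ⊗ₜ[K] 1))
      rw [Bialgebra.comul_one, Algebra.TensorProduct.one_def, leftMulMid_tmul, mul_one, outerAd_one]
    have hj : incl K H ∘ₗ augToOmega K H = j ∘ₗ (augIdeal K H).subtype :=
      LinearMap.ext incl_augToOmega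
    have h5 : IsLeftColinear (augCoaction K H) ρ (incl K H ∘ₗ augToOmega K H) := by
      refine LinearMap.ext fun x => ?_
      rw [hj, LinearMap.comp_apply, LinearMap.comp_apply, LinearMap.comp_apply,
        LinearMap.lTensor_comp_apply, augCoaction_coe, h2, ← h4]
      exact h3 x
    exact IsLeftColinear.of_comp incl_injective (omegaIncl K H).left h5
  coinvariant x := by
    refine isCoinvariant_of_injective (omegaIncl K H).right incl_injective ?_
    have h1 : (outer K H).IsCoinvariant (1 ⊗ₜ[K] 1 : H ⊗[K] H) := by
      change rightMulMid K H H H (Coalgebra.comul 1 ⊗ₜ Coalgebra.comul 1) = (1 ⊗ₜ[K] 1) ⊗ₜ[K] 1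
      rw [Bialgebra.comul_one, Algebra.TensorProduct.one_def, rightMulMid_tmul, mul_one]
    have h2 := h1.ad _ (x : H)
    have h3 : (omegaIncl K H).toLin (augToOmega K H x) =
        (outer K H).ad (x : H) (1 ⊗ₜ[K] 1 : H ⊗[K] H) := incl_augToOmega x
    rwa [← h3] at h2
  map_act h x := by
    refine incl_injective ?_
    have e : ((augAct K H h x : augIdeal K H) : H) = h * x := rfl
    refine (incl_augToOmega _).trans ?_
    rw [incl_ad, e, outerAd_mul]
    exact congrArg (outerAd h) (incl_augToOmega x).symm

lemma incl_augToOmega_augProj (x : H) : incl K H (augToOmega K H (augProj K H x)) =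
    outerAd x (1 ⊗ₜ[K] 1) - Coalgebra.counit (R := K) x • (1 ⊗ₜ[K] 1) := by
  have e : (augProj K H x : H) = x - Coalgebra.counit (R := K) x • (1 : H) := by
    rw [← Algebra.algebraMap_eq_smul_one]
    rfl
  refine (incl_augToOmega _).trans ?_
  rw [e, map_sub, map_smul, LinearMap.sub_apply, LinearMap.smul_apply, outerAd_one]

/-- The map x ↦ x ▹ (1 ⊗ 1) contributes (p₁ ▹ (1 ⊗ 1)) p₂ = p ⊗ 1, by `outerAd_ract`; the counit
part of the projection onto H⁺ contributes 1 ⊗ p. Thus the canonical map H⁺ → Ω¹H induces the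
universal derivation. -/
lemma incl_derivation_augToOmega (p : H) :
    incl K H (derivation (augToOmega K H) p) = p ⊗ₜ[K] 1 - 1 ⊗ₜ[K] p := by
  have e1 : ∀ t : H ⊗[K] H, incl K H (rightActMap (omega K H).ract
      ((augToOmega K H ∘ₗ augProj K H).rTensor H t)) =
      TensorProduct.lift (LinearMap.flip (opR H (mulR K H)))
        ((outerAd.flip (1 ⊗ₜ[K] 1)).rTensor H t) -
      1 ⊗ₜ[K] TensorProduct.lid K H ((Coalgebra.counit (R := K) (A := H)).rTensor H t) := by
    intro t
    induction t using TensorProduct.induction_on with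
    | zero => simp
    | add a b ha hb =>
      simp only [map_add, ha, hb, TensorProduct.tmul_add]
      abel
    | tmul a b =>
      rw [LinearMap.rTensor_tmul, rightActMap_tmul, incl_ract, LinearMap.comp_apply,
        incl_augToOmega_augProj, map_sub, map_smul, opR_tmul]
      simp
  refine (e1 (Coalgebra.comul p)).trans ?_
  rw [outerAd_ract, Coalgebra.rTensor_counit_comul]
  simp

/-- The universal derivation sends z = ∑ p ⊗ q to z - 1 ⊗ ∑ p q, and the correction vanishes on Ω¹H.
-/
lemma lift_augToOmega : (isAdMap_augToOmega K H).lift.toLin = LinearMap.id := by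
  have e : ∀ z : H ⊗[K] H, incl K H (outerLift (augToOmega K H) z) =
      z - 1 ⊗ₜ[K] LinearMap.mul' K H z := by
    intro z
    induction z using TensorProduct.induction_on with
    | zero => simp
    | add a b ha hb =>
      simp only [map_add, ha, hb, TensorProduct.tmul_add]
      abel
    | tmul p q =>
      rw [outerLift_tmul, incl_ract, incl_derivation_augToOmega]
      simp
  refine LinearMap.ext fun z => incl_injective ((e (incl K H z)).trans ?_)
  rw [mul_incl, TensorProduct.tmul_zero, sub_zero]
  rfl

/-- A morphism out of `Ω¹H` is determined by its restriction to `H⁺`. -/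
lemma omega_hom_eq_lift (f : omega K H ⟶ X) :
    f.toLin = ((isAdMap_augToOmega K H).comp f).lift.toLin := by
  rw [← (isAdMap_augToOmega K H).lift_comp, lift_augToOmega, LinearMap.comp_id]

/-- Evaluating the lift at x₁ ⊗ S(x₂) gives c(x₁ - ε(x₁)) x₂ S(x₃), where x₂ S(x₃) contracts to a
counit. Here `e1` is the regrouping by coassociativity and `e2` the contraction. -/
lemma IsAdMap.lift_augToOmega_apply {c : augIdeal K H →ₗ[K] X.carrier} (hc : X.IsAdMap c)
    (x : augIdeal K H) : hc.lift.toLin (augToOmega K H x) = c x := by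
  let d : H →ₗ[K] X.carrier := c ∘ₗ augProj K H
  let ψ : H ⊗[K] (H ⊗[K] H) →ₗ[K] X.carrier := rightActMap X.ract ∘ₗ
    TensorProduct.map d (LinearMap.mul' K H ∘ₗ (antipode K).lTensor H)
  have e1 : ∀ t : H ⊗[K] H, outerLift c ((antipode K (A := H)).lTensor H t) =
      ψ (TensorProduct.assoc K H H H ((Coalgebra.comul (R := K) (A := H)).rTensor H t)) := by
    intro t
    induction t using TensorProduct.induction_on with
    | zero => simp
    | add a b ha hb => simp only [map_add, ha, hb]
    | tmul a b =>
      rw [LinearMap.lTensor_tmul, outerLift_tmul, LinearMap.rTensor_tmul]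
      simp only [derivation, LinearMap.comp_apply]
      generalize (Coalgebra.comul (R := K) a) = s
      induction s using TensorProduct.induction_on with
      | zero => simp
      | add a b ha hb => simp only [map_add, TensorProduct.add_tmul, ha, hb]
      | tmul p q => simp [ψ, d]
  have e2 : ∀ t : H ⊗[K] H, ψ ((Coalgebra.comul (R := K) (A := H)).lTensor H t) =
      d (TensorProduct.rid K H ((Coalgebra.counit (R := K) (A := H)).lTensor H t)) := by
    intro t
    induction t using TensorProduct.induction_on with
    | zero => simp
    | add a b ha hb => simp only [map_add, ha, hb]
    | tmul a b =>
      simp only [LinearMap.lTensor_tmul, ψ, LinearMap.comp_apply, TensorProduct.map_tmul,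
        mul_antipode_lTensor_comul_apply, rightActMap_tmul, Algebra.algebraMap_eq_smul_one,
        MulOpposite.op_smul, MulOpposite.op_one, map_smul, map_one, LinearMap.smul_apply,
        Module.End.one_apply, TensorProduct.rid_tmul]
  have h1 : hc.lift.toLin (augToOmega K H x) =
      outerLift c ((antipode K (A := H)).lTensor H (Coalgebra.comul (x : H))) := rfl
  rw [h1, e1, Coalgebra.coassoc_apply, e2, Coalgebra.lTensor_counit_comul]
  have h2 := LinearMap.congr_fun (augProj_comp_subtype K H) x
  simp only [LinearMap.comp_apply, Submodule.subtype_apply, LinearMap.id_apply] at h2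
  simp [d, h2]

end HopfBimod

end Omega

/-! ## Free Yetter-Drinfeld modules -/

section Free

variable {K : Type u} [Field K] {H : Type v} [Ring H] [HopfAlgebra K H]
variable {V W : Type*} [AddCommGroup V] [Module K V] [AddCommGroup W] [Module K W]

variable (K H V) in
/-- The action of `H` on the left factor of `H ⊗ V`. -/
def freeAct : H →ₐ[K] Module.End K (H ⊗[K] V) :=
  (Module.End.rTensorAlgHom K H V).comp (Algebra.lmul K H)

@[simp] lemma freeAct_tmul (h a : H) (v : V) : freeAct K H V h (a ⊗ₜ v) = (h * a) ⊗ₜ v := rfl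

/-- The map `a ⊗ v ↦ a₍₁₎ v₍₋₁₎ S(a₍₃₎) ⊗ (a₍₂₎ ⊗ v₍₀₎)`. -/
def freeCoact (ρ : V →ₗ[K] H ⊗[K] V) : H ⊗[K] V →ₗ[K] H ⊗[K] (H ⊗[K] V) :=
  TensorProduct.lift ((adOp (freeAct K H V).toLinearMap).compl₂
    ((TensorProduct.mk K H V 1).lTensor H ∘ₗ ρ))

lemma freeCoact_tmul (ρ : V →ₗ[K] H ⊗[K] V) (a : H) (v : V) : freeCoact ρ (a ⊗ₜ v) =
    adOp (freeAct K H V).toLinearMap a ((TensorProduct.mk K H V 1).lTensor H (ρ v)) := rfl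

lemma adOp_one (l : H →ₐ[K] Module.End K W) (z : H ⊗[K] W) : adOp l.toLinearMap 1 z = z := by
  rw [adOp_eq_twist]
  induction z using TensorProduct.induction_on with
  | zero => simp
  | add a b ha hb => rw [map_add, ha, hb]
  | tmul a b => simp [Algebra.TensorProduct.one_def]

lemma freeCoact_one_tmul (ρ : V →ₗ[K] H ⊗[K] V) (v : V) :
    freeCoact ρ (1 ⊗ₜ v) = (TensorProduct.mk K H V 1).lTensor H (ρ v) := by
  rw [freeCoact_tmul, adOp_one]

lemma intertwines_freeCoact (ρ : V →ₗ[K] H ⊗[K] V) : Intertwines (freeCoact ρ)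
    (freeAct K H V).toLinearMap (adOp (freeAct K H V).toLinearMap) := by
  intro h z
  induction z using TensorProduct.induction_on with
  | zero => simp
  | add a b ha hb => simp only [map_add, ha, hb]
  | tmul a v =>
    rw [AlgHom.toLinearMap_apply, freeAct_tmul, freeCoact_tmul, freeCoact_tmul, adOp_mul]
    rfl

/-! ### Coassociativity and counit of the free coaction. -/

variable (K H W) in
/-- The map `g ⊗ m ↦ g₍₁₎ ⊗ (g₍₂₎ ⊗ m)`. -/
def comulLeft : H ⊗[K] W →ₗ[K] H ⊗[K] (H ⊗[K] W) :=
  (TensorProduct.assoc K H H W).toLinearMap ∘ₗ (Coalgebra.comul (R := K) (A := H)).rTensor W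

lemma comulLeft_tmul (g : H) (m : W) : comulLeft K H W (g ⊗ₜ m) =
    TensorProduct.assoc K H H W (Coalgebra.comul g ⊗ₜ m) := rfl

lemma comulLeft_lTensor (f : V →ₗ[K] W) (z : H ⊗[K] V) :
    comulLeft K H W (f.lTensor H z) = (f.lTensor H).lTensor H (comulLeft K H V z) := by
  induction z using TensorProduct.induction_on with
  | zero => simp
  | add a b ha hb => simp only [map_add, ha, hb]
  | tmul g v =>
    rw [LinearMap.lTensor_tmul, comulLeft_tmul, comulLeft_tmul]
    generalize (Coalgebra.comul (R := K) g) = t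
    induction t using TensorProduct.induction_on with
    | zero => simp
    | add a b ha hb => simp only [map_add, TensorProduct.add_tmul, ha, hb]
    | tmul a b => simp

/-- Δ(h₁ g S(h₃)) splits by multiplicativity of Δ and anti-comultiplicativity of S into an outer and
an inner conjugation, which are the two nested `adOp`. It reduces coassociativity of the free
coaction to generators 1 ⊗ v. -/
lemma intertwines_comulLeft (f : H →ₗ[K] Module.End K W) :
    Intertwines (comulLeft K H W) (adOp f) (adOp (adOp f)) := by
  have hl : Intertwines (comulLeft K H W) (opL W (mulL K H))
      (opL _ (mulL K H) ⋆ opR H (opL W (mulL K H))) := by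
    intro h z
    induction z using TensorProduct.induction_on with
    | zero => simp
    | add a b ha hb => simp only [map_add, ha, hb]
    | tmul g m =>
      rw [opL_tmul, comulLeft_tmul, comulLeft_tmul, LinearMap.mul_apply', Bialgebra.comul_mul,
        conv_apply]
      generalize (Coalgebra.comul (R := K) g) = s
      generalize (Coalgebra.comul (R := K) h) = t
      induction s using TensorProduct.induction_on with
      | zero => simp
      | add a b ha hb => simp only [map_add, mul_add, TensorProduct.add_tmul, ha, hb]
      | tmul a b =>
        induction t using TensorProduct.induction_on with
        | zero => simp
        | add a b ha hb => simp only [map_add, add_mul, TensorProduct.add_tmul,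
            LinearMap.add_apply, ha, hb]
        | tmul c d => simp
  have hr : Intertwines (comulLeft K H W) (opL W (mulR K H))
      (opL _ (mulR K H) ⋆ opR H (opL W (mulR K H))) := by
    intro h z
    induction z using TensorProduct.induction_on with
    | zero => simp
    | add a b ha hb => simp only [map_add, ha, hb]
    | tmul g m =>
      rw [opL_tmul, comulLeft_tmul, comulLeft_tmul, LinearMap.flip_apply, LinearMap.mul_apply',
        Bialgebra.comul_mul, conv_apply]
      generalize (Coalgebra.comul (R := K) g) = s
      generalize (Coalgebra.comul (R := K) h) = t
      induction s using TensorProduct.induction_on with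
      | zero => simp
      | add a b ha hb => simp only [map_add, add_mul, TensorProduct.add_tmul, ha, hb]
      | tmul a b =>
        induction t using TensorProduct.induction_on with
        | zero => simp
        | add a b ha hb => simp only [map_add, mul_add, TensorProduct.add_tmul,
            LinearMap.add_apply, ha, hb]
        | tmul c d => simp
  have hf : Intertwines (comulLeft K H W) (opR H f) (opR H (opR H f)) := by
    intro h z
    induction z using TensorProduct.induction_on with
    | zero => simp
    | add a b ha hb => simp only [map_add, ha, hb]
    | tmul g m =>
      rw [opR_tmul, comulLeft_tmul, comulLeft_tmul]
      generalize (Coalgebra.comul (R := K) g) = s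
      induction s using TensorProduct.induction_on with
      | zero => simp
      | add a b ha hb => simp only [map_add, TensorProduct.add_tmul, ha, hb]
      | tmul a b => simp
  have h := hl.conv (hf.conv hr.comp_antipode)
  rw [conv_comp_antipode] at h
  · simpa only [adOp, opR_conv, conv_assoc, opR_comp_antipode] using h
  · intro a b
    refine TensorProduct.ext' fun x m => ?_
    simp

lemma convUnit_comp_antipode :
    (convUnit : H →ₗ[K] Module.End K W) ∘ₗ antipode K = convUnit := by
  rw [convUnit, LinearMap.comp_assoc, counit_comp_antipode]

/-- Under ε both multiplications become scalars ε(h), and ε ∘ S = ε, so only f remains. It reduces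
the counit axiom of the free coaction to generators. -/
lemma intertwines_counit (f : H →ₗ[K] Module.End K W) :
    Intertwines ((Coalgebra.counit (R := K) (A := H)).rTensor W) (adOp f) (opR K f) := by
  have hl : Intertwines ((Coalgebra.counit (R := K) (A := H)).rTensor W) (opL W (mulL K H))
      convUnit := by
    intro h z
    rw [convUnit_apply]
    induction z using TensorProduct.induction_on with
    | zero => simp
    | add a b ha hb => simp only [map_add, smul_add, ha, hb]
    | tmul g m => simp [TensorProduct.smul_tmul']
  have hr : Intertwines ((Coalgebra.counit (R := K) (A := H)).rTensor W) (opL W (mulR K H))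
      convUnit := by
    intro h z
    rw [convUnit_apply]
    induction z using TensorProduct.induction_on with
    | zero => simp
    | add a b ha hb => simp only [map_add, smul_add, ha, hb]
    | tmul g m => simp [TensorProduct.smul_tmul', mul_comm]
  have h := hl.conv ((Intertwines.opR_rTensor (M := H)
    (Coalgebra.counit (R := K) (A := H)) f).conv hr.comp_antipode)
  rwa [convUnit_comp_antipode, conv_convUnit, convUnit_conv] at h

/-- The free Yetter-Drinfeld module `H ⊗ V` on a left comodule `V`. -/
def freeYetterDrinfeld {V : Type v} [AddCommGroup V] [Module K V] (ρ : LeftCoaction K H V) :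
    YetterDrinfeld.{v} K H where
  carrier := H ⊗[K] V
  coact :=
    { toLin := freeCoact ρ.toLin
      coassoc := by
        have h1 : freeCoact ρ.toLin ∘ₗ TensorProduct.mk K H V 1 =
            (TensorProduct.mk K H V 1).lTensor H ∘ₗ ρ.toLin :=
          LinearMap.ext (freeCoact_one_tmul ρ.toLin)
        refine TensorProduct.ext' fun a v => ?_
        change comulLeft K H (H ⊗[K] V) (freeCoact ρ.toLin (a ⊗ₜ v)) =
          (freeCoact ρ.toLin).lTensor H (freeCoact ρ.toLin (a ⊗ₜ v))
        -- Both sides are the operator `adOp (adOp _)` of a applied to their values at 1 ⊗ v, where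
        -- coassociativity is that of ρ.
        rw [freeCoact_tmul, intertwines_comulLeft, (intertwines_freeCoact ρ.toLin).adOp,
          comulLeft_lTensor, ← LinearMap.lTensor_comp_apply, h1, LinearMap.lTensor_comp_apply]
        congr 2
        exact LinearMap.congr_fun ρ.coassoc v
      counit := by
        refine TensorProduct.ext' fun a v => ?_
        have h1 := LinearMap.congr_fun ρ.counit v
        simp only [LinearMap.comp_apply] at h1
        have h2 : (Coalgebra.counit (R := K) (A := H)).rTensor (H ⊗[K] V)
            ((TensorProduct.mk K H V 1).lTensor H (ρ.toLin v)) =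
            (TensorProduct.mk K H V 1).lTensor K
              ((Coalgebra.counit (R := K) (A := H)).rTensor V (ρ.toLin v)) :=
          LinearMap.congr_fun ((LinearMap.rTensor_comp_lTensor ..).trans
            (LinearMap.lTensor_comp_rTensor ..).symm) (ρ.toLin v)
        rw [LinearMap.comp_apply, freeCoact_tmul, intertwines_counit, h2, h1]
        simp }
  act := freeAct K H V
  compat h z := by
    rw [← adOp_eq_twist]
    exact intertwines_freeCoact ρ.toLin h z

lemma unit_leftColinear {V : Type v} [AddCommGroup V] [Module K V] (ρ : LeftCoaction K H V) :
    IsLeftColinear ρ (freeYetterDrinfeld ρ).coact (TensorProduct.mk K H V 1) :=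
  LinearMap.ext (freeCoact_one_tmul ρ.toLin)

lemma leftActMap_freeAct (l : H →ₐ[K] Module.End K W) (t : V →ₗ[K] W) :
    Intertwines (leftActMap l ∘ₗ t.lTensor H) (freeAct K H V).toLinearMap l.toLinearMap := by
  intro h z
  induction z using TensorProduct.induction_on with
  | zero => simp
  | add a b ha hb => simp only [map_add, ha, hb]
  | tmul a b => simp

/-- The morphism `H ⊗ V ⟶ X`, `a ⊗ v ↦ a t(v)`, given by a colinear map `t : V → X`. -/
def freeHom {V : Type v} [AddCommGroup V] [Module K V] {ρ : LeftCoaction K H V}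
    {X : YetterDrinfeld.{v} K H} {t : V →ₗ[K] X.carrier} (ht : IsLeftColinear ρ X.coact t) :
    freeYetterDrinfeld ρ ⟶ X where
  toLin := leftActMap X.act ∘ₗ t.lTensor H
  colinear := by
    refine TensorProduct.ext' fun a v => ?_
    change X.coact.toLin (X.act a (t v)) =
      (leftActMap X.act ∘ₗ t.lTensor H).lTensor H (freeCoact ρ.toLin (a ⊗ₜ v))
    have e : (leftActMap X.act ∘ₗ t.lTensor H) ∘ₗ TensorProduct.mk K H V 1 = t := by
      ext; simp
    -- By linearity of the map and the Yetter–Drinfeld condition of X, colinearity at a ⊗ v follows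
    -- from that of t at v.
    rw [freeCoact_tmul, (leftActMap_freeAct X.act t).adOp, ← LinearMap.lTensor_comp_apply, e]
    have h1 := LinearMap.congr_fun ht v
    simp only [LinearMap.comp_apply] at h1
    rw [← h1]
    exact X.intertwines a (t v)
  map_act := leftActMap_freeAct X.act t

end Free

/-! ## Complete fs-sections -/

section Sections

variable {K : Type u} [Field K] {H : Type v} [Ring H] [HopfAlgebra K H]

/-- Since S(a₃ x₃) = S(x₃) S(a₃), the left side is the adjoint coaction of x conjugated by a, that
is, the recipe of `freeCoact`. -/
lemma adCoact_mul_tmul (a x : H) : adCoact (LinearMap.mul' K H) (a ⊗ₜ[K] x) =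
    adOp (freeAct K H H).toLinearMap a
      ((TensorProduct.mk K H H 1).lTensor H (adCoact LinearMap.id x)) := by
  rw [adOp_eq_twist, adCoact_apply, adCoact_apply, TensorProduct.comul_tmul]
  generalize (Coalgebra.comul (R := K) a) = s
  generalize (Coalgebra.comul (R := K) x) = t
  induction s using TensorProduct.induction_on with
  | zero => simp
  | add a b ha hb => simp only [map_add, TensorProduct.add_tmul, LinearMap.add_apply, ha, hb]
  | tmul a b =>
    induction t using TensorProduct.induction_on with
    | zero => simp
    | add a b ha hb => simp only [map_add, TensorProduct.tmul_add, ha, hb]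
    | tmul x y =>
      simp only [TensorProduct.AlgebraTensorModule.tensorTensorTensorComm_tmul,
        LinearMap.lTensor_tmul, TensorProduct.comul_tmul]
      generalize (Coalgebra.comul (R := K) b) = s
      generalize (Coalgebra.comul (R := K) y) = t
      induction s using TensorProduct.induction_on with
      | zero => simp
      | add a b ha hb => simp only [map_add, TensorProduct.add_tmul, TensorProduct.tmul_add,
          LinearMap.add_apply, ha, hb]
      | tmul b c =>
        induction t using TensorProduct.induction_on with
        | zero => simp
        | add a b ha hb => simp only [map_add, TensorProduct.tmul_add, ha, hb]
        | tmul y z => simp [antipode_mul_antidistrib, mul_assoc]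

lemma adCoact_incl (t : H ⊗[K] augIdeal K H) :
    adCoact (LinearMap.mul' K H) ((augIdeal K H).subtype.lTensor H t) =
      ((augIdeal K H).subtype.lTensor H).lTensor H (freeCoact (augCoaction K H).toLin t) := by
  have h1 : Intertwines ((augIdeal K H).subtype.lTensor H) (freeAct K H (augIdeal K H)).toLinearMap
      (freeAct K H H).toLinearMap := Intertwines.opL_lTensor _ (mulL K H)
  have h2 : (augIdeal K H).subtype.lTensor H ∘ₗ TensorProduct.mk K H (augIdeal K H) 1 =
      TensorProduct.mk K H H 1 ∘ₗ (augIdeal K H).subtype := rfl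
  induction t using TensorProduct.induction_on with
  | zero => simp
  | add a b ha hb => simp only [map_add, ha, hb]
  | tmul a x =>
    rw [LinearMap.lTensor_tmul, Submodule.subtype_apply, adCoact_mul_tmul, freeCoact_tmul, h1.adOp,
      ← LinearMap.lTensor_comp_apply, h2, LinearMap.lTensor_comp_apply, augCoaction_coe]

/-- Condition (iii) is colinearity of τ into the free Yetter–Drinfeld module. The comparison in H ⊗
(H ⊗ H) loses nothing, since tensoring over a field preserves injectivity. -/
lemma freeCoact_eq_iff (τ : augIdeal K H →ₗ[K] H ⊗[K] augIdeal K H) (x : augIdeal K H) :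
    adCoact (LinearMap.mul' K H) ((augIdeal K H).subtype.lTensor H (τ x)) =
      ((augIdeal K H).subtype.lTensor H ∘ₗ τ).lTensor H ((augCoaction K H).toLin x) ↔
    freeCoact (augCoaction K H).toLin (τ x) = τ.lTensor H ((augCoaction K H).toLin x) := by
  rw [adCoact_incl, LinearMap.lTensor_comp_apply]
  exact (Module.Flat.lTensor_preserves_injective_linearMap (M := H) _
    (Module.Flat.lTensor_preserves_injective_linearMap (M := H) (augIdeal K H).subtype
      (augIdeal K H).injective_subtype)).eq_iff

/-- A complete fs-section as a morphism of Yetter-Drinfeld modules. -/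
def IsCompleteFsSection.hom {τ : augIdeal K H →ₗ[K] H ⊗[K] augIdeal K H}
    (hτ : IsCompleteFsSection τ) :
    augYetterDrinfeld K H ⟶ freeYetterDrinfeld (augCoaction K H) where
  toLin := τ
  colinear := LinearMap.ext fun x => (freeCoact_eq_iff τ x).1 (hτ.colinear x)
  map_act := hτ.map_act

lemma isCompleteFsSection_of_hom (f : augYetterDrinfeld K H ⟶ freeYetterDrinfeld (augCoaction K H))
    (hf : ∀ x : augIdeal K H, leftActMap (augAct K H) (f.toLin x) = x) :
    IsCompleteFsSection (K := K) (H := H) f.toLin where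
  map_act := f.map_act
  mul_eq := hf
  colinear x := (freeCoact_eq_iff f.toLin x).2 (LinearMap.congr_fun f.colinear x)

/-- If `H⁺` is projective relative to the functor that forgets the action, then there is a complete
fs-section. -/
lemma exists_completeFsSection
    (h : RelProjective (YetterDrinfeld.forget.{v} K H) (augYetterDrinfeld K H)) :
    ∃ τ : augIdeal K H →ₗ[K] H ⊗[K] augIdeal K H, IsCompleteFsSection τ := by
  -- The multiplication H ⊗ H⁺ → H⁺, as the extension of the identity of H⁺; lifting the identity
  -- along it produces τ.
  let p : freeYetterDrinfeld (augCoaction K H) ⟶ augYetterDrinfeld K H :=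
    freeHom (X := augYetterDrinfeld K H) (IsLeftColinear.id (augCoaction K H))
  let s : (YetterDrinfeld.forget K H).obj (augYetterDrinfeld K H) ⟶
      (YetterDrinfeld.forget K H).obj (freeYetterDrinfeld (augCoaction K H)) :=
    ⟨TensorProduct.mk K H (augIdeal K H) 1, unit_leftColinear _⟩
  have hp : IsSplitEpi ((YetterDrinfeld.forget K H).map p) := by
    refine ⟨⟨⟨s, ?_⟩⟩⟩
    refine LeftComod.Hom.ext (LinearMap.ext fun x => ?_)
    change augAct K H 1 x = x
    rw [map_one]
    rfl
  obtain ⟨l, hl⟩ := h p hp (𝟙 _)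
  refine ⟨l.toLin, isCompleteFsSection_of_hom l fun x => ?_⟩
  have h1 := LinearMap.congr_fun (congrArg (fun f => f.toLin) hl) x
  have h2 : leftActMap (augAct K H) (LinearMap.id.lTensor H (l.toLin x)) = x := h1
  rwa [LinearMap.lTensor_id] at h2

/-- A complete fs-section makes `H` formally smooth. -/
lemma IsCompleteFsSection.formallySmooth {τ : augIdeal K H →ₗ[K] H ⊗[K] augIdeal K H}
    (hτ : IsCompleteFsSection τ) : (BicomodAlgebra.regular K H).FormallySmooth := by
  intro X Y f hf g
  obtain ⟨⟨⟨s, hs⟩⟩⟩ := hf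
  have hs' : ∀ y, f.toLin (s.toLin y) = y := fun y =>
    LinearMap.congr_fun (congrArg Bicomod.Hom.toLin hs) y
  have hg := (HopfBimod.isAdMap_augToOmega K H).comp g
  -- The bicomodule section s transports the restriction of g to X colinearly and with coinvariant
  -- values, but not ▹-linearly. Extending to H ⊗ H⁺ and composing with τ restores ▹-linearity.
  let g' : augIdeal K H →ₗ[K] Y.carrier := g.toLin ∘ₗ HopfBimod.augToOmega K H
  let t : augIdeal K H →ₗ[K] X.carrier := s.toLin ∘ₗ g'
  have ht : IsLeftColinear (augCoaction K H) (HopfBimod.toYetterDrinfeld X).coact t :=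
    IsLeftColinear.comp s.left hg.colinear
  let e := hτ.hom ≫ freeHom ht
  have he : HopfBimod.IsAdMap X e.toLin := by
    refine ⟨e.colinear, fun x => ?_, e.map_act⟩
    change HopfBimod.IsCoinvariant X (leftActMap (HopfBimod.ad X) (t.lTensor H (τ x)))
    generalize τ x = z
    induction z using TensorProduct.induction_on with
    | zero => simp [HopfBimod.IsCoinvariant]
    | add a b ha hb =>
      rw [map_add, map_add]
      exact ha.add hb
    | tmul a b =>
      -- Values of e are sums of a ▹ t(b): right colinearity of s makes t(b) coinvariant, and the
      -- adjoint action keeps it so.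
      exact HopfBimod.IsCoinvariant.ad X
        (HopfBimod.rightColinear_isCoinvariant s.right (hg.coinvariant b)) a
  refine ⟨he.lift, ?_⟩
  refine BicomodBimod.Hom.ext ?_
  -- With τ(x) = ∑ a ⊗ b, f sends ∑ a ▹ t(b) to ∑ a ▹ g'(b) = g'(∑ a b) = g'(x), by f ∘ s = id and ∑
  -- a b = x. Agreement on H⁺ determines the morphisms out of Ω¹H.
  have h1 : f.toLin ∘ₗ e.toLin = g' := by
    have h2 : ∀ z : H ⊗[K] augIdeal K H,
        f.toLin (leftActMap (HopfBimod.ad X) (t.lTensor H z)) = g' (leftActMap (augAct K H) z) := by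
      intro z
      induction z using TensorProduct.induction_on with
      | zero => simp
      | add a b ha hb => simp only [map_add, ha, hb]
      | tmul a b =>
        rw [leftActMap_tmul, LinearMap.lTensor_tmul, leftActMap_tmul]
        refine (HopfBimod.hom_ad f a (t b)).trans ?_
        refine Eq.trans ?_ (hg.map_act a b).symm
        exact congrArg (HopfBimod.ad Y a) (hs' (g' b))
    exact LinearMap.ext fun x => (h2 (τ x)).trans (congrArg g' (hτ.mul_eq x))
  change f.toLin ∘ₗ he.lift.toLin = g.toLin
  rw [he.lift_comp f, HopfBimod.omega_hom_eq_lift g]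
  simp only [HopfBimod.IsAdMap.lift_toLin]
  exact congrArg (fun c => HopfBimod.outerLift c ∘ₗ HopfBimod.incl K H) h1

/-- If `H` is formally smooth, then `H⁺` is projective relative to the functor that forgets the
action. -/
lemma relProjective_of_formallySmooth (h : (BicomodAlgebra.regular K H).FormallySmooth) :
    RelProjective (YetterDrinfeld.forget.{v} K H) (augYetterDrinfeld K H) := by
  intro X Y f hf g
  obtain ⟨⟨⟨s, hs⟩⟩⟩ := hf
  have hs' : ∀ y, f.toLin (s.toLin y) = y := fun y =>
    LinearMap.congr_fun (congrArg LeftComod.Hom.toLin hs) y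
  have hsplit : IsSplitEpi ((BicomodBimod.forget _).map (YetterDrinfeld.inducedMap f)) := by
    have h1 := YetterDrinfeld.induced_colinear (V := Y) (W := X) s.toLin s.colinear
    let s' : Y.induced.toBicomod ⟶ X.induced.toBicomod := ⟨s.toLin.rTensor H, h1.1, h1.2⟩
    refine ⟨⟨⟨s', ?_⟩⟩⟩
    refine Bicomod.Hom.ext ?_
    change f.toLin.rTensor H ∘ₗ s.toLin.rTensor H = LinearMap.id
    let s₀ : Y.carrier →ₗ[K] X.carrier := s.toLin
    have hfs : f.toLin ∘ₗ s₀ = LinearMap.id := LinearMap.ext hs'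
    exact (LinearMap.rTensor_comp H f.toLin s₀).symm.trans
      ((congrArg (LinearMap.rTensor H) hfs).trans (LinearMap.rTensor_id H Y.carrier))
  -- The map x ↦ g(x) ⊗ 1 is the restriction to H⁺ of a morphism Ω¹H → Y ⊗ H, and that morphism is
  -- lifted along f ⊗ H.
  have hc : HopfBimod.IsAdMap Y.induced (Y.toInduced ∘ₗ g.toLin) := by
    refine ⟨IsLeftColinear.comp Y.toInduced_colinear g.colinear,
      fun x => Y.isCoinvariant_toInduced _, fun a x => ?_⟩
    exact (congrArg Y.toInduced (g.map_act a x)).trans (Y.toInduced_act a _)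
  obtain ⟨l, hl⟩ := h (YetterDrinfeld.inducedMap f) hsplit hc.lift
  have hd := (HopfBimod.isAdMap_augToOmega K H).comp l
  let d : augIdeal K H →ₗ[K] X.carrier ⊗[K] H := l.toLin ∘ₗ HopfBimod.augToOmega K H
  -- The restriction of l to H⁺ takes coinvariant values, so it factors through X ⊗ 1; this
  -- factorization is the required lift to X.
  have hd' : ∀ x, X.toInduced (X.ofInduced (d x)) = d x :=
    fun x => X.toInduced_ofInduced (hd.coinvariant x)
  let m : augYetterDrinfeld K H ⟶ X :=
    { toLin := X.ofInduced ∘ₗ d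
      colinear := by
        refine IsLeftColinear.of_comp X.toInduced_injective X.toInduced_colinear ?_
        have h1 : X.toInduced ∘ₗ X.ofInduced ∘ₗ d = d := LinearMap.ext hd'
        have h2 : IsLeftColinear (augCoaction K H) (X.coact.tensor (comulCoaction K H)) d :=
          hd.colinear
        rw [← h1] at h2
        exact h2
      map_act := fun a x => X.toInduced_injective (by
        refine (hd' _).trans ((hd.map_act a x).trans ?_)
        rw [X.toInduced_act]
        exact congrArg (X.induced.ad a) (hd' x).symm) }
  refine ⟨m, YetterDrinfeld.Hom.ext (LinearMap.ext fun x => Y.toInduced_injective ?_)⟩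
  have h1 : f.toLin.rTensor H (d x) = Y.toInduced (g.toLin x) :=
    (LinearMap.congr_fun (congrArg (fun k => k.toLin) hl) (HopfBimod.augToOmega K H x)).trans
      (hc.lift_augToOmega_apply x)
  refine Eq.trans ?_ h1
  rw [← hd' x]
  rfl

end Sections

/-! ## Finite dimensional Hopf algebras -/

section FiniteDimensional

variable {K : Type u} [Field K] {H : Type v} [Ring H] [HopfAlgebra K H]

lemma augIdeal_mul_top_le : augIdeal K H * ⊤ ≤ augIdeal K H :=
  Submodule.mul_le.2 fun a ha b _ => by
    simp only [augIdeal, LinearMap.mem_ker] at ha ⊢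
    simp [ha]

/-- Exponents start at 1: the zeroth power of a subspace is K·1, which is in general not a right
ideal. -/
lemma augIdeal_pow_mul_top_le (n : ℕ) : augIdeal K H ^ (n + 1) * ⊤ ≤ augIdeal K H ^ (n + 1) := by
  rw [pow_succ, mul_assoc]
  exact mul_le_mul' le_rfl augIdeal_mul_top_le

lemma augProj_of_mem {x : H} (hx : x ∈ augIdeal K H) : augProj K H x = ⟨x, hx⟩ :=
  LinearMap.congr_fun (augProj_comp_subtype K H) ⟨x, hx⟩

/-- In a finite dimensional Hopf algebra, a left linear map `H⁺ → H` has values in `H⁺`. -/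
lemma counit_eq_zero_of_leftLinear [FiniteDimensional K H] (α : augIdeal K H →ₗ[K] H)
    (hα : ∀ h x, α (augAct K H h x) = h * α x) (x : augIdeal K H) :
    Coalgebra.counit (R := K) (α x) = 0 := by
  by_contra hx
  let I := augIdeal K H
  -- Rescaling x makes α(y) congruent to 1 modulo H⁺. It will follow that no power of y falls one
  -- step deeper in the filtration by powers of H⁺ than it must, which is incompatible with
  -- stabilization.
  obtain ⟨y, hy⟩ : ∃ y : I, Coalgebra.counit (R := K) (α y) = 1 :=
    ⟨(Coalgebra.counit (R := K) (α x))⁻¹ • x, by simp [inv_mul_cancel₀ hx]⟩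
  -- An extension of α to all of H, so that it can be applied to powers of y and to elements of
  -- powers of I without membership proofs. It is left linear only on I, which is what `hβ` records.
  let β : H →ₗ[K] H := α ∘ₗ augProj K H
  have hβ : ∀ a, ∀ b ∈ I, β (a * b) = a * β b := fun a b hb => by
    have hab : a * b ∈ augIdeal K H := (augAct K H a ⟨b, hb⟩).2
    change α (augProj K H (a * b)) = a * α (augProj K H b)
    rw [augProj_of_mem hab, augProj_of_mem hb, ← hα]
    rfl
  have hβy : β y = α y := congrArg α (augProj_of_mem y.2)
  -- β lowers the filtration by one: on a product a b with b in I it gives a β(b), and positive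
  -- powers of I absorb β(b) on the right.
  have hmem : ∀ n, ∀ z ∈ I ^ (n + 2), β z ∈ I ^ (n + 1) := fun n z hz => by
    rw [pow_succ] at hz
    refine Submodule.mul_induction_on hz (fun a ha b hb => ?_) (fun a b ha hb => ?_)
    · rw [hβ a b hb]
      exact augIdeal_pow_mul_top_le n (Submodule.mul_mem_mul ha trivial)
    · rw [map_add]
      exact add_mem ha hb
  have hpow : ∀ n, (y : H) ^ (n + 1) ∉ I ^ (n + 2) := by
    intro n
    induction n with
    | zero =>
      intro h
      have h1 := hmem 0 _ h
      rw [zero_add, pow_one, pow_one, hβy] at h1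
      exact one_ne_zero (hy.symm.trans h1)
    | succ n ih =>
      intro h
      have h1 := hmem (n + 1) _ h
      rw [pow_succ (y : H), hβ _ _ y.2, hβy] at h1
      -- β(yⁿ⁺²) = yⁿ⁺¹ α(y) differs from yⁿ⁺¹ by yⁿ⁺¹ (α(y) - 1), an element of Iⁿ⁺². So yⁿ⁺² in
      -- Iⁿ⁺³ would force yⁿ⁺¹ in Iⁿ⁺².
      have h2 : α y - 1 ∈ I := by
        change Coalgebra.counit (R := K) (α y - 1) = 0
        rw [map_sub, hy, Bialgebra.counit_one, sub_self]
      have h3 : (y : H) ^ (n + 1) * (α y - 1) ∈ I ^ (n + 2) := by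
        rw [pow_succ I (n + 1)]
        exact Submodule.mul_mem_mul (Submodule.pow_mem_pow I y.2 (n + 1)) h2
      have h4 := sub_mem h1 h3
      rw [mul_sub, mul_one, sub_sub_cancel] at h4
      exact ih h4
  have hanti : Antitone fun n => I ^ (n + 1) := antitone_nat_of_succ_le fun n => by
    rw [pow_succ]
    exact (mul_le_mul' le_rfl le_top).trans (augIdeal_pow_mul_top_le n)
  -- Finite dimension enters here: the descending chain of powers stabilizes, so yⁿ⁺¹ does lie in
  -- Iⁿ⁺² for some n.
  obtain ⟨n, hn⟩ := IsArtinian.monotone_stabilizes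
    (⟨fun n => OrderDual.toDual (I ^ (n + 1)), fun a b h => hanti h⟩ :
      ℕ →o (Submodule K H)ᵒᵈ)
  have h1 : I ^ (n + 1) = I ^ (n + 2) := hn (n + 1) n.le_succ
  exact hpow n (h1 ▸ Submodule.pow_mem_pow I y.2 (n + 1))

/-- In a finite dimensional Hopf algebra, fs-sections have values in `H⁺ ⊗ H⁺`. -/
lemma IsFsSection.rTensor_counit [FiniteDimensional K H]
    {τ : augIdeal K H →ₗ[K] H ⊗[K] augIdeal K H} (hτ : IsFsSection τ) (x : augIdeal K H) :
    (Coalgebra.counit (R := K) (A := H)).rTensor (augIdeal K H) (τ x) = 0 := by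
  -- Linear functionals ψ on H⁺ separate points, and for each of them (id ⊗ ψ) ∘ τ is a left linear
  -- map H⁺ → H, to which `counit_eq_zero_of_leftLinear` applies.
  rw [← (TensorProduct.lid K (augIdeal K H)).map_eq_zero_iff,
    ← Module.forall_dual_apply_eq_zero_iff K]
  intro ψ
  let γ : H ⊗[K] augIdeal K H →ₗ[K] H := (TensorProduct.rid K H).toLinearMap ∘ₗ ψ.lTensor H
  have h1 : ∀ (h : H) t, γ ((LinearMap.mulLeft K h).rTensor (augIdeal K H) t) = h * γ t := by
    intro h t
    induction t using TensorProduct.induction_on with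
    | zero => simp
    | add a b ha hb => simp only [map_add, mul_add, ha, hb]
    | tmul a b => simp [γ]
  have h2 : ∀ t, Coalgebra.counit (R := K) (γ t) = ψ (TensorProduct.lid K (augIdeal K H)
      ((Coalgebra.counit (R := K) (A := H)).rTensor (augIdeal K H) t)) := by
    intro t
    induction t using TensorProduct.induction_on with
    | zero => simp
    | add a b ha hb => simp only [map_add, ha, hb]
    | tmul a b => simp [γ, mul_comm]
  rw [← h2]
  exact counit_eq_zero_of_leftLinear (γ ∘ₗ τ)
    (fun h x => (congrArg γ (hτ.map_act h x)).trans (h1 h (τ x))) x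

lemma map_subtype_eq (t : augIdeal K H ⊗[K] augIdeal K H) :
    TensorProduct.map (augIdeal K H).subtype (augIdeal K H).subtype t =
      (augIdeal K H).subtype.lTensor H ((augIdeal K H).subtype.rTensor (augIdeal K H) t) := by
  rw [← LinearMap.comp_apply, LinearMap.lTensor_comp_rTensor]

/-- A section of the multiplication `H⁺ ⊗ H⁺ → H⁺` as in `IsAugMulSection` is a complete
fs-section. -/
lemma IsAugMulSection.isCompleteFsSection
    {τ : augIdeal K H →ₗ[K] augIdeal K H ⊗[K] augIdeal K H} (hτ : IsAugMulSection τ) :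
    IsCompleteFsSection ((augIdeal K H).subtype.rTensor (augIdeal K H) ∘ₗ τ) where
  map_act h x := by
    rw [LinearMap.comp_apply, hτ.map_act, LinearMap.comp_apply, ← LinearMap.rTensor_comp_apply,
      ← LinearMap.rTensor_comp_apply]
    rfl
  mul_eq x := LinearMap.congr_fun hτ.section_eq x
  colinear x := by
    have e : (augIdeal K H).subtype.lTensor H ∘ₗ
        (augIdeal K H).subtype.rTensor (augIdeal K H) ∘ₗ τ =
        TensorProduct.map (augIdeal K H).subtype (augIdeal K H).subtype ∘ₗ τ :=
      LinearMap.ext fun x => (map_subtype_eq (τ x)).symm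
    rw [e, ← hτ.colinear, map_subtype_eq, LinearMap.comp_apply]

/-- In a finite dimensional Hopf algebra, a complete fs-section gives a section of the
multiplication `H⁺ ⊗ H⁺ → H⁺`. -/
lemma IsCompleteFsSection.exists_augMulSection [FiniteDimensional K H]
    {τ : augIdeal K H →ₗ[K] H ⊗[K] augIdeal K H} (hτ : IsCompleteFsSection τ) :
    ∃ σ : augIdeal K H →ₗ[K] augIdeal K H ⊗[K] augIdeal K H, IsAugMulSection σ := by
  let i := (augIdeal K H).subtype.rTensor (augIdeal K H)
  let σ := (augProj K H).rTensor (augIdeal K H) ∘ₗ τ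
  have hi : Function.Injective i :=
    Module.Flat.rTensor_preserves_injective_linearMap _ (augIdeal K H).injective_subtype
  -- Projecting the first factor to H⁺ subtracts 1 ⊗ (ε ⊗ id)(τ(x)), which is zero. Hence τ factors
  -- through H⁺ ⊗ H⁺, and the properties of σ are those of τ read through the injection i.
  have hσ : ∀ x, i (σ x) = τ x := by
    intro x
    have e : (augIdeal K H).subtype ∘ₗ augProj K H =
      LinearMap.id - Algebra.linearMap K H ∘ₗ Coalgebra.counit := rfl
    change (augIdeal K H).subtype.rTensor (augIdeal K H)
      ((augProj K H).rTensor (augIdeal K H) (τ x)) = τ x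
    rw [← LinearMap.rTensor_comp_apply, e, LinearMap.rTensor_sub, LinearMap.sub_apply,
      LinearMap.rTensor_comp_apply, hτ.toIsFsSection.rTensor_counit, map_zero, sub_zero,
      LinearMap.rTensor_id, LinearMap.id_apply]
  refine ⟨σ, fun h x => hi ?_, LinearMap.ext fun x => ?_, fun x => ?_⟩
  · rw [hσ, hτ.map_act, ← hσ]
    simp only [i]
    rw [← LinearMap.rTensor_comp_apply, ← LinearMap.rTensor_comp_apply]
    rfl
  · change leftActMap (augAct K H) (i (σ x)) = x
    rw [hσ, hτ.mul_eq]
  · have e : TensorProduct.map (augIdeal K H).subtype (augIdeal K H).subtype ∘ₗ σ =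
        (augIdeal K H).subtype.lTensor H ∘ₗ τ :=
      LinearMap.ext fun x => (map_subtype_eq (σ x)).trans
        (congrArg ((augIdeal K H).subtype.lTensor H) (hσ x))
    rw [e, ← hτ.colinear, ← LinearMap.comp_apply (TensorProduct.map _ _) σ, e,
      LinearMap.comp_apply]

end FiniteDimensional

end HopfSmooth

end

theorem mainTheorem8 (K : Type u) [Field K] (H : Type v) [Ring H] [HopfAlgebra K H] :
    List.TFAE
      [(HopfSmooth.BicomodAlgebra.regular K H).FormallySmooth,
        HopfSmooth.RelProjective (HopfSmooth.YetterDrinfeld.forget.{v} K H)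
          (HopfSmooth.augYetterDrinfeld K H),
        ∃ τ : HopfSmooth.augIdeal K H →ₗ[K] H ⊗[K] HopfSmooth.augIdeal K H,
          HopfSmooth.IsCompleteFsSection τ] ∧
    (FiniteDimensional K H → List.TFAE
      [(HopfSmooth.BicomodAlgebra.regular K H).FormallySmooth,
        HopfSmooth.RelProjective (HopfSmooth.YetterDrinfeld.forget.{v} K H)
          (HopfSmooth.augYetterDrinfeld K H),
        ∃ τ : HopfSmooth.augIdeal K H →ₗ[K] H ⊗[K] HopfSmooth.augIdeal K H,
          HopfSmooth.IsCompleteFsSection τ,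
        ∃ τ : HopfSmooth.augIdeal K H →ₗ[K]
            HopfSmooth.augIdeal K H ⊗[K] HopfSmooth.augIdeal K H,
          HopfSmooth.IsAugMulSection τ]) := by
  have hab := HopfSmooth.relProjective_of_formallySmooth (K := K) (H := H)
  have hbc := HopfSmooth.exists_completeFsSection (K := K) (H := H)
  have hca : (∃ τ : HopfSmooth.augIdeal K H →ₗ[K] H ⊗[K] HopfSmooth.augIdeal K H,
      HopfSmooth.IsCompleteFsSection τ) → (HopfSmooth.BicomodAlgebra.regular K H).FormallySmooth :=
    fun ⟨_, hτ⟩ => hτ.formallySmooth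
  refine ⟨?_, fun _ => ?_⟩
  · tfae_have 1 → 2 := hab
    tfae_have 2 → 3 := hbc
    tfae_have 3 → 1 := hca
    tfae_finish
  · tfae_have 1 → 2 := hab
    tfae_have 2 → 3 := hbc
    tfae_have 3 → 1 := hca
    tfae_have 3 → 4 := fun ⟨_, hτ⟩ => hτ.exists_augMulSection
    tfae_have 4 → 3 := fun ⟨_, hτ⟩ => ⟨_, hτ.isCompleteFsSection⟩
    tfae_finish
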